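/- Let $\Bbbk$ be a field; $\otimes$ and $\mathrm{Hom}$ without decoration are over $\Bbbk$, and Sweedler notation is used. Let $H$ be a coquasi-Hopf algebra over $\Bbbk$: a coassociative counital coalgebra $(H,\Delta,\varepsilon)$ with coalgebra maps $H\otimes H\to H$ (a product, not necessarily associative, with two-sided unit $1$) and $\Bbbk\to H$ (the unit), a convolution invertible $\omega\in(H\otimes H\otimes H)^*$ with $$h_1(g_1l_1)\,\omega(h_2,g_2,l_2)=\omega(h_1,g_1,l_1)\,(h_2g_2)l_2,\qquad \omega(h,1,g)=\varepsilon(h)\varepsilon(g),$$ $$\omega(h_1,g_1,l_1m_1)\,\omega(h_2g_2,l_2,m_2)=\omega(g_1,l_1,m_1)\,\omega(h_1,g_2l_2,m_2)\,\omega(h_2,g_3,l_3),$$ and a coalgebra antihomomorphism $S:H\to H$ and $\alpha,\beta\in H^*$ with $S(h_1)\alpha(h_2)h_3=\alpha(h)1$, $h_1\beta(h_2)S(h_3)=\beta(h)1$ and $\omega(h_1\beta(h_2),S(h_3),\alpha(h_4)h_5)=\omega^{-1}(S(h_1),\alpha(h_2)h_3\beta(h_4),S(h_5))=\varepsilon(h)$.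 Let $A$ be a right $H$-comodule algebra: a right $H$-comodule with coaction $\rho(a)=a_0\otimes a_1$, with a colinear product and a colinear two-sided unit $1_A$, such that $(ab)c=a_0(b_0c_0)\,\omega(a_1,b_1,c_1)$. Let $B=\{a\in A:\rho(a)=a\otimes 1\}$, an associative unital algebra over which $A$ is a left and a right module. Write $\mathrm{Hom}^H(H,A)$, $\mathrm{Hom}^H(H^S,A)$, $\mathrm{Hom}^H(\overline H,A)$ for the spaces of $H$-colinear maps $H\to A$ where the source $H$ carries the right coaction $h\mapsto h_1\otimes h_2$, $h\mapsto h_2\otimes S(h_1)$, $h\mapsto h_2\otimes S(h_1)h_3$, respectively. For $p\in \mathrm{Hom}^H(H,A)$, $q\in \mathrm{Hom}^H(H^S,A)$, $s\in\mathrm{Hom}^H(\overline H,A)$, $r\in\mathrm{Hom}(H,B)$ put $$(rp)(h)=r(h_1)p(h_2),\qquad (ps)(h)=p(h_1)s(h_5)\,\beta(h_3)\,\omega(h_2,S(h_4),h_6),$$ $$(qr)(h)=q(h_1)r(h_2),\qquad (sq)(h)=s(h_2)q(h_6)\,\beta(h_4)\,\omega^{-1}(S(h_1),h_3,S(h_5)).$$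 These are the bimodule actions of the Morita context $\mathbb M(A)$ between $\mathrm{Hom}^H(\overline H,A)$ and $\mathrm{Hom}(H,B)$, whose connecting maps are $$(-,-):\mathrm{Hom}^H(H,A)\otimes_{\mathrm{Hom}^H(\overline H,A)}\mathrm{Hom}^H(H^S,A)\to \mathrm{Hom}(H,B),\qquad (p,q)(h)=p(h_1)\beta(h_2)q(h_3),$$ $$[-,-]:\mathrm{Hom}^H(H^S,A)\otimes_{\mathrm{Hom}(H,B)}\mathrm{Hom}^H(H,A)\to \mathrm{Hom}^H(\overline H,A),\qquad [q,p](h)=q(h_1)p(h_2).$$ The context is called strict if both connecting maps are surjective. The extension $B\subseteq A$ is called Galois if the map $A\otimes_BA\to A\otimes H$, $a\otimes_B b\mapsto a_0b_0\otimes b_4\,\omega^{-1}(a_1,b_1\beta(b_2),S(b_3))$, is bijective. It is called cleft if there are a colinear map $\gamma:H\to A$ (for the coaction $\Delta$ on $H$) and a linear map $\delta:H\to A$ with $\rho(\delta(h))=\delta(h_2)\otimes S(h_1)$, $\delta(h_1)\gamma(h_2)=\alpha(h)1_A$ and $\gamma(h_1)\beta(h_2)\delta(h_3)=\varepsilon(h)1_A$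 for all $h\in H$. Regard $A$ (by multiplication and $\rho$) and $B\otimes H$ (by $b(b'\otimes h)=bb'\otimes h$ and $b\otimes h\mapsto b\otimes h_1\otimes h_2$) as left $B$-modules and right $H$-comodules. **Theorem.** 1. The map $[-,-]$ is surjective if and only if $B\subseteq A$ is Galois and there is a nonnegative integer $n$ such that $A$ is a direct summand of $(B\otimes H)^n$ as left $B$-module, right $H$-comodule. 2. The Morita context $\mathbb M(A)$ is strict if and only if $B\subseteq A$ is Galois and there are nonnegative integers $n,\bar n$ such that $A$ is a direct summand of $(B\otimes H)^n$ and $B\otimes H$ is a direct summand of $A^{\bar n}$, both as left $B$-modules, right $H$-comodules. 3. If $B\subseteq A$ is cleft, then $\mathbb M(A)$ is strict. -/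

import Mathlib

noncomputable section

set_option linter.unusedSectionVars false

namespace CoquasiHopf

open TensorProduct Coalgebra

/-! ### Convolution over a coalgebra -/

section Convolution

variable {k C V W X U : Type*} [Field k] [AddCommGroup C] [Module k C] [Coalgebra k C]
  [AddCommGroup V] [Module k V] [AddCommGroup W] [Module k W]
  [AddCommGroup X] [Module k X] [AddCommGroup U] [Module k U]

/-- `h ↦ f(h₁) ⊗ g(h₂)`. -/
def convTmul (f : C →ₗ[k] V) (g : C →ₗ[k] W) : C →ₗ[k] V ⊗[k] W :=
  TensorProduct.map f g ∘ₗ comul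

/-- `h ↦ μ(f(h₁), g(h₂))`. -/
def conv (μ : V →ₗ[k] W →ₗ[k] U) (f : C →ₗ[k] V) (g : C →ₗ[k] W) : C →ₗ[k] U :=
  TensorProduct.lift μ ∘ₗ convTmul f g

/-- `h ↦ μ(f(h₁), g(h₂), l(h₃))`. -/
def conv₃ (μ : V →ₗ[k] W →ₗ[k] X →ₗ[k] U) (f : C →ₗ[k] V) (g : C →ₗ[k] W) (l : C →ₗ[k] X) :
    C →ₗ[k] U :=
  conv LinearMap.id (conv μ f g) l

/-- `h ↦ φ(h₁) f(h₂)` for a functional `φ`. -/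
def convL (φ : C →ₗ[k] k) (f : C →ₗ[k] V) : C →ₗ[k] V := conv (LinearMap.lsmul k V) φ f

/-- `h ↦ f(h₁) φ(h₂)` for a functional `φ`. -/
def convR (f : C →ₗ[k] V) (φ : C →ₗ[k] k) : C →ₗ[k] V := conv (LinearMap.lsmul k V).flip f φ

end Convolution

/-! ### Coquasi-bialgebras and coquasi-Hopf algebras -/

/-- A coquasi-bialgebra: a coassociative coalgebra `H` with a unital, not necessarily associative,
product which is a coalgebra morphism, a grouplike unit, and a convolution invertible
reassociator `ω` (with inverse `ωInv`). Sums over `Coalgebra.Repr` spell out Sweedler notation. -/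
class CoquasiBialgebra (k H : Type*) [Field k] [NonAssocRing H] [Module k H]
    [SMulCommClass k H H] [IsScalarTower k H H] [Coalgebra k H] where
  comul_mul : ∀ h g : H, comul (R := k) (h * g) =
    TensorProduct.map₂ (LinearMap.mul k H) (LinearMap.mul k H) (comul h) (comul g)
  counit_mul : ∀ h g : H, counit (R := k) (h * g) = counit (R := k) h * counit (R := k) g
  comul_one : comul (R := k) (1 : H) = 1 ⊗ₜ[k] 1
  counit_one : counit (R := k) (1 : H) = 1
  /-- the reassociator -/
  ω : H →ₗ[k] H →ₗ[k] H →ₗ[k] k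
  /-- the convolution inverse of the reassociator -/
  ωInv : H →ₗ[k] H →ₗ[k] H →ₗ[k] k
  ω_mul_ωInv : ∀ {ι₁ ι₂ ι₃ : Type} {h g l : H}
    (a : Repr k h ι₁) (b : Repr k g ι₂) (c : Repr k l ι₃),
    ∑ i ∈ a.index, ∑ j ∈ b.index, ∑ m ∈ c.index,
      ω (a.left i) (b.left j) (c.left m) * ωInv (a.right i) (b.right j) (c.right m) =
    counit (R := k) h * counit (R := k) g * counit (R := k) l
  ωInv_mul_ω : ∀ {ι₁ ι₂ ι₃ : Type} {h g l : H}
    (a : Repr k h ι₁) (b : Repr k g ι₂) (c : Repr k l ι₃),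
    ∑ i ∈ a.index, ∑ j ∈ b.index, ∑ m ∈ c.index,
      ωInv (a.left i) (b.left j) (c.left m) * ω (a.right i) (b.right j) (c.right m) =
    counit (R := k) h * counit (R := k) g * counit (R := k) l
  /-- `h₁(g₁l₁) ω(h₂,g₂,l₂) = ω(h₁,g₁,l₁) (h₂g₂)l₂` -/
  mul_assoc_ω : ∀ {ι₁ ι₂ ι₃ : Type} {h g l : H}
    (a : Repr k h ι₁) (b : Repr k g ι₂) (c : Repr k l ι₃),
    ∑ i ∈ a.index, ∑ j ∈ b.index, ∑ m ∈ c.index,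
      ω (a.right i) (b.right j) (c.right m) • (a.left i * (b.left j * c.left m)) =
    ∑ i ∈ a.index, ∑ j ∈ b.index, ∑ m ∈ c.index,
      ω (a.left i) (b.left j) (c.left m) • ((a.right i * b.right j) * c.right m)
  /-- `ω(h₁,g₁,l₁m₁) ω(h₂g₂,l₂,m₂) = ω(g₁,l₁,m₁) ω(h₁,g₂l₂,m₂) ω(h₂,g₃,l₃)` -/
  ω_cocycle : ∀ {ι₁ ι₂ ι₃ ι₄ κ₂ κ₃ : Type} {h g l m : H}
    (a : Repr k h ι₁) (b : Repr k g ι₂) (c : Repr k l ι₃) (d : Repr k m ι₄)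
    (b' : ∀ j, Repr k (b.right j) κ₂) (c' : ∀ s, Repr k (c.right s) κ₃),
    ∑ i ∈ a.index, ∑ j ∈ b.index, ∑ s ∈ c.index, ∑ t ∈ d.index,
      ω (a.left i) (b.left j) (c.left s * d.left t) *
        ω (a.right i * b.right j) (c.right s) (d.right t) =
    ∑ i ∈ a.index, ∑ j ∈ b.index, ∑ s ∈ c.index, ∑ t ∈ d.index,
      ∑ j' ∈ (b' j).index, ∑ s' ∈ (c' s).index,
        ω (b.left j) (c.left s) (d.left t) *
          ω (a.left i) ((b' j).left j' * (c' s).left s') (d.right t) *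
            ω (a.right i) ((b' j).right j') ((c' s).right s')
  ω_one_mid : ∀ h g : H, ω h 1 g = counit (R := k) h * counit (R := k) g

open CoquasiBialgebra (ω ωInv)

/-- A coquasi-Hopf algebra: a coquasi-bialgebra with an antipode `(S, α, β)`. -/
class CoquasiHopfAlgebra (k H : Type*) [Field k] [NonAssocRing H] [Module k H]
    [SMulCommClass k H H] [IsScalarTower k H H] [Coalgebra k H]
    extends CoquasiBialgebra k H where
  /-- the antipode, a coalgebra antihomomorphism -/
  S : H →ₗ[k] H
  α : H →ₗ[k] k
  β : H →ₗ[k] k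
  comul_S : ∀ h : H, comul (R := k) (S h) =
    TensorProduct.map S S (TensorProduct.comm k H H (comul h))
  counit_S : ∀ h : H, counit (R := k) (S h) = counit (R := k) h
  /-- `S(h₁) α(h₂) h₃ = α(h) 1` -/
  S_α_id : ∀ h : H, conv (LinearMap.mul k H) S (convL α LinearMap.id) h = α h • 1
  /-- `h₁ β(h₂) S(h₃) = β(h) 1` -/
  id_β_S : ∀ h : H, conv (LinearMap.mul k H) LinearMap.id (convL β S) h = β h • 1
  /-- `ω(h₁ β(h₂), S(h₃), α(h₄) h₅) = ε(h)` -/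
  ω_id_S_id : ∀ h : H,
    conv₃ ω (convR LinearMap.id β) S (convL α LinearMap.id) h = counit (R := k) h
  /-- `ω⁻¹(S(h₁), α(h₂) h₃ β(h₄), S(h₅)) = ε(h)` -/
  ωInv_S_id_S : ∀ h : H,
    conv₃ ωInv S (convR (convL α LinearMap.id) β) S h = counit (R := k) h

open CoquasiHopfAlgebra (S α β)

/-! ### Comodule algebras -/

/-- A right `H`-comodule algebra, that is, an algebra in the monoidal category of right
`H`-comodules; it is unital, and associative up to `ω`. -/
class ComoduleAlgebra (k H A : Type*) [Field k] [NonAssocRing H] [Module k H]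
    [SMulCommClass k H H] [IsScalarTower k H H] [Coalgebra k H] [CoquasiBialgebra k H]
    [NonAssocRing A] [Module k A] [SMulCommClass k A A] [IsScalarTower k A A] where
  /-- the coaction `a ↦ a₀ ⊗ a₁` -/
  ρ : A →ₗ[k] A ⊗[k] H
  ρ_coassoc : ∀ a : A,
    TensorProduct.assoc k A H H (ρ.rTensor H (ρ a)) = (comul (R := k)).lTensor A (ρ a)
  ρ_counit : ∀ a : A, (counit (R := k)).lTensor A (ρ a) = a ⊗ₜ[k] 1
  ρ_mul : ∀ a b : A, ρ (a * b) =
    TensorProduct.map₂ (LinearMap.mul k A) (LinearMap.mul k H) (ρ a) (ρ b)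
  ρ_one : ρ 1 = 1 ⊗ₜ[k] 1
  /-- `(ab)c = a₀(b₀c₀) ω(a₁,b₁,c₁)`, for any way of writing `ρ(a) = ∑ a₀ ⊗ a₁` etc. -/
  mul_assoc_ω : ∀ {ι₁ ι₂ ι₃ : Type} (I : Finset ι₁) (J : Finset ι₂) (K : Finset ι₃)
    (a₀ : ι₁ → A) (a₁ : ι₁ → H) (b₀ : ι₂ → A) (b₁ : ι₂ → H) (c₀ : ι₃ → A) (c₁ : ι₃ → H)
    {a b c : A}, ρ a = ∑ i ∈ I, a₀ i ⊗ₜ[k] a₁ i → ρ b = ∑ j ∈ J, b₀ j ⊗ₜ[k] b₁ j →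
    ρ c = ∑ l ∈ K, c₀ l ⊗ₜ[k] c₁ l →
    (a * b) * c = ∑ i ∈ I, ∑ j ∈ J, ∑ l ∈ K,
      (ω (a₁ i) (b₁ j) (c₁ l) : k) • (a₀ i * (b₀ j * c₀ l))

section Coinvariants

variable (k H A : Type*) [Field k] [NonAssocRing H] [Module k H]
  [SMulCommClass k H H] [IsScalarTower k H H] [Coalgebra k H] [CoquasiBialgebra k H]
  [NonAssocRing A] [Module k A] [SMulCommClass k A A] [IsScalarTower k A A]
  [ComoduleAlgebra k H A]

/-- The coaction of a comodule algebra. -/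
abbrev coact : A →ₗ[k] A ⊗[k] H := ComoduleAlgebra.ρ

/-- The coinvariants `B = A^{co H}`. -/
def Coinv : Submodule k A where
  carrier := {a | coact k H A a = a ⊗ₜ[k] 1}
  add_mem' {a b} ha hb := by
    change coact k H A _ = _ at ha hb ⊢
    rw [map_add, ha, hb, add_tmul]
  zero_mem' := by simp
  smul_mem' c a ha := by
    change coact k H A _ = _ at ha ⊢
    rw [map_smul, ha, smul_tmul']

variable {k H A}

theorem mem_coinv {a : A} : a ∈ Coinv k H A ↔ coact k H A a = a ⊗ₜ[k] 1 := Iff.rfl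

theorem exists_tmul_sum {V W : Type*} [AddCommGroup V] [Module k V] [AddCommGroup W] [Module k W]
    (x : V ⊗[k] W) : ∃ (n : ℕ) (v : Fin n → V) (w : Fin n → W), x = ∑ i, v i ⊗ₜ[k] w i := by
  obtain ⟨s, hs⟩ := TensorProduct.exists_finset x
  refine ⟨s.card, fun i => (s.equivFin.symm i).1.1, fun i => (s.equivFin.symm i).1.2, ?_⟩
  rw [hs, ← Finset.sum_coe_sort]
  exact (Equiv.sum_comp s.equivFin.symm (fun i => i.1.1 ⊗ₜ[k] i.1.2)).symm

/-- `a₀ ε(a₁) = a`, for any way of writing `ρ(a)`. -/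
theorem sum_counit_coact {ι : Type*} (I : Finset ι) (a₀ : ι → A) (a₁ : ι → H) {a : A}
    (h : coact k H A a = ∑ i ∈ I, a₀ i ⊗ₜ[k] a₁ i) :
    ∑ i ∈ I, counit (R := k) (a₁ i) • a₀ i = a := by
  have h1 := ComoduleAlgebra.ρ_counit (k := k) (H := H) a
  rw [h] at h1
  have h2 := congrArg (TensorProduct.rid k A) h1
  simpa using h2

/-- Associativity holds when the middle factor is coinvariant. -/
theorem assoc_mid (a c : A) {b : A} (hb : b ∈ Coinv k H A) : (a * b) * c = a * (b * c) := by
  obtain ⟨n, a₀, a₁, ha⟩ := exists_tmul_sum (coact k H A a)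
  obtain ⟨m, c₀, c₁, hc⟩ := exists_tmul_sum (coact k H A c)
  have hb' : coact k H A b = ∑ _j ∈ (Finset.univ : Finset Unit), b ⊗ₜ[k] (1 : H) := by
    simpa using mem_coinv.1 hb
  rw [ComoduleAlgebra.mul_assoc_ω (k := k) (H := H) _ _ _ _ _ _ _ _ _ ha hb' hc]
  conv_rhs => rw [← sum_counit_coact _ _ _ ha, ← sum_counit_coact _ _ _ hc]
  simp only [CoquasiBialgebra.ω_one_mid, Finset.sum_mul, Finset.mul_sum, smul_mul_assoc,
    mul_smul_comm, Finset.univ_unique, Finset.sum_singleton, Finset.smul_sum, smul_smul]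
  rw [Finset.sum_comm]
  exact Finset.sum_congr rfl fun _ _ => Finset.sum_congr rfl fun _ _ => by rw [mul_comm]

theorem coact_mul_coinv (a : A) {b : A} (hb : b ∈ Coinv k H A) :
    coact k H A (a * b) = TensorProduct.map (LinearMap.mulRight k b) LinearMap.id
      (coact k H A a) := by
  rw [ComoduleAlgebra.ρ_mul, show ComoduleAlgebra.ρ b = b ⊗ₜ[k] (1 : H) from hb]
  induction ComoduleAlgebra.ρ (k := k) (H := H) a with
  | zero => simp
  | tmul x y => simp
  | add x y hx hy => simp_all

theorem coact_coinv_mul (a : A) {b : A} (hb : b ∈ Coinv k H A) :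
    coact k H A (b * a) = TensorProduct.map (LinearMap.mulLeft k b) LinearMap.id
      (coact k H A a) := by
  rw [ComoduleAlgebra.ρ_mul, show ComoduleAlgebra.ρ b = b ⊗ₜ[k] (1 : H) from hb]
  induction ComoduleAlgebra.ρ (k := k) (H := H) a with
  | zero => simp
  | tmul x y => simp
  | add x y hx hy => simp_all

theorem coinv_mul_mem {a b : A} (ha : a ∈ Coinv k H A) (hb : b ∈ Coinv k H A) :
    a * b ∈ Coinv k H A := by
  rw [mem_coinv, coact_mul_coinv a hb, mem_coinv.1 ha]
  simp

theorem one_mem_coinv : (1 : A) ∈ Coinv k H A := ComoduleAlgebra.ρ_one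

/-- `B` is an associative unital ring with the operations of `A`. -/
instance : Ring (Coinv k H A) where
  mul a b := ⟨a.1 * b.1, coinv_mul_mem a.2 b.2⟩
  one := ⟨1, one_mem_coinv⟩
  mul_assoc a b c := Subtype.ext (assoc_mid a.1 c.1 b.2)
  one_mul a := Subtype.ext (one_mul a.1)
  mul_one a := Subtype.ext (mul_one a.1)
  left_distrib a b c := Subtype.ext (mul_add a.1 b.1 c.1)
  right_distrib a b c := Subtype.ext (add_mul a.1 b.1 c.1)
  zero_mul a := Subtype.ext (zero_mul a.1)
  mul_zero a := Subtype.ext (mul_zero a.1)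
  zsmul := (· • ·)
  zsmul_zero' a := zero_smul ℤ a
  zsmul_succ' n a := SubNegMonoid.zsmul_succ' n a
  zsmul_neg' n a := SubNegMonoid.zsmul_neg' n a
  neg_add_cancel := neg_add_cancel
  sub_eq_add_neg := sub_eq_add_neg

@[simp] theorem coinv_coe_mul (a b : Coinv k H A) : ((a * b : Coinv k H A) : A) = a * b := rfl

@[simp] theorem coinv_coe_one : ((1 : Coinv k H A) : A) = 1 := rfl

instance : Algebra k (Coinv k H A) :=
  Algebra.ofModule (fun r x y => Subtype.ext (smul_mul_assoc r x.1 y.1))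
    (fun r x y => Subtype.ext (mul_smul_comm r x.1 y.1))

/-- `A` is a left `B`-module by multiplication. -/
instance : Module (Coinv k H A) A where
  smul b a := b.1 * a
  one_smul a := one_mul a
  mul_smul b c a := assoc_mid b.1 a c.2
  smul_zero b := mul_zero b.1
  smul_add b x y := mul_add b.1 x y
  add_smul b c a := add_mul b.1 c.1 a
  zero_smul a := zero_mul a

theorem coinv_smul_def (b : Coinv k H A) (a : A) : b • a = b.1 * a := rfl

end Coinvariants

/-! ### Comatrices

Every element of a coalgebra over a field lies in the span of the entries of a finite matrix
`t` with `Δ(tᵢⱼ) = ∑ tᵢₗ ⊗ tₗⱼ` and `ε(tᵢⱼ) = δᵢⱼ`; this is used to verify identities written in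
Sweedler notation. -/

section Comatrix

variable {k C V W X U : Type*} [Field k] [AddCommGroup C] [Module k C] [Coalgebra k C]
  [AddCommGroup V] [Module k V] [AddCommGroup W] [Module k W]
  [AddCommGroup X] [Module k X] [AddCommGroup U] [Module k U]

/-- `Δ(tᵢⱼ) = ∑ tᵢₗ ⊗ tₗⱼ` and `ε(tᵢⱼ) = δᵢⱼ`. -/
structure IsComatrix (k : Type*) {C : Type*} [Field k] [AddCommGroup C] [Module k C]
    [Coalgebra k C] {n : ℕ} (t : Fin n → Fin n → C) : Prop where
  comul_eq : ∀ i j, comul (R := k) (t i j) = ∑ l, t i l ⊗ₜ[k] t l j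
  counit_eq : ∀ i j, counit (R := k) (t i j) = if i = j then 1 else 0

theorem exists_subcomodule (h : C) : ∃ M : Submodule k C, FiniteDimensional k M ∧ h ∈ M ∧
    ∀ x ∈ M, comul (R := k) x ∈ LinearMap.range (TensorProduct.map M.subtype
      (LinearMap.id : C →ₗ[k] C)) := by
  classical
  let b := Module.Basis.ofVectorSpace k C
  let e := TensorProduct.equivFinsuppOfBasisRight (M := C) b
  let f := e (comul h)
  have hf : comul (R := k) h = ∑ i ∈ f.support, f i ⊗ₜ[k] b i := by
    have : comul (R := k) h = e.symm f := by simp [f]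
    rw [this, TensorProduct.equivFinsuppOfBasisRight_symm_apply]
    rfl
  let M : Submodule k C := Submodule.span k (f '' (f.support : Set _))
  have hmem : ∀ i, f i ∈ M := by
    intro i
    by_cases hi : i ∈ f.support
    · exact Submodule.subset_span ⟨i, hi, rfl⟩
    · rw [Finsupp.notMem_support_iff.1 hi]; exact M.zero_mem
  refine ⟨M, FiniteDimensional.span_of_finite k (f.support.finite_toSet.image _), ?_, ?_⟩
  · have h1 := Coalgebra.lTensor_counit_comul (R := k) h
    rw [hf] at h1
    have h2 := congrArg (TensorProduct.rid k C) h1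
    simp only [map_sum, LinearMap.lTensor_tmul, TensorProduct.rid_tmul, one_smul] at h2
    rw [← h2]
    exact M.sum_mem fun i _ => M.smul_mem _ (hmem i)
  · have key : ∀ j, comul (R := k) (f j) ∈ LinearMap.range (TensorProduct.map M.subtype
      (LinearMap.id : C →ₗ[k] C)) := by
      intro j
      have h1 := Coalgebra.coassoc_apply (R := k) h
      rw [hf] at h1
      simp only [map_sum, LinearMap.lTensor_tmul, LinearMap.rTensor_tmul] at h1
      have h2 := congrArg (TensorProduct.rid k (C ⊗[k] C)) (congrArg
        (LinearMap.lTensor (C ⊗[k] C) (b.coord j)) (congrArg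
        (TensorProduct.assoc k C C C).symm h1))
      simp only [map_sum, LinearEquiv.symm_apply_apply, LinearMap.lTensor_tmul,
        TensorProduct.rid_tmul, Module.Basis.coord_apply, Module.Basis.repr_self] at h2
      have h3 : ∑ x ∈ f.support, (Finsupp.single x (1 : k)) j • comul (R := k) (f x) =
          comul (R := k) (f j) := by
        rw [Finset.sum_eq_single j]
        · simp
        · intro i _ hij; simp [hij]
        · intro hj; simp [Finsupp.notMem_support_iff.1 hj]
      rw [h3] at h2
      rw [h2]
      refine Submodule.sum_mem _ fun i _ => ?_
      induction comul (R := k) (b i) with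
      | zero => simp
      | tmul x y =>
        refine ⟨⟨f i, hmem i⟩ ⊗ₜ[k] (b.coord j y • x), ?_⟩
        simp
      | add x y hx hy =>
        simp only [tmul_add, map_add]
        exact Submodule.add_mem _ hx hy
    intro x hx
    refine Submodule.span_induction ?_ ?_ ?_ ?_ hx
    · rintro _ ⟨i, _, rfl⟩; exact key i
    · simp
    · intro x y _ _ hx hy; rw [map_add]; exact Submodule.add_mem _ hx hy
    · intro c x _ hx; rw [map_smul]; exact Submodule.smul_mem _ _ hx

theorem exists_comatrix (h : C) : ∃ (n : ℕ) (t : Fin n → Fin n → C), IsComatrix k t ∧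
    h ∈ Submodule.span k (Set.range fun p : Fin n × Fin n => t p.1 p.2) := by
  classical
  obtain ⟨M, hM, hh, hΔ⟩ := exists_subcomodule (k := k) h
  let w := Module.finBasis k M
  have hexp : ∀ x : M, (x : C) = ∑ j, w.repr x j • (w j : C) := by
    intro x
    have h1 := congrArg M.subtype (w.sum_repr x)
    rw [map_sum] at h1
    exact h1.symm
  have hf : ∀ i, ∃ f : C →ₗ[k] k, f ∘ₗ M.subtype = w.coord i := fun i =>
    LinearMap.exists_extend _
  choose f hf using hf
  have hfw : ∀ i j, f i (w j) = if i = j then 1 else 0 := by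
    intro i j
    have := LinearMap.congr_fun (hf i) (w j)
    simp only [LinearMap.coe_comp, Function.comp_apply, Submodule.subtype_apply,
      Module.Basis.coord_apply, Module.Basis.repr_self] at this
    rw [this, Finsupp.single_apply]
    simp [eq_comm]
  let t : Fin (Module.finrank k M) → Fin (Module.finrank k M) → C := fun i j =>
    TensorProduct.lid k C ((f i).rTensor C (comul (w j : C)))
  have hw : ∀ j, comul (R := k) (w j : C) = ∑ i, (w i : C) ⊗ₜ[k] t i j := by
    intro j
    obtain ⟨z, hz⟩ := hΔ (w j) (w j).2
    have hgen : ∀ z : M ⊗[k] C, TensorProduct.map M.subtype LinearMap.id z =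
        ∑ i, (w i : C) ⊗ₜ[k] TensorProduct.lid k C ((f i).rTensor C
          (TensorProduct.map M.subtype LinearMap.id z)) := by
      intro z
      induction z with
      | zero => simp
      | tmul x y =>
        have : ∀ i, f i x = w.repr x i := fun i => LinearMap.congr_fun (hf i) x
        simp only [map_tmul, Submodule.subtype_apply, LinearMap.id_coe, id_eq,
          LinearMap.rTensor_tmul, TensorProduct.lid_tmul, this]
        conv_lhs => rw [hexp x]
        simp only [TensorProduct.sum_tmul, TensorProduct.tmul_smul, TensorProduct.smul_tmul']
      | add x y hx hy =>
        rw [map_add]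
        nth_rw 1 [hx, hy]
        simp [tmul_add, Finset.sum_add_distrib]
    have := hgen z
    rw [hz] at this
    exact this
  refine ⟨_, t, ⟨?_, ?_⟩, ?_⟩
  · intro l j
    have h1 := Coalgebra.coassoc_apply (R := k) (w j : C)
    rw [hw j] at h1
    simp only [map_sum, LinearMap.lTensor_tmul, LinearMap.rTensor_tmul, hw,
      TensorProduct.sum_tmul, TensorProduct.assoc_tmul] at h1
    have h2 := congrArg (TensorProduct.lid k (C ⊗[k] C)) (congrArg
      (LinearMap.rTensor (C ⊗[k] C) (f l)) h1)
    simp only [map_sum, LinearMap.rTensor_tmul, TensorProduct.lid_tmul, hfw, ite_smul, one_smul,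
      zero_smul, Finset.sum_ite_eq, Finset.mem_univ, if_true] at h2
    exact h2.symm
  · intro l j
    have h1 := Coalgebra.lTensor_counit_comul (R := k) (w j : C)
    rw [hw j] at h1
    have h2 := congrArg (f l) (congrArg (TensorProduct.rid k C) h1)
    simpa [hfw] using h2
  · have hspan : ∀ j, (w j : C) ∈
        Submodule.span k (Set.range fun p : Fin _ × Fin _ => t p.1 p.2) := by
      intro j
      have h1 := Coalgebra.rTensor_counit_comul (R := k) (w j : C)
      rw [hw j] at h1
      have h2 := congrArg (TensorProduct.lid k C) h1
      simp only [map_sum, LinearMap.rTensor_tmul, TensorProduct.lid_tmul, one_smul] at h2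
      rw [← h2]
      exact Submodule.sum_mem _ fun i _ => Submodule.smul_mem _ _
        (Submodule.subset_span ⟨(i, j), rfl⟩)
    rw [show h = ∑ j, w.repr ⟨h, hh⟩ j • (w j : C) from hexp ⟨h, hh⟩]
    exact Submodule.sum_mem _ fun j _ => Submodule.smul_mem _ _ (hspan j)

/-- Linear maps on a coalgebra that agree on comatrix entries are equal. -/
theorem ext_comatrix {f g : C →ₗ[k] V}
    (hfg : ∀ {n : ℕ} {t : Fin n → Fin n → C}, IsComatrix k t → ∀ i j, f (t i j) = g (t i j)) :
    f = g := by
  ext h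
  obtain ⟨n, t, ht, hh⟩ := exists_comatrix (k := k) h
  have : Submodule.span k (Set.range fun p : Fin n × Fin n => t p.1 p.2) ≤
      LinearMap.eqLocus f g := by
    rw [Submodule.span_le]
    rintro _ ⟨p, rfl⟩
    exact hfg ht p.1 p.2
  exact this hh

variable {n : ℕ} {t : Fin n → Fin n → C}

theorem IsComatrix.convTmul (ht : IsComatrix k t) (f : C →ₗ[k] V) (g : C →ₗ[k] W) (i j : Fin n) :
    convTmul f g (t i j) = ∑ l, f (t i l) ⊗ₜ[k] g (t l j) := by
  simp [CoquasiHopf.convTmul, ht.comul_eq]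

theorem IsComatrix.conv (ht : IsComatrix k t) (μ : V →ₗ[k] W →ₗ[k] U) (f : C →ₗ[k] V)
    (g : C →ₗ[k] W) (i j : Fin n) :
    conv μ f g (t i j) = ∑ l, μ (f (t i l)) (g (t l j)) := by
  simp [CoquasiHopf.conv, ht.convTmul]

/-- The comultiplication of a comatrix entry as a representation. -/
def IsComatrix.repr (ht : IsComatrix k t) (i j : Fin n) : Repr k (t i j) (Fin n) where
  index := Finset.univ
  left := fun l => t i l
  right := fun l => t l j
  eq := (ht.comul_eq i j).symm

end Comatrix

/-! ### The forms `u` and `w` -/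

section Forms

variable {k H : Type*} [Field k] [NonAssocRing H] [Module k H]
  [SMulCommClass k H H] [IsScalarTower k H H] [Coalgebra k H] [CoquasiHopfAlgebra k H]

variable (k H) in
/-- `h ↦ β(h₁) S(h₂)`. -/
def betaS : H →ₗ[k] H := convL β S

variable (k H) in
/-- `u(x, z) = ω(x₁, β(x₂) S(x₃), z)`. -/
def uForm : H →ₗ[k] H →ₗ[k] k := conv ω LinearMap.id (betaS k H)

variable (k H) in
/-- `w(x, z) = ω⁻¹(x, z₁ β(z₂), S(z₃))`. -/
def wForm : H →ₗ[k] H →ₗ[k] k where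
  toFun x := conv (ωInv x) LinearMap.id (betaS k H)
  map_add' x y := by
    ext z
    simp only [conv, map_add, LinearMap.coe_comp, Function.comp_apply, LinearMap.add_apply]
    induction convTmul LinearMap.id (betaS k H) z with
    | zero => simp
    | tmul a b => simp
    | add a b ha hb => simp only [map_add, ha, hb]; abel
  map_smul' c x := by
    ext z
    simp only [conv, map_smul, LinearMap.coe_comp, Function.comp_apply, LinearMap.smul_apply,
      RingHom.id_apply]
    induction convTmul LinearMap.id (betaS k H) z with
    | zero => simp
    | tmul a b => simp
    | add a b ha hb => simp only [map_add, ha, hb, smul_add]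

theorem wForm_apply (x : H) : wForm k H x = conv (ωInv x) LinearMap.id (betaS k H) := rfl

theorem sum_comm₃₂ {I J K L M : Type*} [Fintype I] [Fintype J] [Fintype K] [Fintype L] [Fintype M]
    {V : Type*} [AddCommMonoid V] (f : I → J → K → L → M → V) :
    ∑ a, ∑ b, ∑ c, ∑ d, ∑ e, f a b c d e = ∑ d, ∑ e, ∑ a, ∑ b, ∑ c, f a b c d e := by
  have h1 := Finset.sum_comm (s := (Finset.univ : Finset (I × J × K)))
    (t := (Finset.univ : Finset (L × M))) (f := fun p q => f p.1 p.2.1 p.2.2 q.1 q.2)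
  simpa only [Fintype.sum_prod_type] using h1

theorem sum_comm₂₄ {I J K L M N : Type*} [Fintype I] [Fintype J] [Fintype K] [Fintype L]
    [Fintype M] [Fintype N] {V : Type*} [AddCommMonoid V] (f : I → J → K → L → M → N → V) :
    ∑ a, ∑ b, ∑ c, ∑ d, ∑ e, ∑ g, f a b c d e g =
      ∑ c, ∑ d, ∑ e, ∑ g, ∑ a, ∑ b, f a b c d e g := by
  have h1 := Finset.sum_comm (s := (Finset.univ : Finset (I × J)))
    (t := (Finset.univ : Finset (K × L × M × N)))
    (f := fun p q => f p.1 p.2 q.1 q.2.1 q.2.2.1 q.2.2.2)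
  simpa only [Fintype.sum_prod_type] using h1

theorem sum_comm₂₁ {I J K : Type*} [Fintype I] [Fintype J] [Fintype K]
    {V : Type*} [AddCommMonoid V] (f : I → J → K → V) :
    ∑ a, ∑ b, ∑ c, f a b c = ∑ c, ∑ a, ∑ b, f a b c := by
  have h1 := Finset.sum_comm (s := (Finset.univ : Finset (I × J)))
    (t := (Finset.univ : Finset K)) (f := fun p q => f p.1 p.2 q)
  simpa only [Fintype.sum_prod_type] using h1

theorem sum_inv_apply {I : Type*} [Fintype I] [DecidableEq I] {O O' : I → I → k}
    (h : ∀ p q, ∑ s, O' p s * O s q = if p = q then 1 else 0) (E : I → k) (p : I) :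
    ∑ s, O' p s * ∑ s', O s s' * E s' = E p := by
  simp only [Finset.mul_sum, ← mul_assoc]
  rw [Finset.sum_comm]
  simp only [← Finset.sum_mul, h]
  simp

variable {n m r v : ℕ} {t : Fin n → Fin n → H} {y : Fin m → Fin m → H} {z : Fin r → Fin r → H}
  {x : Fin v → Fin v → H}

theorem IsComatrix.antipode (ht : IsComatrix k t) :
    IsComatrix k (fun i j => (S (k := k) (t j i) : H)) where
  comul_eq i j := by
    rw [CoquasiHopfAlgebra.comul_S, ht.comul_eq]
    simp
  counit_eq i j := by
    rw [CoquasiHopfAlgebra.counit_S, ht.counit_eq]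
    simp [eq_comm]

theorem betaS_entry (ht : IsComatrix k t) (i j : Fin n) :
    betaS k H (t i j) = ∑ a, (β (t i a) : k) • S (k := k) (t a j) := by
  simp [betaS, convL, ht.conv]

theorem id_betaS_entry (ht : IsComatrix k t) (i j : Fin n) :
    ∑ a, ∑ b, (β (t a b) : k) • (t i a * S (k := k) (t b j)) = (β (t i j) : k) • (1 : H) := by
  have h1 := CoquasiHopfAlgebra.id_β_S (k := k) (t i j)
  rw [ht.conv] at h1
  rw [← h1]
  refine Finset.sum_congr rfl fun a _ => ?_
  change _ = t i a * betaS k H (t a j)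
  rw [betaS_entry ht, Finset.mul_sum]
  simp [mul_smul_comm]

theorem uForm_entry (ht : IsComatrix k t) (i j : Fin n) (l : H) :
    uForm k H (t i j) l = ∑ a, ∑ b, (β (t a b) : k) * ω (t i a) (S (k := k) (t b j)) l := by
  simp [uForm, ht.conv, betaS_entry ht]

theorem wForm_entry (ht : IsComatrix k t) (i j : Fin n) (l : H) :
    wForm k H l (t i j) = ∑ a, ∑ b, (β (t a b) : k) * ωInv l (t i a) (S (k := k) (t b j)) := by
  simp [wForm_apply, ht.conv, betaS_entry ht]

theorem assoc_entry (hx : IsComatrix k x) (hy : IsComatrix k y) (hz : IsComatrix k z)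
    (i i' j j' l l') :
    ∑ a, ∑ b, ∑ c, (ω (x a i') (y b j') (z c l') : k) • (x i a * (y j b * z l c)) =
    ∑ a, ∑ b, ∑ c, (ω (x i a) (y j b) (z l c) : k) • ((x a i' * y b j') * z c l') :=
  CoquasiBialgebra.mul_assoc_ω (hx.repr i i') (hy.repr j j') (hz.repr l l')

theorem ωInv_ω_entry (hx : IsComatrix k x) (hy : IsComatrix k y) (hz : IsComatrix k z)
    (p q : Fin v × Fin m × Fin r) :
    ∑ s : Fin v × Fin m × Fin r, (ωInv (x p.1 s.1) (y p.2.1 s.2.1) (z p.2.2 s.2.2) : k) *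
      ω (x s.1 q.1) (y s.2.1 q.2.1) (z s.2.2 q.2.2) = if p = q then 1 else 0 := by
  have h := CoquasiBialgebra.ωInv_mul_ω (hx.repr p.1 q.1) (hy.repr p.2.1 q.2.1)
    (hz.repr p.2.2 q.2.2)
  simp only [Fintype.sum_prod_type]
  refine h.trans ?_
  rw [hx.counit_eq, hy.counit_eq, hz.counit_eq]
  obtain ⟨p1, p2, p3⟩ := p
  obtain ⟨q1, q2, q3⟩ := q
  simp only [Prod.mk.injEq]
  split_ifs <;> simp_all

theorem ω_ωInv_entry (hx : IsComatrix k x) (hy : IsComatrix k y) (hz : IsComatrix k z)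
    (p q : Fin v × Fin m × Fin r) :
    ∑ s : Fin v × Fin m × Fin r, (ω (x p.1 s.1) (y p.2.1 s.2.1) (z p.2.2 s.2.2) : k) *
      ωInv (x s.1 q.1) (y s.2.1 q.2.1) (z s.2.2 q.2.2) = if p = q then 1 else 0 := by
  have h := CoquasiBialgebra.ω_mul_ωInv (hx.repr p.1 q.1) (hy.repr p.2.1 q.2.1)
    (hz.repr p.2.2 q.2.2)
  simp only [Fintype.sum_prod_type]
  refine h.trans ?_
  rw [hx.counit_eq, hy.counit_eq, hz.counit_eq]
  obtain ⟨p1, p2, p3⟩ := p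
  obtain ⟨q1, q2, q3⟩ := q
  simp only [Prod.mk.injEq]
  split_ifs <;> simp_all

/-- `(h₁g₁)l₁ ω⁻¹(h₂,g₂,l₂) = ω⁻¹(h₁,g₁,l₁) h₂(g₂l₂)` on comatrix entries. -/
theorem assoc_inv_entry (hx : IsComatrix k x) (hy : IsComatrix k y) (hz : IsComatrix k z)
    (p q : Fin v × Fin m × Fin r) :
    ∑ s : Fin v × Fin m × Fin r, (ωInv (x s.1 q.1) (y s.2.1 q.2.1) (z s.2.2 q.2.2) : k) •
      ((x p.1 s.1 * y p.2.1 s.2.1) * z p.2.2 s.2.2) =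
    ∑ s : Fin v × Fin m × Fin r, (ωInv (x p.1 s.1) (y p.2.1 s.2.1) (z p.2.2 s.2.2) : k) •
      (x s.1 q.1 * (y s.2.1 q.2.1 * z s.2.2 q.2.2)) := by
  classical
  have key : ∀ φ : H →ₗ[k] k, φ (∑ s : Fin v × Fin m × Fin r,
      (ωInv (x s.1 q.1) (y s.2.1 q.2.1) (z s.2.2 q.2.2) : k) •
      ((x p.1 s.1 * y p.2.1 s.2.1) * z p.2.2 s.2.2)) =
    φ (∑ s : Fin v × Fin m × Fin r, (ωInv (x p.1 s.1) (y p.2.1 s.2.1) (z p.2.2 s.2.2) : k) •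
      (x s.1 q.1 * (y s.2.1 q.2.1 * z s.2.2 q.2.2))) := by
    intro φ
    let O : Matrix (Fin v × Fin m × Fin r) (Fin v × Fin m × Fin r) k :=
      fun p q => ω (x p.1 q.1) (y p.2.1 q.2.1) (z p.2.2 q.2.2)
    let O' : Matrix (Fin v × Fin m × Fin r) (Fin v × Fin m × Fin r) k :=
      fun p q => ωInv (x p.1 q.1) (y p.2.1 q.2.1) (z p.2.2 q.2.2)
    let F : Matrix (Fin v × Fin m × Fin r) (Fin v × Fin m × Fin r) k :=
      fun p q => φ (x p.1 q.1 * (y p.2.1 q.2.1 * z p.2.2 q.2.2))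
    let G : Matrix (Fin v × Fin m × Fin r) (Fin v × Fin m × Fin r) k :=
      fun p q => φ ((x p.1 q.1 * y p.2.1 q.2.1) * z p.2.2 q.2.2)
    have h1 : O * O' = 1 := by
      ext p q
      rw [Matrix.mul_apply, Matrix.one_apply]
      exact ω_ωInv_entry hx hy hz p q
    have h2 : O' * O = 1 := by
      ext p q
      rw [Matrix.mul_apply, Matrix.one_apply]
      exact ωInv_ω_entry hx hy hz p q
    have h3 : F * O = O * G := by
      ext p q
      rw [Matrix.mul_apply, Matrix.mul_apply]
      have := congrArg φ (assoc_entry hx hy hz p.1 q.1 p.2.1 q.2.1 p.2.2 q.2.2)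
      simp only [map_sum, map_smul, smul_eq_mul] at this
      simp only [Fintype.sum_prod_type, F, O, G]
      rw [← this]
      simp only [mul_comm]
    have h4 : G * O' = O' * F := by
      calc G * O' = (O' * O) * G * O' := by rw [h2, Matrix.one_mul]
        _ = O' * (O * G) * O' := by simp only [Matrix.mul_assoc]
        _ = O' * F * (O * O') := by rw [← h3]; simp only [Matrix.mul_assoc]
        _ = O' * F := by rw [h1, Matrix.mul_one]
    have h5 := congrFun (congrFun h4 p) q
    rw [Matrix.mul_apply, Matrix.mul_apply] at h5
    simp only [map_sum, map_smul, smul_eq_mul]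
    simp only [F, O', G] at h5
    rw [← h5]
    exact Finset.sum_congr rfl fun _ _ => mul_comm _ _
  exact sub_eq_zero.1 ((Module.forall_dual_apply_eq_zero_iff k _).1 fun φ => by
    rw [map_sub, key φ, sub_self])

theorem cocycle_raw (ht : IsComatrix k t) (hx : IsComatrix k x) (hy : IsComatrix k y)
    (hz : IsComatrix k z) (i i' : Fin n) (s q : Fin v × Fin m × Fin r) :
    ∑ a, ∑ b, ∑ c, ∑ d, (ω (t i a) (x s.1 b) (y s.2.1 c * z s.2.2 d) : k) *
        ω (t a i' * x b q.1) (y c q.2.1) (z d q.2.2) =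
    ∑ s' : Fin v × Fin m × Fin r, (ω (x s.1 s'.1) (y s.2.1 s'.2.1) (z s.2.2 s'.2.2) : k) *
      ∑ a, ∑ b, ∑ c, (ω (t i a) (x s'.1 b * y s'.2.1 c) (z s'.2.2 q.2.2) : k) *
        ω (t a i') (x b q.1) (y c q.2.1) := by
  refine (CoquasiBialgebra.ω_cocycle (ht.repr i i') (hx.repr s.1 q.1) (hy.repr s.2.1 q.2.1)
    (hz.repr s.2.2 q.2.2) (fun j => hx.repr j q.1) (fun j => hy.repr j q.2.1)).trans ?_
  simp only [IsComatrix.repr, Finset.mul_sum, Fintype.sum_prod_type]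
  rw [Finset.sum_comm]
  refine Finset.sum_congr rfl fun b _ => ?_
  rw [Finset.sum_comm]
  refine Finset.sum_congr rfl fun c _ => ?_
  rw [Finset.sum_comm]
  refine Finset.sum_congr rfl fun d _ => ?_
  simp only [mul_assoc]

/-- `ω(h₁,g₁l₁,m) ω(h₂,g₂,l₂) = ω⁻¹(g₁,l₁,m₁) ω(h₁,g₂,l₂m₂) ω(h₂g₃,l₃,m₃)` on comatrix entries. -/
theorem cocycle_entry (ht : IsComatrix k t) (hx : IsComatrix k x) (hy : IsComatrix k y)
    (hz : IsComatrix k z) (i i' : Fin n) (p q : Fin v × Fin m × Fin r) :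
    ∑ a, ∑ b, ∑ c, (ω (t i a) (x p.1 b * y p.2.1 c) (z p.2.2 q.2.2) : k) *
      ω (t a i') (x b q.1) (y c q.2.1) =
    ∑ s : Fin v × Fin m × Fin r, (ωInv (x p.1 s.1) (y p.2.1 s.2.1) (z p.2.2 s.2.2) : k) *
      ∑ a, ∑ b, ∑ c, ∑ d, (ω (t i a) (x s.1 b) (y s.2.1 c * z s.2.2 d) : k) *
        ω (t a i' * x b q.1) (y c q.2.1) (z d q.2.2) := by
  simp only [cocycle_raw ht hx hy hz]
  exact (sum_inv_apply (ωInv_ω_entry hx hy hz) (fun s => ∑ a, ∑ b, ∑ c,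
    (ω (t i a) (x s.1 b * y s.2.1 c) (z s.2.2 q.2.2) : k) *
      ω (t a i') (x b q.1) (y c q.2.1)) p).symm

theorem isComatrix_one : IsComatrix k (fun _ _ : Fin 1 => (1 : H)) where
  comul_eq i j := by simp [CoquasiBialgebra.comul_one]
  counit_eq i j := by simp [CoquasiBialgebra.counit_one, Subsingleton.elim i j]

theorem ω_entry_of_idem (hx : IsComatrix k x) (hy : IsComatrix k y) (hz : IsComatrix k z)
    (h : ∀ p q : Fin v × Fin m × Fin r,
      ∑ s : Fin v × Fin m × Fin r, (ω (x p.1 s.1) (y p.2.1 s.2.1) (z p.2.2 s.2.2) : k) *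
        ω (x s.1 q.1) (y s.2.1 q.2.1) (z s.2.2 q.2.2) =
      ω (x p.1 q.1) (y p.2.1 q.2.1) (z p.2.2 q.2.2)) (p q : Fin v × Fin m × Fin r) :
    (ω (x p.1 q.1) (y p.2.1 q.2.1) (z p.2.2 q.2.2) : k) = if p = q then 1 else 0 := by
  have h1 := sum_inv_apply (ωInv_ω_entry hx hy hz)
    (fun s => (ω (x s.1 q.1) (y s.2.1 q.2.1) (z s.2.2 q.2.2) : k)) p
  simp only [h] at h1
  rw [← h1, ωInv_ω_entry hx hy hz]

theorem ω_one_left (hy : IsComatrix k y) (hz : IsComatrix k z) (i i' : Fin m) (j j' : Fin r) :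
    (ω (1 : H) (y i i') (z j j') : k) = if i = i' ∧ j = j' then 1 else 0 := by
  have h := ω_entry_of_idem isComatrix_one hy hz (fun p q => by
    have h1 := cocycle_raw isComatrix_one isComatrix_one hy hz 0 0 p q
    simp only [Finset.univ_unique, Finset.sum_singleton, mul_one, one_mul,
      CoquasiBialgebra.ω_one_mid, CoquasiBialgebra.counit_one, CoquasiBialgebra.counit_mul,
      hy.counit_eq, hz.counit_eq] at h1
    simp only [ite_mul, one_mul, zero_mul, mul_ite, mul_zero, mul_one, Finset.sum_ite_eq,
      Finset.sum_ite_eq', Finset.mem_univ, if_true] at h1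
    exact h1.symm) (0, i, j) (0, i', j')
  simpa using h

theorem ω_one_right (hx : IsComatrix k x) (hy : IsComatrix k y) (i i' : Fin v) (j j' : Fin m) :
    (ω (x i i') (y j j') (1 : H) : k) = if i = i' ∧ j = j' then 1 else 0 := by
  have h := ω_entry_of_idem hx hy isComatrix_one (fun p q => by
    have h1 := cocycle_raw hx hy isComatrix_one isComatrix_one p.1 q.1 (p.2.1, 0, 0) (q.2.1, 0, 0)
    simp only [Finset.univ_unique, Finset.sum_singleton, mul_one,
      CoquasiBialgebra.ω_one_mid, CoquasiBialgebra.counit_one, CoquasiBialgebra.counit_mul,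
      hy.counit_eq, hx.counit_eq, Fintype.sum_prod_type] at h1
    simp only [ite_mul, one_mul, zero_mul, mul_ite, mul_zero, mul_one, Finset.sum_ite_eq,
      Finset.sum_ite_eq', Finset.mem_univ, if_true] at h1
    simp only [Fintype.sum_prod_type, Finset.univ_unique, Finset.sum_singleton]
    exact h1.symm) (i, j, 0) (i', j', 0)
  simpa using h

/-- `x₁(S(x₃)z₁) u(x₂,z₂) = u(x,z₁) z₂` on comatrix entries. -/
theorem uForm_colinear (ht : IsComatrix k t) (hy : IsComatrix k y) (i j : Fin n) (l l' : Fin m) :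
    ∑ a, ∑ b, ∑ c, uForm k H (t a b) (y c l') • (t i a * (S (k := k) (t b j) * y l c)) =
    ∑ c, uForm k H (t i j) (y l c) • y c l' := by
  calc _ = ∑ d, ∑ e, (β (t d e) : k) • ∑ a, ∑ b, ∑ c,
        (ω (t a d) (S (k := k) (t e b)) (y c l') : k) •
          (t i a * (S (k := k) (t b j) * y l c)) := by
        simp only [uForm_entry ht, Finset.sum_smul, Finset.smul_sum, smul_smul]
        exact sum_comm₃₂ _
    _ = ∑ d, ∑ e, (β (t d e) : k) • ∑ a, ∑ b, ∑ c,
        (ω (t i a) (S (k := k) (t b j)) (y l c) : k) •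
          ((t a d * S (k := k) (t e b)) * y c l') := by
        refine Finset.sum_congr rfl fun d _ => Finset.sum_congr rfl fun e _ => ?_
        rw [assoc_entry ht ht.antipode hy]
    _ = ∑ a, ∑ b, ∑ c, (ω (t i a) (S (k := k) (t b j)) (y l c) : k) •
          ((∑ d, ∑ e, (β (t d e) : k) • (t a d * S (k := k) (t e b))) * y c l') := by
        simp only [Finset.sum_mul, Finset.smul_sum]
        rw [← sum_comm₃₂]
        refine Fintype.sum_congr _ _ fun a => Fintype.sum_congr _ _ fun b =>
          Fintype.sum_congr _ _ fun c => Fintype.sum_congr _ _ fun d =>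
          Fintype.sum_congr _ _ fun e => ?_
        rw [smul_mul_assoc, smul_comm]
    _ = _ := by
        simp only [id_betaS_entry ht, uForm_entry ht, Finset.sum_smul, smul_mul_assoc, one_mul,
          smul_smul]
        rw [sum_comm₂₁]
        refine Fintype.sum_congr _ _ fun a => Fintype.sum_congr _ _ fun b =>
          Fintype.sum_congr _ _ fun c => ?_
        rw [mul_comm]

/-- `(g₁z₁)S(z₃) w(g₂,z₂) = w(g₁,z) g₂` on comatrix entries. -/
theorem wForm_colinear (hx : IsComatrix k x) (hy : IsComatrix k y) (p q : Fin v) (i j : Fin m) :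
    ∑ s, ∑ a, ∑ b, wForm k H (x s q) (y a b) • ((x p s * y i a) * S (k := k) (y b j)) =
    ∑ s, wForm k H (x p s) (y i j) • x s q := by
  calc _ = ∑ d, ∑ e, (β (y d e) : k) • ∑ s, ∑ a, ∑ b,
        (ωInv (x s q) (y a d) (S (k := k) (y e b)) : k) •
          ((x p s * y i a) * S (k := k) (y b j)) := by
        simp only [wForm_entry hy, Finset.sum_smul, Finset.smul_sum, smul_smul]
        exact sum_comm₃₂ _
    _ = ∑ d, ∑ e, (β (y d e) : k) • ∑ s, ∑ a, ∑ b,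
        (ωInv (x p s) (y i a) (S (k := k) (y b j)) : k) •
          (x s q * (y a d * S (k := k) (y e b))) := by
        refine Finset.sum_congr rfl fun d _ => Finset.sum_congr rfl fun e _ => ?_
        have := assoc_inv_entry hx hy hy.antipode (p, i, j) (q, d, e)
        simp only [Fintype.sum_prod_type] at this
        rw [this]
    _ = ∑ s, ∑ a, ∑ b, (ωInv (x p s) (y i a) (S (k := k) (y b j)) : k) •
          (x s q * (∑ d, ∑ e, (β (y d e) : k) • (y a d * S (k := k) (y e b)))) := by
        simp only [Finset.mul_sum, Finset.smul_sum]
        rw [← sum_comm₃₂]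
        refine Fintype.sum_congr _ _ fun a => Fintype.sum_congr _ _ fun b =>
          Fintype.sum_congr _ _ fun c => Fintype.sum_congr _ _ fun d =>
          Fintype.sum_congr _ _ fun e => ?_
        rw [mul_smul_comm, smul_comm]
    _ = _ := by
        simp only [id_betaS_entry hy, wForm_entry hy, Finset.sum_smul, mul_smul_comm, mul_one,
          smul_smul]
        refine Fintype.sum_congr _ _ fun a => Fintype.sum_congr _ _ fun b =>
          Fintype.sum_congr _ _ fun c => ?_
        rw [mul_comm]

theorem uForm_wForm_aux (ht : IsComatrix k t) (hy : IsComatrix k y) (i i' : Fin n)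
    (j j' d e : Fin m) :
    ∑ f, ∑ g, (β (t f g) : k) * ∑ a, ∑ b, ∑ c,
      (ω (t i a) (S (k := k) (t b i') * y j c) (S (k := k) (y e j')) : k) *
        ω (t a f) (S (k := k) (t g b)) (y c d) =
    ∑ s : Fin n × Fin m × Fin m,
      (ωInv (S (k := k) (t s.1 i')) (y j s.2.1) (S (k := k) (y s.2.2 j')) : k) *
      ∑ a, ∑ b, (β (t a b) : k) *
        ω (t i a) (S (k := k) (t b s.1)) (y s.2.1 d * S (k := k) (y e s.2.2)) := by
  have h1 : ∀ f g, ∑ a, ∑ b, ∑ c,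
      (ω (t i a) (S (k := k) (t b i') * y j c) (S (k := k) (y e j')) : k) *
        ω (t a f) (S (k := k) (t g b)) (y c d) = _ := fun f g =>
    cocycle_entry ht ht.antipode hy hy.antipode i f (i', j, j') (g, d, e)
  simp only [h1]
  simp only [Finset.mul_sum (s := (Finset.univ : Finset (Fin n × Fin m × Fin m)))]
  rw [sum_comm₂₁]
  refine Fintype.sum_congr _ _ fun s => ?_
  have h2 : ∀ a b c d', ∑ f, ∑ g, (β (t f g) : k) *
      ω (t a f * S (k := k) (t g b)) (y c d) (S (k := k) (y e d')) =
      (β (t a b) : k) * if c = d ∧ d' = e then 1 else 0 := by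
    intro a b c d'
    rw [← ω_one_left (k := k) hy hy.antipode c d d' e]
    have := congrArg (fun q : H => (ω q (y c d) (S (k := k) (y e d')) : k))
      (id_betaS_entry ht a b)
    simpa using this
  calc _ = ∑ a, ∑ b, ∑ c, ∑ d', ∑ f, ∑ g,
        (ωInv (S (k := k) (t s.1 i')) (y j s.2.1) (S (k := k) (y s.2.2 j')) : k) *
        (ω (t i a) (S (k := k) (t b s.1)) (y s.2.1 c * S (k := k) (y d' s.2.2)) *
        ((β (t f g) : k) * ω (t a f * S (k := k) (t g b)) (y c d) (S (k := k) (y e d')))) := by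
        rw [← sum_comm₂₄]
        simp only [Finset.mul_sum]
        refine Fintype.sum_congr _ _ fun f => Fintype.sum_congr _ _ fun g =>
          Fintype.sum_congr _ _ fun a => Fintype.sum_congr _ _ fun b =>
          Fintype.sum_congr _ _ fun c => Fintype.sum_congr _ _ fun d' => ?_
        ring
    _ = _ := by
        simp only [← Finset.mul_sum, h2]
        congr 1
        refine Fintype.sum_congr _ _ fun a => Fintype.sum_congr _ _ fun b => ?_
        rw [Finset.sum_eq_single d, Finset.sum_eq_single e]
        · simp [mul_comm]
        · intro d' _ h; simp [h]
        · simp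
        · intro c _ h; simp [h]
        · simp

/-- `ω(x₁, S(x₃)z₁, S(z₄)) u(x₂,z₂) β(z₃) = β(x₁) w(S(x₂),z)` on comatrix entries. -/
theorem uForm_wForm (ht : IsComatrix k t) (hy : IsComatrix k y) (i i' : Fin n) (j j' : Fin m) :
    ∑ a, ∑ b, ∑ c, ∑ d, ∑ e, (β (y d e) : k) * (uForm k H (t a b) (y c d) *
      ω (t i a) (S (k := k) (t b i') * y j c) (S (k := k) (y e j'))) =
    ∑ a, (β (t i a) : k) * wForm k H (S (k := k) (t a i')) (y j j') := by
  have h3 : ∀ (a b s2 : Fin n) (s3 s4 : Fin m), ∑ d, ∑ e, (β (y d e) : k) * ω (t i a) (S (k := k) (t b s2))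
      (y s3 d * S (k := k) (y e s4)) =
      (β (y s3 s4) : k) * if i = a ∧ s2 = b then 1 else 0 := by
    intro a b s2 s3 s4
    rw [← ω_one_right (k := k) ht ht.antipode i a s2 b]
    have := congrArg (fun q : H => (ω (t i a) (S (k := k) (t b s2)) q : k))
      (id_betaS_entry hy s3 s4)
    simpa using this
  calc _ = ∑ d, ∑ e, (β (y d e) : k) * ∑ f, ∑ g, (β (t f g) : k) * ∑ a, ∑ b, ∑ c,
      (ω (t i a) (S (k := k) (t b i') * y j c) (S (k := k) (y e j')) : k) *
        ω (t a f) (S (k := k) (t g b)) (y c d) := by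
        rw [sum_comm₃₂]
        refine Fintype.sum_congr _ _ fun d => Fintype.sum_congr _ _ fun e => ?_
        simp only [← Finset.mul_sum]
        congr 1
        simp only [uForm_entry ht, Finset.sum_mul, Finset.mul_sum]
        rw [sum_comm₃₂]
        refine Fintype.sum_congr _ _ fun f => Fintype.sum_congr _ _ fun g =>
          Fintype.sum_congr _ _ fun a => Fintype.sum_congr _ _ fun b =>
          Fintype.sum_congr _ _ fun c => ?_
        ring
    _ = ∑ s : Fin n × Fin m × Fin m,
      (ωInv (S (k := k) (t s.1 i')) (y j s.2.1) (S (k := k) (y s.2.2 j')) : k) *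
        ((β (y s.2.1 s.2.2) : k) * β (t i s.1)) := by
        simp only [uForm_wForm_aux ht hy]
        simp only [Finset.mul_sum (s := (Finset.univ : Finset (Fin n × Fin m × Fin m)))]
        rw [sum_comm₂₁]
        refine Fintype.sum_congr _ _ fun s => ?_
        calc _ = ∑ a, ∑ b, (ωInv (S (k := k) (t s.1 i')) (y j s.2.1) (S (k := k) (y s.2.2 j')) : k)
              * ((β (t a b) : k) * ∑ d, ∑ e, (β (y d e) : k) *
              ω (t i a) (S (k := k) (t b s.1)) (y s.2.1 d * S (k := k) (y e s.2.2))) := by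
              simp only [Finset.mul_sum]
              have h4 := Finset.sum_comm (s := (Finset.univ : Finset (Fin m × Fin m)))
                (t := (Finset.univ : Finset (Fin n × Fin n))) (f := fun p q => (β (y p.1 p.2) : k) *
                ((ωInv (S (k := k) (t s.1 i')) (y j s.2.1) (S (k := k) (y s.2.2 j')) : k) *
                ((β (t q.1 q.2) : k) * ω (t i q.1) (S (k := k) (t q.2 s.1))
                  (y s.2.1 p.1 * S (k := k) (y p.2 s.2.2)))))
              simp only [Fintype.sum_prod_type] at h4
              rw [h4]
              refine Fintype.sum_congr _ _ fun a => Fintype.sum_congr _ _ fun b =>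
                Fintype.sum_congr _ _ fun d => Fintype.sum_congr _ _ fun e => ?_
              ring
          _ = _ := by
              simp only [h3]
              simp only [← Finset.mul_sum]
              congr 1
              rw [Finset.sum_eq_single i, Finset.sum_eq_single s.1]
              · simp [mul_comm]
              · intro b _ h; simp [h.symm]
              · simp
              · intro a _ h; simp [h.symm]
              · simp
    _ = _ := by
        simp only [wForm_entry hy, Fintype.sum_prod_type, Finset.mul_sum]
        refine Fintype.sum_congr _ _ fun a => Fintype.sum_congr _ _ fun b =>
          Fintype.sum_congr _ _ fun c => ?_
        ring

end Forms

/-! ### The Morita context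

The two algebras are `Hom^H(H̄, A)` and `Hom(H, B)`, the two bimodules are `Hom^H(H, A)` and
`Hom^H(H^S, A)`. The tensor product of two modules over an algebra is the quotient of their tensor
product over the field by the relations `ps ⊗ q = p ⊗ sq`, so it involves the algebra through its
actions only. -/

section Morita

variable (k H A : Type*) [Field k] [NonAssocRing H] [Module k H]
  [SMulCommClass k H H] [IsScalarTower k H H] [Coalgebra k H] [CoquasiHopfAlgebra k H]
  [NonAssocRing A] [Module k A] [SMulCommClass k A A] [IsScalarTower k A A]
  [ComoduleAlgebra k H A]

/-- The coaction `h ↦ h₂ ⊗ S(h₁)` of the comodule `H^S`. -/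
def coactS : H →ₗ[k] H ⊗[k] H :=
  (TensorProduct.comm k H H).toLinearMap ∘ₗ convTmul S LinearMap.id

/-- The right adjoint coaction `h ↦ h₂ ⊗ S(h₁)h₃` of the comodule `H̄`. -/
def coactAd : H →ₗ[k] H ⊗[k] H :=
  conv (LinearMap.lTensorHom H ∘ₗ LinearMap.mul k H) S comul

variable {k H} in
/-- The colinear maps from `H`, with the coaction `ρ`, to `A`. -/
def HomH (ρ : H →ₗ[k] H ⊗[k] H) : Submodule k (H →ₗ[k] A) where
  carrier := {f | coact k H A ∘ₗ f = f.rTensor H ∘ₗ ρ}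
  add_mem' {f g} hf hg := by
    change _ ∘ₗ _ = _ at hf hg ⊢
    rw [LinearMap.comp_add, hf, hg, LinearMap.rTensor_add, LinearMap.add_comp]
  zero_mem' := by
    change _ ∘ₗ _ = _
    simp
  smul_mem' c f hf := by
    change _ ∘ₗ _ = _ at hf ⊢
    rw [LinearMap.comp_smul, hf, LinearMap.rTensor_smul, LinearMap.smul_comp]

/-- `Hom(H, B)`, with `B` the coinvariants of `A`. -/
abbrev HomR := H →ₗ[k] Coinv k H A

/-- `Hom^H(H, A)`. -/
abbrev HomP : Submodule k (H →ₗ[k] A) := HomH A (comul (R := k) (A := H))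

/-- `Hom^H(H^S, A)`. -/
abbrev HomQ : Submodule k (H →ₗ[k] A) := HomH A (coactS k H)

/-- `Hom^H(H̄, A)`. -/
abbrev HomS : Submodule k (H →ₗ[k] A) := HomH A (coactAd k H)

variable {k H A}

/-- `(rp)(h) = r(h₁) p(h₂)`. -/
def mulRP (r : HomR k H A) (p : H →ₗ[k] A) : H →ₗ[k] A :=
  conv (LinearMap.mul k A) ((Coinv k H A).subtype ∘ₗ r) p

/-- `(qr)(h) = q(h₁) r(h₂)`. -/
def mulQR (q : H →ₗ[k] A) (r : HomR k H A) : H →ₗ[k] A :=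
  conv (LinearMap.mul k A) q ((Coinv k H A).subtype ∘ₗ r)

/-- `(ps)(h) = p(h₁) s(h₅) β(h₃) ω(h₂, S(h₄), h₆)`, that is,
`(ps)(h) = p(h₁) s(h₃) u(h₂, h₄)` with `u(x, z) = ω(x₁, β(x₂) S(x₃), z)`. -/
def mulPS (p s : H →ₗ[k] A) : H →ₗ[k] A :=
  (TensorProduct.rid k A).toLinearMap ∘ₗ
    conv (TensorProduct.map₂ (LinearMap.mul k A) (uForm k H))
      (convTmul p LinearMap.id) (convTmul s LinearMap.id)

/-- `(sq)(h) = s(h₂) q(h₆) β(h₄) ω⁻¹(S(h₁), h₃, S(h₅))`, that is,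
`(sq)(h) = s(h₂) q(h₄) w(S(h₁), h₃)` with `w(x, z) = ω⁻¹(x, z₁ β(z₂), S(z₃))`. -/
def mulSQ (s q : H →ₗ[k] A) : H →ₗ[k] A :=
  (TensorProduct.lid k A).toLinearMap ∘ₗ
    conv (TensorProduct.map₂ (wForm k H ∘ₗ S) (LinearMap.mul k A))
      (convTmul LinearMap.id s) (convTmul LinearMap.id q)

/-- `(p, q)(h) = p(h₁) β(h₂) q(h₃)`. -/
def parenFun (p q : H →ₗ[k] A) : H →ₗ[k] A := conv (LinearMap.mul k A) p (convL β q)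

/-- `[q, p](h) = q(h₁) p(h₂)`. -/
def bracketFun (q p : H →ₗ[k] A) : H →ₗ[k] A := conv (LinearMap.mul k A) q p

variable {n : ℕ} {t : Fin n → Fin n → H}

theorem coactS_entry (ht : IsComatrix k t) (i j : Fin n) :
    coactS k H (t i j) = ∑ a, t a j ⊗ₜ[k] S (k := k) (t i a) := by
  simp [coactS, ht.convTmul]

theorem coactAd_entry (ht : IsComatrix k t) (i j : Fin n) :
    coactAd k H (t i j) = ∑ a, ∑ b, t a b ⊗ₜ[k] (S (k := k) (t i a) * t b j) := by
  simp [coactAd, ht.conv, ht.comul_eq]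

theorem coact_P (ht : IsComatrix k t) {p : H →ₗ[k] A} (hp : p ∈ HomP k H A) (i j : Fin n) :
    coact k H A (p (t i j)) = ∑ a, p (t i a) ⊗ₜ[k] t a j := by
  have h := LinearMap.congr_fun (show _ ∘ₗ _ = _ from hp) (t i j)
  simpa [ht.comul_eq] using h

theorem coact_Q (ht : IsComatrix k t) {q : H →ₗ[k] A} (hq : q ∈ HomQ k H A) (i j : Fin n) :
    coact k H A (q (t i j)) = ∑ a, q (t a j) ⊗ₜ[k] S (k := k) (t i a) := by
  have h := LinearMap.congr_fun (show _ ∘ₗ _ = _ from hq) (t i j)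
  simpa [coactS_entry ht] using h

theorem coact_S (ht : IsComatrix k t) {s : H →ₗ[k] A} (hs : s ∈ HomS k H A) (i j : Fin n) :
    coact k H A (s (t i j)) =
      ∑ x : Fin n × Fin n, s (t x.1 x.2) ⊗ₜ[k] (S (k := k) (t i x.1) * t x.2 j) := by
  have h := LinearMap.congr_fun (show _ ∘ₗ _ = _ from hs) (t i j)
  simpa [coactAd_entry ht, Fintype.sum_prod_type] using h

theorem mulPS_entry (ht : IsComatrix k t) (p s : H →ₗ[k] A) (i j : Fin n) :
    mulPS p s (t i j) =
      ∑ a, ∑ b, ∑ c, uForm k H (t a b) (t c j) • (p (t i a) * s (t b c)) := by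
  simp only [mulPS, LinearMap.coe_comp, Function.comp_apply, ht.conv, ht.convTmul, map_sum,
    LinearMap.sum_apply, TensorProduct.map₂_apply_tmul, TensorProduct.map_tmul,
    LinearMap.id_apply, LinearMap.mul_apply', LinearEquiv.coe_coe, TensorProduct.rid_tmul]
  rw [sum_comm₂₁, Finset.sum_comm]

theorem mulSQ_entry (ht : IsComatrix k t) (s q : H →ₗ[k] A) (i j : Fin n) :
    mulSQ s q (t i j) =
      ∑ a, ∑ b, ∑ c, wForm k H (S (k := k) (t i a)) (t b c) • (s (t a b) * q (t c j)) := by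
  simp only [mulSQ, LinearMap.coe_comp, Function.comp_apply, ht.conv, ht.convTmul, map_sum,
    LinearMap.sum_apply, TensorProduct.map₂_apply_tmul, TensorProduct.map_tmul,
    LinearMap.id_apply, LinearMap.mul_apply', LinearEquiv.coe_coe, TensorProduct.lid_tmul]
  rw [sum_comm₂₁, Finset.sum_comm]

theorem parenFun_entry (ht : IsComatrix k t) (p q : H →ₗ[k] A) (i j : Fin n) :
    parenFun p q (t i j) = ∑ a, ∑ b, (β (t a b) : k) • (p (t i a) * q (t b j)) := by
  simp [parenFun, convL, ht.conv]

theorem bracketFun_entry (ht : IsComatrix k t) (q p : H →ₗ[k] A) (i j : Fin n) :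
    bracketFun q p (t i j) = ∑ a, q (t i a) * p (t a j) := by
  simp [bracketFun, ht.conv]

theorem mulRP_entry (ht : IsComatrix k t) (r : HomR k H A) (p : H →ₗ[k] A) (i j : Fin n) :
    mulRP r p (t i j) = ∑ a, (r (t i a) : A) * p (t a j) := by
  simp [mulRP, ht.conv]

theorem mulQR_entry (ht : IsComatrix k t) (q : H →ₗ[k] A) (r : HomR k H A) (i j : Fin n) :
    mulQR q r (t i j) = ∑ a, q (t i a) * (r (t a j) : A) := by
  simp [mulQR, ht.conv]

theorem mulRP_mem (r : HomR k H A) {p : H →ₗ[k] A} (hp : p ∈ HomP k H A) :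
    mulRP r p ∈ HomP k H A := by
  refine ext_comatrix fun {n t} ht i j => ?_
  simp only [LinearMap.coe_comp, Function.comp_apply, mulRP_entry ht, map_sum,
    coact_coinv_mul _ (r _).2, coact_P ht hp, ht.comul_eq, LinearMap.rTensor_tmul,
    TensorProduct.sum_tmul, TensorProduct.map_tmul, LinearMap.mulLeft_apply, LinearMap.id_apply]
  exact Finset.sum_comm

theorem mulQR_mem {q : H →ₗ[k] A} (hq : q ∈ HomQ k H A) (r : HomR k H A) :
    mulQR q r ∈ HomQ k H A := by
  refine ext_comatrix fun {n t} ht i j => ?_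
  simp only [LinearMap.coe_comp, Function.comp_apply, mulQR_entry ht, map_sum,
    coact_mul_coinv _ (r _).2, coact_Q ht hq, coactS_entry ht, LinearMap.rTensor_tmul,
    TensorProduct.sum_tmul, TensorProduct.map_tmul, LinearMap.mulRight_apply, LinearMap.id_apply]
  exact Finset.sum_comm

theorem coact_mul_sum {ι κ : Type*} [Fintype ι] [Fintype κ] {a b : A} {a₀ : ι → A} {a₁ : ι → H}
    {b₀ : κ → A} {b₁ : κ → H} (ha : coact k H A a = ∑ i, a₀ i ⊗ₜ[k] a₁ i)
    (hb : coact k H A b = ∑ j, b₀ j ⊗ₜ[k] b₁ j) :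
    coact k H A (a * b) = ∑ i, ∑ j, (a₀ i * b₀ j) ⊗ₜ[k] (a₁ i * b₁ j) := by
  rw [ComoduleAlgebra.ρ_mul, ha, hb]
  simp only [map_sum, LinearMap.sum_apply, TensorProduct.map₂_apply_tmul, TensorProduct.map_tmul,
    LinearMap.mul_apply']
  exact Finset.sum_comm

theorem sum_comm₃₃ {I J K L M N : Type*} [Fintype I] [Fintype J] [Fintype K] [Fintype L]
    [Fintype M] [Fintype N] {V : Type*} [AddCommMonoid V] (f : I → J → K → L → M → N → V) :
    ∑ a, ∑ b, ∑ c, ∑ d, ∑ e, ∑ g, f a b c d e g =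
      ∑ d, ∑ e, ∑ g, ∑ a, ∑ b, ∑ c, f a b c d e g := by
  have h1 := Finset.sum_comm (s := (Finset.univ : Finset (I × J × K)))
    (t := (Finset.univ : Finset (L × M × N)))
    (f := fun p q => f p.1 p.2.1 p.2.2 q.1 q.2.1 q.2.2)
  simpa only [Fintype.sum_prod_type] using h1

theorem sum_comm₃₁ {I J K L : Type*} [Fintype I] [Fintype J] [Fintype K] [Fintype L]
    {V : Type*} [AddCommMonoid V] (f : I → J → K → L → V) :
    ∑ a, ∑ b, ∑ c, ∑ d, f a b c d = ∑ d, ∑ a, ∑ b, ∑ c, f a b c d := by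
  have h1 := Finset.sum_comm (s := (Finset.univ : Finset (I × J × K)))
    (t := (Finset.univ : Finset L)) (f := fun p q => f p.1 p.2.1 p.2.2 q)
  simpa only [Fintype.sum_prod_type] using h1

theorem sum_comm₂₃₄ {I J K L M N O P Q : Type*} [Fintype I] [Fintype J] [Fintype K] [Fintype L]
    [Fintype M] [Fintype N] [Fintype O] [Fintype P] [Fintype Q] {V : Type*} [AddCommMonoid V]
    (f : I → J → K → L → M → N → O → P → Q → V) :
    ∑ g, ∑ h, ∑ a, ∑ b, ∑ c, ∑ l, ∑ d, ∑ e, ∑ j, f g h a b c l d e j =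
      ∑ l, ∑ d, ∑ e, ∑ j, ∑ a, ∑ b, ∑ c, ∑ g, ∑ h, f g h a b c l d e j := by
  have h1 := Finset.sum_comm (s := (Finset.univ : Finset (I × J)))
    (t := (Finset.univ : Finset (K × L × M)))
    (f := fun p q => ∑ x : N × O × P × Q,
      f p.1 p.2 q.1 q.2.1 q.2.2 x.1 x.2.1 x.2.2.1 x.2.2.2)
  have h2 := Finset.sum_comm (s := (Finset.univ : Finset ((K × L × M) × (I × J))))
    (t := (Finset.univ : Finset (N × O × P × Q)))
    (f := fun p x => f p.2.1 p.2.2 p.1.1 p.1.2.1 p.1.2.2 x.1 x.2.1 x.2.2.1 x.2.2.2)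
  simp only [Fintype.sum_prod_type] at h1 h2
  exact h1.trans h2

theorem mulPS_mem {p s : H →ₗ[k] A} (hp : p ∈ HomP k H A) (hs : s ∈ HomS k H A) :
    mulPS p s ∈ HomP k H A := by
  refine ext_comatrix fun {n t} ht i j => ?_
  have h1 : ∀ a b c, coact k H A (p (t i a) * s (t b c)) = ∑ l, ∑ d, ∑ e,
      (p (t i l) * s (t d e)) ⊗ₜ[k] (t l a * (S (k := k) (t b d) * t e c)) := by
    intro a b c
    rw [coact_mul_sum (coact_P ht hp i a) (coact_S ht hs b c)]
    simp only [Fintype.sum_prod_type]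
  simp only [LinearMap.coe_comp, Function.comp_apply, mulPS_entry ht, map_sum, map_smul, h1,
    ht.comul_eq, LinearMap.rTensor_tmul, Finset.smul_sum, TensorProduct.sum_tmul]
  refine (sum_comm₃₃ _).trans (Eq.trans ?_ (sum_comm₃₁ _))
  refine Fintype.sum_congr _ _ fun l => Fintype.sum_congr _ _ fun d =>
    Fintype.sum_congr _ _ fun e => ?_
  have h2 := congrArg (fun x : H => (p (t i l) * s (t d e)) ⊗ₜ[k] x)
    (uForm_colinear ht ht l d e j)
  simpa only [TensorProduct.tmul_sum, TensorProduct.tmul_smul, TensorProduct.smul_tmul'] using h2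

theorem mulSQ_mem {s q : H →ₗ[k] A} (hs : s ∈ HomS k H A) (hq : q ∈ HomQ k H A) :
    mulSQ s q ∈ HomQ k H A := by
  refine ext_comatrix fun {n t} ht i j => ?_
  have h1 : ∀ a b c, coact k H A (s (t a b) * q (t c j)) = ∑ d, ∑ e, ∑ l,
      (s (t d e) * q (t l j)) ⊗ₜ[k] ((S (k := k) (t a d) * t e b) * S (k := k) (t c l)) := by
    intro a b c
    rw [coact_mul_sum (coact_S ht hs a b) (coact_Q ht hq c j)]
    simp only [Fintype.sum_prod_type]
  simp only [LinearMap.coe_comp, Function.comp_apply, mulSQ_entry ht, map_sum, map_smul, h1,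
    coactS_entry ht, LinearMap.rTensor_tmul, Finset.smul_sum, TensorProduct.sum_tmul]
  refine (sum_comm₃₃ _).trans (Eq.trans ?_ (sum_comm₃₁ _))
  refine Fintype.sum_congr _ _ fun d => Fintype.sum_congr _ _ fun e =>
    Fintype.sum_congr _ _ fun l => ?_
  have h2 := congrArg (fun x : H => (s (t d e) * q (t l j)) ⊗ₜ[k] x)
    (wForm_colinear ht.antipode ht d i e l)
  simpa only [TensorProduct.tmul_sum, TensorProduct.tmul_smul, TensorProduct.smul_tmul'] using h2

theorem parenFun_mem {p q : H →ₗ[k] A} (hp : p ∈ HomP k H A) (hq : q ∈ HomQ k H A) (h : H) :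
    parenFun p q h ∈ Coinv k H A := by
  refine LinearMap.congr_fun (f := coact k H A ∘ₗ parenFun p q)
    (g := (TensorProduct.mk k A H).flip 1 ∘ₗ parenFun p q) (ext_comatrix fun {n t} ht i j => ?_) h
  have h1 : ∀ a b, coact k H A (p (t i a) * q (t b j)) = ∑ c, ∑ d,
      (p (t i c) * q (t d j)) ⊗ₜ[k] (t c a * S (k := k) (t b d)) := fun a b =>
    coact_mul_sum (coact_P ht hp i a) (coact_Q ht hq b j)
  simp only [LinearMap.coe_comp, Function.comp_apply, parenFun_entry ht, map_sum, map_smul, h1,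
    Finset.smul_sum, LinearMap.flip_apply, TensorProduct.mk_apply]
  have h4 := Finset.sum_comm (s := (Finset.univ : Finset (Fin n × Fin n)))
    (t := (Finset.univ : Finset (Fin n × Fin n))) (f := fun x y => (β (t x.1 x.2) : k) •
      ((p (t i y.1) * q (t y.2 j)) ⊗ₜ[k] (t y.1 x.1 * S (k := k) (t x.2 y.2))))
  simp only [Fintype.sum_prod_type] at h4
  rw [h4]
  refine Fintype.sum_congr _ _ fun c => Fintype.sum_congr _ _ fun d => ?_
  have h2 := congrArg (fun x : H => (p (t i c) * q (t d j)) ⊗ₜ[k] x) (id_betaS_entry ht c d)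
  simpa only [TensorProduct.tmul_sum, TensorProduct.tmul_smul] using h2

theorem bracketFun_mem {q p : H →ₗ[k] A} (hq : q ∈ HomQ k H A) (hp : p ∈ HomP k H A) :
    bracketFun q p ∈ HomS k H A := by
  refine ext_comatrix fun {n t} ht i j => ?_
  have h1 : ∀ a, coact k H A (q (t i a) * p (t a j)) = ∑ c, ∑ d,
      (q (t c a) * p (t a d)) ⊗ₜ[k] (S (k := k) (t i c) * t d j) := fun a =>
    coact_mul_sum (coact_Q ht hq i a) (coact_P ht hp a j)
  simp only [LinearMap.coe_comp, Function.comp_apply, bracketFun_entry ht, map_sum, h1,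
    coactAd_entry ht, LinearMap.rTensor_tmul, TensorProduct.sum_tmul]
  rw [← sum_comm₂₁]

/-- `[qr, p] = [q, rp]`. -/
theorem bracket_balanced (q p : H →ₗ[k] A) (r : HomR k H A) :
    bracketFun (mulQR q r) p = bracketFun q (mulRP r p) := by
  refine ext_comatrix fun {n t} ht i j => ?_
  simp only [bracketFun_entry ht, mulQR_entry ht, mulRP_entry ht, Finset.sum_mul, Finset.mul_sum,
    assoc_mid _ _ (r _).2]
  exact Finset.sum_comm

/-- `(ps, q) = (p, sq)`. -/
theorem paren_balanced {p s q : H →ₗ[k] A} (hp : p ∈ HomP k H A) (hs : s ∈ HomS k H A)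
    (hq : q ∈ HomQ k H A) : parenFun (mulPS p s) q = parenFun p (mulSQ s q) := by
  refine ext_comatrix fun {n t} ht i j => ?_
  have h1 : ∀ a b c h, (p (t i a) * s (t b c)) * q (t h j) = ∑ l, ∑ d, ∑ e, ∑ f,
      (ω (t l a) (S (k := k) (t b d) * t e c) (S (k := k) (t h f)) : k) •
        (p (t i l) * (s (t d e) * q (t f j))) := by
    intro a b c h
    rw [ComoduleAlgebra.mul_assoc_ω (k := k) (H := H) _ _ _ _ _ _ _ _ _ (coact_P ht hp i a)
      (coact_S ht hs b c) (coact_Q ht hq h j)]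
    simp only [Fintype.sum_prod_type]
  have h2 : ∀ l d e f, ∑ a, ∑ b, ∑ c, ∑ g, ∑ h, ((β (t g h) : k) * (uForm k H (t a b) (t c g) *
      ω (t l a) (S (k := k) (t b d) * t e c) (S (k := k) (t h f)))) •
        (p (t i l) * (s (t d e) * q (t f j))) =
      ∑ a, ((β (t l a) : k) * wForm k H (S (k := k) (t a d)) (t e f)) •
        (p (t i l) * (s (t d e) * q (t f j))) := by
    intro l d e f
    simp only [← Finset.sum_smul]
    rw [uForm_wForm ht ht]
  have h3 : ∀ g h, (β (t g h) : k) • (mulPS p s (t i g) * q (t h j)) =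
      ∑ a, ∑ b, ∑ c, ∑ l, ∑ d, ∑ e, ∑ f, ((β (t g h) : k) * (uForm k H (t a b) (t c g) *
        ω (t l a) (S (k := k) (t b d) * t e c) (S (k := k) (t h f)))) •
        (p (t i l) * (s (t d e) * q (t f j))) := by
    intro g h
    rw [mulPS_entry ht]
    simp only [Finset.sum_mul, Finset.smul_sum]
    refine Fintype.sum_congr _ _ fun a => Fintype.sum_congr _ _ fun b =>
      Fintype.sum_congr _ _ fun c => ?_
    rw [smul_mul_assoc, h1]
    simp only [Finset.smul_sum, smul_smul]
  have h5 : ∀ l a, (β (t l a) : k) • (p (t i l) * mulSQ s q (t a j)) =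
      ∑ d, ∑ e, ∑ f, ((β (t l a) : k) * wForm k H (S (k := k) (t a d)) (t e f)) •
        (p (t i l) * (s (t d e) * q (t f j))) := by
    intro l a
    rw [mulSQ_entry ht]
    simp only [Finset.mul_sum, Finset.smul_sum]
    refine Fintype.sum_congr _ _ fun d => Fintype.sum_congr _ _ fun e =>
      Fintype.sum_congr _ _ fun f => ?_
    rw [mul_smul_comm, smul_smul]
  rw [parenFun_entry ht, parenFun_entry ht]
  simp only [h3, h5]
  refine (sum_comm₂₃₄ _).trans ?_
  refine Fintype.sum_congr _ _ fun l => ?_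
  refine Eq.trans ?_ (sum_comm₃₁ _)
  exact Fintype.sum_congr _ _ fun d => Fintype.sum_congr _ _ fun e =>
    Fintype.sum_congr _ _ fun f => h2 l d e f

end Morita

/-! ### Balanced tensor products -/

section Balanced

variable {k P Q R : Type*} [Field k] [AddCommGroup P] [Module k P] [AddCommGroup Q] [Module k Q]

/-- The relations `pr ⊗ q = p ⊗ rq`. -/
def balRel (act : P → R → P) (act' : R → Q → Q) : Submodule k (P ⊗[k] Q) :=
  Submodule.span k {x | ∃ p r q, x = act p r ⊗ₜ[k] q - p ⊗ₜ[k] act' r q}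

variable (k) in
/-- The tensor product of `P` and `Q` balanced over a right action of `R` on `P` and a left action
of `R` on `Q`: the quotient of `P ⊗ Q` by the relations `pr ⊗ q = p ⊗ rq`. -/
abbrev BalTensor (act : P → R → P) (act' : R → Q → Q) : Type _ :=
  (P ⊗[k] Q) ⧸ (balRel act act' : Submodule k (P ⊗[k] Q))

/-- The linear map on a balanced tensor product induced by a balanced bilinear map. -/
def balLift {U : Type*} [AddCommGroup U] [Module k U] (act : P → R → P) (act' : R → Q → Q)
    (f : P →ₗ[k] Q →ₗ[k] U) (hf : ∀ p r q, f (act p r) q = f p (act' r q)) :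
    BalTensor k act act' →ₗ[k] U :=
  (balRel act act').liftQ (TensorProduct.lift f) <| by
    rw [balRel, Submodule.span_le]
    rintro _ ⟨p, r, q, rfl⟩
    rw [SetLike.mem_coe, LinearMap.mem_ker, map_sub, TensorProduct.lift.tmul,
      TensorProduct.lift.tmul, hf, sub_self]
end Balanced

section Context

variable (k H A : Type*) [Field k] [NonAssocRing H] [Module k H]
  [SMulCommClass k H H] [IsScalarTower k H H] [Coalgebra k H] [CoquasiHopfAlgebra k H]
  [NonAssocRing A] [Module k A] [SMulCommClass k A A] [IsScalarTower k A A]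
  [ComoduleAlgebra k H A]

/-- The left action of `Hom(H, B)` on `Hom^H(H, A)`. -/
def actRP (r : HomR k H A) (p : HomP k H A) : HomP k H A := ⟨mulRP r p, mulRP_mem r p.2⟩

/-- The right action of `Hom^H(H̄, A)` on `Hom^H(H, A)`. -/
def actPS (p : HomP k H A) (s : HomS k H A) : HomP k H A :=
  ⟨mulPS p.1 s.1, mulPS_mem p.2 s.2⟩

/-- The left action of `Hom^H(H̄, A)` on `Hom^H(H^S, A)`. -/
def actSQ (s : HomS k H A) (q : HomQ k H A) : HomQ k H A :=
  ⟨mulSQ s.1 q.1, mulSQ_mem s.2 q.2⟩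

/-- The right action of `Hom(H, B)` on `Hom^H(H^S, A)`. -/
def actQR (q : HomQ k H A) (r : HomR k H A) : HomQ k H A := ⟨mulQR q r, mulQR_mem q.2 r⟩

/-- `Hom^H(H, A) ⊗ Hom^H(H^S, A)` over `Hom^H(H̄, A)`. -/
abbrev TensorPQ : Type _ := BalTensor k (actPS k H A) (actSQ k H A)

/-- `Hom^H(H^S, A) ⊗ Hom^H(H, A)` over `Hom(H, B)`. -/
abbrev TensorQP : Type _ := BalTensor k (actQR k H A) (actRP k H A)

/-- `(p, q) ↦ (h ↦ p(h₁) β(h₂) q(h₃))` as a bilinear map. -/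
def parenBil : HomP k H A →ₗ[k] HomQ k H A →ₗ[k] HomR k H A :=
  LinearMap.mk₂ k (fun p q => (parenFun p.1 q.1).codRestrict (Coinv k H A)
      (parenFun_mem p.2 q.2))
    (fun p p' q => by
      refine ext_comatrix fun ht i j => Subtype.ext ?_
      simp [parenFun_entry ht, add_mul, Finset.sum_add_distrib])
    (fun c p q => by
      refine ext_comatrix fun ht i j => Subtype.ext ?_
      simp [parenFun_entry ht, Finset.smul_sum, smul_mul_assoc, smul_comm c])
    (fun p q q' => by
      refine ext_comatrix fun ht i j => Subtype.ext ?_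
      simp [parenFun_entry ht, mul_add, Finset.sum_add_distrib])
    (fun c p q => by
      refine ext_comatrix fun ht i j => Subtype.ext ?_
      simp [parenFun_entry ht, Finset.smul_sum, mul_smul_comm, smul_comm c])

/-- `(q, p) ↦ (h ↦ q(h₁) p(h₂))` as a bilinear map. -/
def bracketBil : HomQ k H A →ₗ[k] HomP k H A →ₗ[k] HomS k H A :=
  LinearMap.mk₂ k (fun q p => ⟨bracketFun q.1 p.1, bracketFun_mem q.2 p.2⟩)
    (fun q q' p => Subtype.ext (ext_comatrix fun ht i j => by
      simp [bracketFun_entry ht, add_mul, Finset.sum_add_distrib]))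
    (fun c q p => Subtype.ext (ext_comatrix fun ht i j => by
      simp [bracketFun_entry ht, Finset.smul_sum, smul_mul_assoc]))
    (fun q p p' => Subtype.ext (ext_comatrix fun ht i j => by
      simp [bracketFun_entry ht, mul_add, Finset.sum_add_distrib]))
    (fun c q p => Subtype.ext (ext_comatrix fun ht i j => by
      simp [bracketFun_entry ht, Finset.smul_sum, mul_smul_comm]))

/-- The connecting map `(-,-)` of the Morita context. -/
def paren : TensorPQ k H A →ₗ[k] HomR k H A :=
  balLift (actPS k H A) (actSQ k H A) (parenBil k H A) fun p s q =>
    LinearMap.ext fun x => Subtype.ext (LinearMap.congr_fun (paren_balanced p.2 s.2 q.2) x)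

/-- The connecting map `[-,-]` of the Morita context. -/
def bracket : TensorQP k H A →ₗ[k] HomS k H A :=
  balLift (actQR k H A) (actRP k H A) (bracketBil k H A) fun q r p =>
    Subtype.ext (bracket_balanced q.1 p.1 r)

/-- The Morita context is strict: both connecting maps are surjective. -/
def IsStrict : Prop :=
  Function.Surjective (paren k H A) ∧ Function.Surjective (bracket k H A)

/-! ### Galois and cleft extensions, direct summands -/

/-- `A ⊗_B A`. -/
abbrev TensorB : Type _ :=
  BalTensor k (fun (a : A) (b : Coinv k H A) => a * b.1) (fun (b : Coinv k H A) (c : A) => b.1 * c)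

/-- `(x, z) ↦ w(x, z₁) z₂ = ω⁻¹(x, z₁ β(z₂), S(z₃)) z₄`. -/
def canForm : H →ₗ[k] H →ₗ[k] H :=
  LinearMap.mk₂ k (fun x z => convL (wForm k H x) LinearMap.id z)
    (fun x x' z => LinearMap.congr_fun (f := convL (wForm k H (x + x')) LinearMap.id)
      (g := convL (wForm k H x) LinearMap.id + convL (wForm k H x') LinearMap.id)
      (ext_comatrix fun ht i j => by
        simp [convL, ht.conv, Finset.sum_add_distrib]) z)
    (fun c x z => LinearMap.congr_fun (f := convL (wForm k H (c • x)) LinearMap.id)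
      (g := c • convL (wForm k H x) LinearMap.id)
      (ext_comatrix fun ht i j => by
        simp [convL, ht.conv, mul_smul, Finset.smul_sum]) z)
    (fun x z z' => map_add _ z z')
    (fun c x z => map_smul _ c z)

/-- `(a, b) ↦ a₀ b₀ ⊗ b₄ ω⁻¹(a₁, b₁ β(b₂), S(b₃))`. -/
def canBil : A →ₗ[k] A →ₗ[k] A ⊗[k] H :=
  (TensorProduct.map₂ (LinearMap.mul k A) (canForm k H)).compl₁₂ (coact k H A) (coact k H A)

/-- The canonical map `can : A ⊗_B A → A ⊗ H`. -/
def can : TensorB k H A →ₗ[k] A ⊗[k] H :=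
  balLift _ _ (canBil k H A) <| by
    intro a b c
    simp only [canBil, LinearMap.compl₁₂_apply, coact_mul_coinv a b.2, coact_coinv_mul c b.2]
    generalize coact k H A a = x
    generalize coact k H A c = y
    induction x with
    | zero => simp
    | add x x' hx hx' => simp only [map_add, LinearMap.add_apply, hx, hx']
    | tmul a₀ a₁ =>
      induction y with
      | zero => simp
      | add y y' hy hy' => simp only [map_add, hy, hy']
      | tmul c₀ c₁ => simp [assoc_mid _ _ b.2]

/-- The extension `B ⊆ A` is Galois. -/
def IsGalois : Prop := Function.Bijective (can k H A)

/-- The extension `B ⊆ A` is cleft: there are a colinear `γ : H → A` and a linear `δ : H → A` with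
`ρ(δ(h)) = δ(h₂) ⊗ S(h₁)`, `δ(h₁)γ(h₂) = α(h)1` and `γ(h₁)β(h₂)δ(h₃) = ε(h)1`. -/
def IsCleft : Prop :=
  ∃ γ δ : H →ₗ[k] A,
    (∀ h, coact k H A (γ h) = γ.rTensor H (comul h)) ∧
    (∀ h, coact k H A (δ h) =
      TensorProduct.comm k H A (TensorProduct.map S δ (comul h))) ∧
    (∀ h, conv (LinearMap.mul k A) δ γ h = (α h : k) • (1 : A)) ∧
    (∀ h, conv (LinearMap.mul k A) γ (convL β δ) h = counit (R := k) h • (1 : A))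

instance : IsScalarTower k (Coinv k H A) A where
  smul_assoc c b a := smul_mul_assoc c b.1 a

/-- The coaction `b ⊗ h ↦ b ⊗ h₁ ⊗ h₂` of `B ⊗ H`. -/
def coactBH : Coinv k H A ⊗[k] H →ₗ[k] (Coinv k H A ⊗[k] H) ⊗[k] H :=
  (TensorProduct.assoc k (Coinv k H A) H H).symm.toLinearMap ∘ₗ
    (comul (R := k) (A := H)).lTensor (Coinv k H A)

variable {k H} in
/-- The componentwise coaction on the direct sum `M^n` of copies of a comodule `M`. -/
def coactPow {M : Type*} [AddCommGroup M] [Module k M] (ρ : M →ₗ[k] M ⊗[k] H) (n : ℕ) :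
    (Fin n → M) →ₗ[k] (Fin n → M) ⊗[k] H :=
  ∑ i, (LinearMap.single k (fun _ : Fin n => M) i).rTensor H ∘ₗ ρ ∘ₗ LinearMap.proj i

variable {k H} in
/-- For two left `B`-modules with right `H`-coactions: `M` is a direct summand of `N` as left
`B`-module, right `H`-comodule, i.e. there are `B`-linear, `H`-colinear maps `M → N → M` with
composite the identity. -/
def IsDirectSummand {M N : Type*} [AddCommGroup M] [Module k M] [Module (Coinv k H A) M]
    [IsScalarTower k (Coinv k H A) M] [AddCommGroup N] [Module k N] [Module (Coinv k H A) N]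
    [IsScalarTower k (Coinv k H A) N] (ρM : M →ₗ[k] M ⊗[k] H) (ρN : N →ₗ[k] N ⊗[k] H) : Prop :=
  ∃ (f : M →ₗ[Coinv k H A] N) (g : N →ₗ[Coinv k H A] M),
    (∀ x, ρN (f x) = (f.restrictScalars k).rTensor H (ρM x)) ∧
    (∀ x, ρM (g x) = (g.restrictScalars k).rTensor H (ρN x)) ∧
    ∀ x, g (f x) = x

end Context

end CoquasiHopf

end

/-! Each connecting map is onto as soon as its image contains a unit. From `∑ [qᵢ, pᵢ] = α1` follows
`∑ [qᵢ, pᵢs] = s` (`sum_bracket_mulPS`), and from `∑ (pᵢ, qᵢ) = ε1` follows `∑ (rpᵢ, qᵢ) = r`. So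
surjectivity of `[-,-]` means `∑ qᵢ(h₁)pᵢ(h₂) = α(h)1` for some finite family, and surjectivity of
`(-,-)` means `∑ pᵢ(h₁)β(h₂)qᵢ(h₃) = ε(h)1` (`bracket_surjective_iff`, `paren_surjective_iff`).

The summand conditions also become equations. `B ⊗ H` is cofree over `B`, so a `B`-linear colinear
map `A → B ⊗ H` is `a ↦ φ(a₀) ⊗ a₁` for a `B`-linear `φ : A → B`. A `B`-linear colinear map `B ⊗ H →
A` is `b ⊗ h ↦ b p(h)` for `p` in `Hom^H(H, A)`. Hence `A` is a summand of a power of `B ⊗ H` iff `∑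
φᵢ(a₀)pᵢ(a₁) = a` is solvable, and `B ⊗ H` is a summand of a power of `A` iff `∑ φᵢ(pᵢ(h)) = ε(h)1`
is. The bridge is the map sending `q` to `θ_q(a) = a₀β(a₁)q(a₂)`, a `B`-linear map `A → B` with `(p,
q) = θ_q ∘ p`.

If `∑ [qᵢ, pᵢ] = α1`, then `∑ θ_{qᵢ}(a₀)pᵢ(a₁) = a` (`sum_fromBH_toBH_theta`), and `a ⊗ h ↦ ∑
aqᵢ(h₁) ⊗ pᵢ(h₂)` inverts the canonical map (`can_canInv`, `canInv_can`). Conversely, for a Galois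
extension with `∑ φᵢ(a₀)pᵢ(a₁) = a`, write `l ⊗ r` for the preimage of `1 ⊗ h` and put `qᵢ(h) =
lφᵢ(r)`. Colinearity of `can` gives `∑ qᵢ(h₁)pᵢ(h₂) = ∑ lφᵢ(r₀)pᵢ(r₁) = lr`, and `lr = α(h)1`
because the multiplication of `A` factors through `can` (`alphaMap_can`).

For strictness, once `[-,-]` is onto, every `B`-linear `φ : A → B` is a `θ_q`, with `q = ∑ qᵢ(φ ∘
pᵢ)`; so the second unit equation is the second summand condition (`hasParenUnit_iff`). In the cleft
case the pair `δ, γ` solves both unit equations.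

Identities with `ω` are checked on comatrix entries. There the cocycle identity is an equation
between invertible finite matrices, and it is contracted with a row made from `α` and a column made
from `β`. These two vectors absorb all factors but one, which an antipode axiom evaluates
(`contract_E_B`, `contract_B_E`, `contract_A_C`). -/

noncomputable section

set_option linter.unusedSectionVars false

namespace CoquasiHopf

open TensorProduct Coalgebra
open CoquasiBialgebra (ω ωInv)
open CoquasiHopfAlgebra (S α β)

/-! ### Comatrices over arbitrary finite index types -/

section Comat

variable {k H : Type*} [Field k] [NonAssocRing H] [Module k H]
  [SMulCommClass k H H] [IsScalarTower k H H] [Coalgebra k H]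
variable {I J K L : Type} [Fintype I] [Fintype J] [Fintype K] [Fintype L]
  [DecidableEq I] [DecidableEq J] [DecidableEq K] [DecidableEq L]

/-- `Δ(xᵢⱼ) = ∑ xᵢₗ ⊗ xₗⱼ` and `ε(xᵢⱼ) = δᵢⱼ`, for an arbitrary finite index type. -/
structure Comat (k : Type*) {H : Type*} [Field k] [AddCommGroup H] [Module k H]
    [Coalgebra k H] {I : Type} [Fintype I] [DecidableEq I] (x : I → I → H) : Prop where
  comul_eq : ∀ i j, comul (R := k) (x i j) = ∑ l, x i l ⊗ₜ[k] x l j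
  counit_eq : ∀ i j, counit (R := k) (x i j) = if i = j then 1 else 0

theorem IsComatrix.comat {n : ℕ} {t : Fin n → Fin n → H} (ht : IsComatrix k t) : Comat k t :=
  ⟨ht.comul_eq, ht.counit_eq⟩

/-- The comultiplication of an entry as a representation. -/
def Comat.repr {x : I → I → H} (hx : Comat k x) (i j : I) : Repr k (x i j) I where
  index := Finset.univ
  left := fun l => x i l
  right := fun l => x l j
  eq := (hx.comul_eq i j).symm

/-- The product of `H` is a coalgebra map, so products of entries again form a comatrix, indexed by
pairs. This is the reason for allowing index types other than `Fin n`. -/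
theorem Comat.mul [CoquasiBialgebra k H] {x : I → I → H} {y : J → J → H} (hx : Comat k x)
    (hy : Comat k y) : Comat k (fun p q : I × J => x p.1 q.1 * y p.2 q.2) where
  comul_eq p q := by
    rw [CoquasiBialgebra.comul_mul, hx.comul_eq, hy.comul_eq, Fintype.sum_prod_type]
    simp only [map_sum, LinearMap.sum_apply, TensorProduct.map₂_apply_tmul,
      TensorProduct.map_tmul, LinearMap.mul_apply']
    exact Finset.sum_comm
  counit_eq p q := by
    rw [CoquasiBialgebra.counit_mul, hx.counit_eq, hy.counit_eq]
    obtain ⟨a, b⟩ := p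
    obtain ⟨c, d⟩ := q
    simp only [Prod.mk.injEq]
    split_ifs <;> simp_all

variable [CoquasiBialgebra k H] {x : I → I → H} {y : J → J → H} {z : K → K → H} {w : L → L → H}

/-- `ω(h₁,g₁,l₁) ω⁻¹(h₂,g₂,l₂) = ε(h) ε(g) ε(l)` on entries. -/
theorem Comat.ω_ωInv (hx : Comat k x) (hy : Comat k y) (hz : Comat k z) (i i' j j' l l') :
    ∑ a, ∑ b, ∑ c, (ω (x i a) (y j b) (z l c) : k) * ωInv (x a i') (y b j') (z c l') =
      if i = i' ∧ j = j' ∧ l = l' then 1 else 0 := by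
  refine (CoquasiBialgebra.ω_mul_ωInv (hx.repr i i') (hy.repr j j') (hz.repr l l')).trans ?_
  rw [hx.counit_eq, hy.counit_eq, hz.counit_eq]
  split_ifs <;> simp_all

end Comat

/-! ### Consequences of the cocycle identity

For four comatrices `x, y, z, w` the cocycle identity is an equality `A * B = C * D * E` of
matrices indexed by quadruples. -/

section Cocycle

variable {k H : Type*} [Field k] [NonAssocRing H] [Module k H]
  [SMulCommClass k H H] [IsScalarTower k H H] [Coalgebra k H]
variable {n m r v : ℕ}

/-- Quadruples of indices. -/
abbrev Quad (n m r v : ℕ) : Type := Fin n × Fin m × Fin r × Fin v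

/-- The matrix of `f(x, y, zw)`. -/
def matA (f : H →ₗ[k] H →ₗ[k] H →ₗ[k] k) (x : Fin n → Fin n → H) (y : Fin m → Fin m → H)
    (z : Fin r → Fin r → H) (w : Fin v → Fin v → H) : Matrix (Quad n m r v) (Quad n m r v) k :=
  fun p q => f (x p.1 q.1) (y p.2.1 q.2.1) (z p.2.2.1 q.2.2.1 * w p.2.2.2 q.2.2.2)

/-- The matrix of `f(xy, z, w)`. -/
def matB (f : H →ₗ[k] H →ₗ[k] H →ₗ[k] k) (x : Fin n → Fin n → H) (y : Fin m → Fin m → H)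
    (z : Fin r → Fin r → H) (w : Fin v → Fin v → H) : Matrix (Quad n m r v) (Quad n m r v) k :=
  fun p q => f (x p.1 q.1 * y p.2.1 q.2.1) (z p.2.2.1 q.2.2.1) (w p.2.2.2 q.2.2.2)

/-- The matrix of `ε(x) f(y, z, w)`. -/
def matC (f : H →ₗ[k] H →ₗ[k] H →ₗ[k] k) (n : ℕ) (y : Fin m → Fin m → H)
    (z : Fin r → Fin r → H) (w : Fin v → Fin v → H) : Matrix (Quad n m r v) (Quad n m r v) k :=
  fun p q => if p.1 = q.1 then f (y p.2.1 q.2.1) (z p.2.2.1 q.2.2.1) (w p.2.2.2 q.2.2.2) else 0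

/-- The matrix of `f(x, yz, w)`. -/
def matD (f : H →ₗ[k] H →ₗ[k] H →ₗ[k] k) (x : Fin n → Fin n → H) (y : Fin m → Fin m → H)
    (z : Fin r → Fin r → H) (w : Fin v → Fin v → H) : Matrix (Quad n m r v) (Quad n m r v) k :=
  fun p q => f (x p.1 q.1) (y p.2.1 q.2.1 * z p.2.2.1 q.2.2.1) (w p.2.2.2 q.2.2.2)

/-- The matrix of `f(x, y, z) ε(w)`. -/
def matE (f : H →ₗ[k] H →ₗ[k] H →ₗ[k] k) (x : Fin n → Fin n → H) (y : Fin m → Fin m → H)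
    (z : Fin r → Fin r → H) (v : ℕ) : Matrix (Quad n m r v) (Quad n m r v) k :=
  fun p q => if p.2.2.2 = q.2.2.2 then f (x p.1 q.1) (y p.2.1 q.2.1) (z p.2.2.1 q.2.2.1) else 0

variable [CoquasiBialgebra k H] {x : Fin n → Fin n → H} {y : Fin m → Fin m → H}
  {z : Fin r → Fin r → H} {w : Fin v → Fin v → H}

/-- Convolution invertibility of `ω`, applied to `x`, `y` and the product comatrix of `z` and `w`.
The analogues below differ only in the slot that holds the product, or in having an idle leg on
which the matrix is diagonal. -/
theorem matA_mul_inv (hx : IsComatrix k x) (hy : IsComatrix k y) (hz : IsComatrix k z)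
    (hw : IsComatrix k w) : matA (k := k) ω x y z w * matA ωInv x y z w = 1 := by
  ext p q
  rw [Matrix.mul_apply, Matrix.one_apply]
  have h := hx.comat.ω_ωInv hy.comat (hz.comat.mul hw.comat) p.1 q.1 p.2.1 q.2.1 p.2.2 q.2.2
  simp only [Fintype.sum_prod_type, matA] at h ⊢
  rw [h]
  simp only [Prod.ext_iff]

theorem matB_mul_inv (hx : IsComatrix k x) (hy : IsComatrix k y) (hz : IsComatrix k z)
    (hw : IsComatrix k w) : matB (k := k) ω x y z w * matB ωInv x y z w = 1 := by
  ext p q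
  rw [Matrix.mul_apply, Matrix.one_apply]
  have h := (hx.comat.mul hy.comat).ω_ωInv hz.comat hw.comat (p.1, p.2.1) (q.1, q.2.1)
    p.2.2.1 q.2.2.1 p.2.2.2 q.2.2.2
  simp only [Fintype.sum_prod_type, matB] at h ⊢
  rw [h]
  simp only [Prod.ext_iff, and_assoc]

theorem matD_mul_inv (hx : IsComatrix k x) (hy : IsComatrix k y) (hz : IsComatrix k z)
    (hw : IsComatrix k w) : matD (k := k) ω x y z w * matD ωInv x y z w = 1 := by
  ext p q
  rw [Matrix.mul_apply, Matrix.one_apply]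
  have h := hx.comat.ω_ωInv (hy.comat.mul hz.comat) hw.comat p.1 q.1 (p.2.1, p.2.2.1)
    (q.2.1, q.2.2.1) p.2.2.2 q.2.2.2
  simp only [Fintype.sum_prod_type, matD] at h ⊢
  rw [h]
  simp only [Prod.ext_iff, and_assoc]

theorem matC_mul_inv (n : ℕ) (hy : IsComatrix k y) (hz : IsComatrix k z) (hw : IsComatrix k w) :
    matC (k := k) ω n y z w * matC ωInv n y z w = 1 := by
  ext p q
  rw [Matrix.mul_apply, Matrix.one_apply, Fintype.sum_prod_type, Finset.sum_eq_single p.1]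
  · have h := hy.comat.ω_ωInv hz.comat hw.comat p.2.1 q.2.1 p.2.2.1 q.2.2.1 p.2.2.2 q.2.2.2
    simp only [Fintype.sum_prod_type, matC] at h ⊢
    by_cases hpq : p.1 = q.1
    · simp only [hpq, if_true, h, Prod.ext_iff, true_and]
    · simp [hpq, Prod.ext_iff]
  · intro i _ hi
    simp [matC, hi.symm]
  · simp

theorem matE_mul_inv (hx : IsComatrix k x) (hy : IsComatrix k y) (hz : IsComatrix k z) (v : ℕ) :
    matE (k := k) ω x y z v * matE ωInv x y z v = 1 := by
  ext p q
  rw [Matrix.mul_apply, Matrix.one_apply]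
  have h := hx.comat.ω_ωInv hy.comat hz.comat p.1 q.1 p.2.1 q.2.1 p.2.2.1 q.2.2.1
  simp only [Fintype.sum_prod_type, matE, ite_mul, zero_mul, Finset.sum_ite_eq, Finset.mem_univ,
    if_true]
  by_cases hpq : p.2.2.2 = q.2.2.2
  · simp only [hpq, if_true, h, Prod.ext_iff, and_true]
  · simp [hpq, Prod.ext_iff]

end Cocycle

/-! ### Contracting the cocycle identity with `α` and `β` -/

section Contraction

variable {k H : Type*} [Field k] [NonAssocRing H] [Module k H]
  [SMulCommClass k H H] [IsScalarTower k H H] [Coalgebra k H] [CoquasiHopfAlgebra k H]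
variable {n m r v : ℕ} {x : Fin n → Fin n → H} {y : Fin m → Fin m → H}
  {z : Fin r → Fin r → H} {w : Fin v → Fin v → H}

variable (k) in
/-- The comatrix `S(yⱼᵢ)`. -/
abbrev antipodeT (y : Fin m → Fin m → H) : Fin m → Fin m → H := fun i j => S (k := k) (y j i)

theorem cocycle_mat (hx : IsComatrix k x) (hy : IsComatrix k y) (hz : IsComatrix k z)
    (hw : IsComatrix k w) : matA (k := k) ω x y z w * matB ω x y z w =
      matC ω n y z w * matD ω x y z w * matE ω x y z v := by
  ext p q
  have h := cocycle_raw hx hy hz hw p.1 q.1 p.2 q.2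
  rw [Matrix.mul_assoc, Matrix.mul_apply, Matrix.mul_apply]
  simp only [Fintype.sum_prod_type] at h ⊢
  refine h.trans ?_
  -- The matrix of `ε(x) ω(y, z, w)` is diagonal in the first index, so only one block contributes.
  rw [Finset.sum_eq_single p.1]
  · simp only [matC, if_true, Matrix.mul_apply, Fintype.sum_prod_type, matD, matE, mul_ite,
      mul_zero, Finset.sum_ite_eq', Finset.mem_univ]
  · intro i _ hi
    simp [matC, hi.symm]
  · simp

theorem S_alpha_entry (hx : IsComatrix k x) (i j : Fin n) :
    ∑ a, ∑ b, (α (x a b) : k) • (S (k := k) (x i a) * x b j) = (α (x i j) : k) • (1 : H) := by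
  have h1 := CoquasiHopfAlgebra.S_α_id (k := k) (x i j)
  simp only [convL, hx.conv] at h1
  rw [← h1]
  refine Finset.sum_congr rfl fun a _ => ?_
  simp

/-- The row absorbs the left factor and the column absorbs the right one. This is how a product of
three cocycle matrices is reduced to its middle factor. -/
theorem dotProduct_mulVec_of_fixed {I : Type*} [Fintype I] {L M R : Matrix I I k} {a b : I → k}
    (ha : Matrix.vecMul a L = a) (hb : Matrix.mulVec R b = b) :
    a ⬝ᵥ Matrix.mulVec (L * M * R) b = a ⬝ᵥ Matrix.mulVec M b := by
  rw [← Matrix.mulVec_mulVec, hb, ← Matrix.mulVec_mulVec, Matrix.dotProduct_mulVec, ha]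

theorem vecMul_inv_fixed {I : Type*} [Fintype I] [DecidableEq I] {L L' : Matrix I I k} {a : I → k}
    (hL : L * L' = 1) (ha : Matrix.vecMul a L = a) : Matrix.vecMul a L' = a := by
  conv_lhs => rw [← ha, Matrix.vecMul_vecMul, hL, Matrix.vecMul_one]

theorem mulVec_inv_fixed {I : Type*} [Fintype I] [DecidableEq I] {L L' : Matrix I I k} {a : I → k}
    (hL : L * L' = 1) (ha : Matrix.mulVec L a = a) : Matrix.mulVec L' a = a := by
  -- A right inverse of a finite square matrix is also a left inverse.
  conv_lhs => rw [← ha, Matrix.mulVec_mulVec, mul_eq_one_comm.1 hL, Matrix.one_mulVec]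

/-- To be used with `f` equal to `ω` with two slots frozen: pairing with `α` replaces the product in
the free slot by `1`, where `ω` is trivial. -/
theorem alpha_contract (f : H →ₗ[k] k) (hy : IsComatrix k y) (c d : Fin m) :
    ∑ a, ∑ b, (α (y a b) : k) * f (S (k := k) (y c a) * y b d) = (α (y c d) : k) * f 1 := by
  simpa using congrArg f (S_alpha_entry hy c d)

theorem beta_contract (f : H →ₗ[k] k) (hy : IsComatrix k y) (c d : Fin m) :
    ∑ a, ∑ b, (f (y c a * S (k := k) (y b d)) : k) * β (y a b) = (β (y c d) : k) * f 1 := by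
  simpa [mul_comm] using congrArg f (id_betaS_entry hy c d)

/-- The antipode axiom for `ω⁻¹`, with its sums nested as they appear after contracting with an
`α`-row and a `β`-column. -/
theorem ωInv_alpha_beta_entry (hy : IsComatrix k y) (i j : Fin m) :
    ∑ a, ∑ b, (α (y a b) : k) * ∑ c, ∑ d,
      (ωInv (S (k := k) (y i a)) (y b c) (S (k := k) (y d j)) : k) * β (y c d) =
      if i = j then 1 else 0 := by
  rw [← hy.counit_eq, ← CoquasiHopfAlgebra.ωInv_S_id_S]
  simp only [conv₃, convR, convL, hy.conv, map_sum, LinearMap.sum_apply, Finset.mul_sum]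
  rw [sum_comm₃₁]
  refine Fintype.sum_congr _ _ fun d => Fintype.sum_congr _ _ fun a => ?_
  rw [Finset.sum_comm]
  refine Fintype.sum_congr _ _ fun c => Fintype.sum_congr _ _ fun b => ?_
  simp only [LinearMap.flip_apply, LinearMap.lsmul_apply, LinearMap.id_apply, map_smul,
    LinearMap.smul_apply, smul_eq_mul]
  ring

theorem ω_beta_alpha_entry (hy : IsComatrix k y) (i j : Fin m) :
    ∑ a, ∑ b, (α (y a b) : k) * ∑ c, ∑ d,
      (ω (y i c) (S (k := k) (y d a)) (y b j) : k) * β (y c d) =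
      if i = j then 1 else 0 := by
  rw [← hy.counit_eq, ← CoquasiHopfAlgebra.ω_id_S_id]
  simp only [conv₃, convR, convL, hy.conv, map_sum, LinearMap.sum_apply, Finset.mul_sum]
  refine Fintype.sum_congr _ _ fun a => Fintype.sum_congr _ _ fun b => ?_
  rw [Finset.sum_comm]
  refine Fintype.sum_congr _ _ fun c => Fintype.sum_congr _ _ fun d => ?_
  simp only [LinearMap.flip_apply, LinearMap.lsmul_apply, LinearMap.id_apply, map_smul,
    LinearMap.smul_apply, smul_eq_mul]
  ring

/-- `α(h₃) ω(a₁,S(h₂),h₄) ω⁻¹(a₂S(h₁),h₅β(h₆),S(h₇)) = ε(a) ε(h)` on entries. -/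
theorem contract_E_B (hx : IsComatrix k x) (hy : IsComatrix k y) (p p' : Fin n) (i j : Fin m) :
    ∑ a, ∑ b, (α (y a b) : k) * ∑ p₁, ∑ c, ∑ d, (ω (x p p₁) (S (k := k) (y c a)) (y b d) : k) *
      wForm k H (x p₁ p' * S (k := k) (y i c)) (y d j) = if p = p' ∧ i = j then 1 else 0 := by
  have hy' := hy.antipode
  -- The four legs are `x, S(y), y, S(y)`. The row `r` puts `α` on legs two and three, where `S(y)y`
  -- collapses inside `matD`; the column `s` puts `β` on legs three and four, where `yS(y)`
  -- collapses inside `matA`.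
  let r : Quad n m m m → k := fun q => if p = q.1 ∧ j = q.2.2.2 then α (y q.2.1 q.2.2.1) else 0
  let s : Quad n m m m → k := fun q => if p' = q.1 ∧ i = q.2.1 then β (y q.2.2.1 q.2.2.2) else 0
  have hr : Matrix.vecMul r (matD ω x (antipodeT k y) y
      (antipodeT k y)) = r := by
    ext q
    simp only [Matrix.vecMul, dotProduct, Fintype.sum_prod_type, r, matD, ite_and, ite_mul,
      zero_mul, Finset.sum_ite_eq, Finset.mem_univ, if_true, Finset.sum_const_zero,
      Finset.sum_ite_irrel]
    refine (alpha_contract ((ω (x p q.1)).flip (S (k := k) (y q.2.2.2 j))) hy q.2.1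
      q.2.2.1).trans ?_
    rw [LinearMap.flip_apply, CoquasiBialgebra.ω_one_mid, hx.counit_eq,
      CoquasiHopfAlgebra.counit_S, hy.counit_eq]
    split_ifs <;> simp_all
  have hs : Matrix.mulVec (matA ω x (antipodeT k y) y
      (antipodeT k y)) s = s := by
    ext q
    simp only [Matrix.mulVec, dotProduct, Fintype.sum_prod_type, s, matA, ite_and, mul_ite,
      mul_zero, Finset.sum_ite_eq, Finset.mem_univ, if_true, Finset.sum_const_zero,
      Finset.sum_ite_irrel]
    refine (beta_contract (ω (x q.1 p') (S (k := k) (y i q.2.1))) hy q.2.2.1 q.2.2.2).trans ?_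
    rw [ω_one_right hx hy']
    split_ifs <;> simp_all
  -- The cocycle identity `AB = CDE` solved for `EB⁻¹ = D⁻¹C⁻¹A`. The fixed vectors strip off `D⁻¹`
  -- and `A`, leaving `C⁻¹`, which holds `ω⁻¹(S(y), y, S(y))`.
  have hX : matE ω x (antipodeT k y) y m *
      matB ωInv x (antipodeT k y) y (antipodeT k y) =
      matD (k := k) ωInv x (antipodeT k y) y (antipodeT k y) *
      matC ωInv n (antipodeT k y) y (antipodeT k y) *
      matA ω x (antipodeT k y) y (antipodeT k y) := by
    have hB := matB_mul_inv hx hy' hy hy'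
    have hC := mul_eq_one_comm.1 (matC_mul_inv n hy' hy hy')
    have hD := mul_eq_one_comm.1 (matD_mul_inv hx hy' hy hy')
    have h := cocycle_mat hx hy' hy hy'
    rw [← mul_one (matA _ _ _ _ _), ← hB, ← mul_assoc (matA _ _ _ _ _), h]
    simp only [mul_assoc]
    rw [← mul_assoc (matC ωInv _ _ _ _), hC, one_mul, ← mul_assoc (matD ωInv _ _ _ _), hD, one_mul]
  have h := dotProduct_mulVec_of_fixed
    (M := matC ωInv n (antipodeT k y) y (antipodeT k y))
    (vecMul_inv_fixed (matD_mul_inv hx hy' hy hy') hr) hs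
  rw [← hX] at h
  have h1 := ωInv_alpha_beta_entry hy i j
  rw [← Matrix.mulVec_mulVec] at h
  simp only [Matrix.mulVec, dotProduct, Fintype.sum_prod_type, r, s, matE,
    matB, matC, ite_and, ite_mul, mul_ite,
      mul_zero, zero_mul, Finset.sum_ite_eq, Finset.mem_univ, if_true, Finset.sum_const_zero,
      Finset.sum_ite_irrel, Finset.sum_ite_eq'] at h
  simp only [wForm_entry hy, mul_comm (β _ : k)]
  refine h.trans ?_
  rw [h1]
  simp only [ite_and]

/-- `ω(a₁b₁,S(b₅),α(b₆)b₇) ω⁻¹(a₂,b₂β(b₃),S(b₄)) = ε(a) ε(b)` on entries. -/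
theorem contract_B_E (hx : IsComatrix k x) (hy : IsComatrix k y) (p p' : Fin n) (i j : Fin m) :
    ∑ a, ∑ b, (α (y a b) : k) * ∑ p₁, ∑ c, ∑ d,
      (ω (x p p₁ * y i c) (S (k := k) (y d a)) (y b j) : k) * wForm k H (x p₁ p') (y c d) =
      if p = p' ∧ i = j then 1 else 0 := by
  have hy' := hy.antipode
  -- The legs are now `x, y, S(y), y`, with `α` on the last two and `β` on the middle two.
  let r : Quad n m m m → k := fun q => if p = q.1 ∧ i = q.2.1 then α (y q.2.2.1 q.2.2.2) else 0
  let s : Quad n m m m → k := fun q => if p' = q.1 ∧ j = q.2.2.2 then β (y q.2.1 q.2.2.1) else 0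
  have hr : Matrix.vecMul r (matA ω x y (antipodeT k y) y) = r := by
    ext q
    simp only [Matrix.vecMul, dotProduct, Fintype.sum_prod_type, r, matA, ite_and, ite_mul,
      zero_mul, Finset.sum_ite_eq, Finset.mem_univ, if_true, Finset.sum_const_zero,
      Finset.sum_ite_irrel]
    refine (alpha_contract (ω (x p q.1) (y i q.2.1)) hy q.2.2.1 q.2.2.2).trans ?_
    rw [ω_one_right hx hy]
    split_ifs <;> simp_all
  have hs : Matrix.mulVec (matD ω x y (antipodeT k y) y) s = s := by
    ext q
    simp only [Matrix.mulVec, dotProduct, Fintype.sum_prod_type, s, matD, ite_and, mul_ite,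
      mul_zero, Finset.sum_ite_eq, Finset.mem_univ, if_true, Finset.sum_const_zero,
      Finset.sum_ite_irrel]
    refine (beta_contract ((ω (x q.1 p')).flip (y q.2.2.2 j)) hy q.2.1 q.2.2.1).trans ?_
    rw [LinearMap.flip_apply, CoquasiBialgebra.ω_one_mid, hx.counit_eq, hy.counit_eq]
    split_ifs <;> simp_all
  -- Here `AB = CDE` is solved for `BE⁻¹ = A⁻¹CD`. The surviving factor `C` holds `ω(y, S(y), y)`,
  -- so the axiom for `ω` rather than `ω⁻¹` finishes.
  have hX : matB ω x y (antipodeT k y) y * matE ωInv x y (antipodeT k y) m =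
      matA (k := k) ωInv x y (antipodeT k y) y * matC ω n y (antipodeT k y) y *
      matD ω x y (antipodeT k y) y := by
    have hA := mul_eq_one_comm.1 (matA_mul_inv hx hy hy' hy)
    have hE := matE_mul_inv hx hy hy' m
    have h := cocycle_mat hx hy hy' hy
    rw [← mul_one (matD _ _ _ _ _), ← hE, ← mul_assoc (matD _ _ _ _ _),
      mul_assoc (matA _ _ _ _ _), ← mul_assoc (matC _ _ _ _ _), ← mul_assoc (matC _ _ _ _ _), ← h,
      ← mul_assoc, ← mul_assoc, hA, one_mul]
  have h := dotProduct_mulVec_of_fixed (M := matC ω n y (antipodeT k y) y)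
    (vecMul_inv_fixed (matA_mul_inv hx hy hy' hy) hr) hs
  rw [← hX] at h
  have h1 := ω_beta_alpha_entry hy i j
  rw [← Matrix.mulVec_mulVec] at h
  simp only [Matrix.mulVec, dotProduct, Fintype.sum_prod_type, r, s, matE,
    matB, matC, ite_and, ite_mul, mul_ite,
      mul_zero, zero_mul, Finset.sum_ite_eq, Finset.mem_univ, if_true, Finset.sum_const_zero,
      Finset.sum_ite_irrel, Finset.sum_ite_eq'] at h
  simp only [wForm_entry hy, mul_comm (β _ : k)]
  refine h.trans ?_
  rw [h1]
  simp only [ite_and]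

/-- `α(h₂) ω⁻¹(S(h₁),h₃,S(h₇)z₁) ω(h₄,β(h₅)S(h₆),z₂) = ε(h) ε(z)` on entries. -/
theorem contract_A_C (hy : IsComatrix k y) (hz : IsComatrix k z) (i j : Fin m) (l l' : Fin r) :
    ∑ a, ∑ b, (α (y a b) : k) * ∑ c, ∑ d, ∑ e,
      (ωInv (S (k := k) (y i a)) (y b c) (S (k := k) (y d j) * z l e) : k) *
        uForm k H (y c d) (z e l') = if i = j ∧ l = l' then 1 else 0 := by
  have hy' := hy.antipode
  -- The legs are `S(y), y, S(y), z`, with `α` on legs one and two and `β` on legs two and three.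
  let ra : Quad m m m r → k := fun q => if j = q.2.2.1 ∧ l = q.2.2.2 then α (y q.1 q.2.1) else 0
  let s : Quad m m m r → k := fun q => if i = q.1 ∧ l' = q.2.2.2 then β (y q.2.1 q.2.2.1) else 0
  have hr : Matrix.vecMul ra (matB ω (antipodeT k y) y (antipodeT k y) z) = ra := by
    ext q
    simp only [Matrix.vecMul, dotProduct, Fintype.sum_prod_type, ra, matB, ite_and, ite_mul,
      zero_mul, Finset.sum_ite_eq, Finset.mem_univ, if_true, Finset.sum_const_zero,
      Finset.sum_ite_irrel]
    refine (alpha_contract ((LinearMap.applyₗ (z l q.2.2.2)) ∘ₗ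
      (LinearMap.applyₗ (antipodeT k y j q.2.2.1)) ∘ₗ ω) hy q.1 q.2.1).trans ?_
    simp only [LinearMap.coe_comp, Function.comp_apply, LinearMap.applyₗ_apply_apply]
    rw [ω_one_left hy' hz]
    split_ifs <;> simp_all
  have hs : Matrix.mulVec (matD ω (antipodeT k y) y (antipodeT k y) z) s = s := by
    ext q
    simp only [Matrix.mulVec, dotProduct, Fintype.sum_prod_type, s, matD, ite_and, mul_ite,
      mul_zero, Finset.sum_ite_eq, Finset.mem_univ, if_true, Finset.sum_const_zero,
      Finset.sum_ite_irrel]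
    refine (beta_contract ((ω (antipodeT k y q.1 i)).flip (z q.2.2.2 l')) hy q.2.1 q.2.2.1).trans ?_
    rw [LinearMap.flip_apply, CoquasiBialgebra.ω_one_mid, CoquasiHopfAlgebra.counit_S,
      hy.counit_eq, hz.counit_eq]
    split_ifs <;> simp_all
  -- The form needed is `A⁻¹C = BE⁻¹D⁻¹`; only `E⁻¹`, holding `ω⁻¹(S(y), y, S(y))`, survives the
  -- contraction.
  have hX : matA ωInv (antipodeT k y) y (antipodeT k y) z *
      matC ω m y (antipodeT k y) z =
      matB (k := k) ω (antipodeT k y) y (antipodeT k y) z *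
      matE ωInv (antipodeT k y) y (antipodeT k y) r *
      matD ωInv (antipodeT k y) y (antipodeT k y) z := by
    have hA := mul_eq_one_comm.1 (matA_mul_inv hy' hy hy' hz)
    have hD := matD_mul_inv hy' hy hy' hz
    have hE := matE_mul_inv hy' hy hy' r
    have h := cocycle_mat hy' hy hy' hz
    rw [← one_mul (matB _ _ _ _ _), ← hA, mul_assoc (matA _ _ _ _ _), h]
    simp only [mul_assoc]
    rw [← mul_assoc (matE ω _ _ _ _), hE, one_mul, hD, mul_one]
  have h := dotProduct_mulVec_of_fixed (M := matE ωInv (antipodeT k y) y (antipodeT k y) r) hr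
    (mulVec_inv_fixed (matD_mul_inv hy' hy hy' hz) hs)
  rw [← hX] at h
  have h1 := ωInv_alpha_beta_entry hy i j
  rw [← Matrix.mulVec_mulVec] at h
  simp only [Matrix.mulVec, dotProduct, Fintype.sum_prod_type, ra, s, matE,
    matA, matC, ite_and, ite_mul, mul_ite,
      mul_zero, zero_mul, Finset.sum_ite_eq, Finset.mem_univ, if_true, Finset.sum_const_zero,
      Finset.sum_ite_irrel, Finset.sum_ite_eq'] at h
  simp only [uForm_entry hy, mul_comm (β _ : k)]
  refine h.trans ?_
  rw [h1]
  simp only [and_comm (a := i = j), ite_and]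

end Contraction

/-! ### Covectors in a comodule algebra -/

section Covector

variable {k H A : Type*} [Field k] [NonAssocRing H] [Module k H]
  [SMulCommClass k H H] [IsScalarTower k H H] [Coalgebra k H] [CoquasiBialgebra k H]
  [NonAssocRing A] [Module k A] [SMulCommClass k A A] [IsScalarTower k A A]
  [ComoduleAlgebra k H A]

/-- Local finiteness of comodules. Expand `ρ(h) = ∑ fᵢ ⊗ bᵢ` along a basis of `H`; the finitely many
nonzero `fᵢ` span `M`. The counit recovers `h`, and coassociativity makes `M` stable. -/
theorem exists_subcomodule_coact (h : A) : ∃ M : Submodule k A, FiniteDimensional k M ∧ h ∈ M ∧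
    ∀ x ∈ M, coact k H A x ∈ LinearMap.range (TensorProduct.map M.subtype
      (LinearMap.id : H →ₗ[k] H)) := by
  classical
  let b := Module.Basis.ofVectorSpace k H
  let e := TensorProduct.equivFinsuppOfBasisRight (M := A) b
  let f := e (coact k H A h)
  have hf : coact k H A h = ∑ i ∈ f.support, f i ⊗ₜ[k] b i := by
    have : coact k H A h = e.symm f := by simp [f]
    rw [this, TensorProduct.equivFinsuppOfBasisRight_symm_apply]
    rfl
  let M : Submodule k A := Submodule.span k (f '' (f.support : Set _))
  have hmem : ∀ i, f i ∈ M := by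
    intro i
    by_cases hi : i ∈ f.support
    · exact Submodule.subset_span ⟨i, hi, rfl⟩
    · rw [Finsupp.notMem_support_iff.1 hi]; exact M.zero_mem
  refine ⟨M, FiniteDimensional.span_of_finite k (f.support.finite_toSet.image _), ?_, ?_⟩
  · have h1 := ComoduleAlgebra.ρ_counit (k := k) (H := H) h
    rw [hf] at h1
    have h2 := congrArg (TensorProduct.rid k A) h1
    simp only [map_sum, LinearMap.lTensor_tmul, TensorProduct.rid_tmul, one_smul] at h2
    rw [← h2]
    exact M.sum_mem fun i _ => M.smul_mem _ (hmem i)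
  · have key : ∀ j, coact k H A (f j) ∈ LinearMap.range (TensorProduct.map M.subtype
      (LinearMap.id : H →ₗ[k] H)) := by
      intro j
      have h1 := ComoduleAlgebra.ρ_coassoc (k := k) (H := H) h
      rw [hf] at h1
      simp only [map_sum, LinearMap.lTensor_tmul, LinearMap.rTensor_tmul] at h1
      -- Taking the `j`-th coordinate of the last leg in the coassociativity equation isolates
      -- `ρ(fⱼ)` on one side and leaves an element of `M ⊗ H` on the other.
      have h2 := congrArg (TensorProduct.rid k (A ⊗[k] H)) (congrArg
        (LinearMap.lTensor (A ⊗[k] H) (b.coord j)) (congrArg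
        (TensorProduct.assoc k A H H).symm h1))
      simp only [map_sum, LinearEquiv.symm_apply_apply, LinearMap.lTensor_tmul,
        TensorProduct.rid_tmul, Module.Basis.coord_apply, Module.Basis.repr_self] at h2
      have h3 : ∑ x ∈ f.support, (Finsupp.single x (1 : k)) j • coact k H A (f x) =
          coact k H A (f j) := by
        rw [Finset.sum_eq_single j]
        · simp
        · intro i _ hij; simp [hij]
        · intro hj; simp [Finsupp.notMem_support_iff.1 hj]
      rw [h3] at h2
      rw [h2]
      refine Submodule.sum_mem _ fun i _ => ?_
      induction comul (R := k) (b i) with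
      | zero => simp
      | tmul x y =>
        refine ⟨⟨f i, hmem i⟩ ⊗ₜ[k] (b.coord j y • x), ?_⟩
        simp
      | add x y hx hy =>
        simp only [tmul_add, map_add]
        exact Submodule.add_mem _ hx hy
    intro x hx
    refine Submodule.span_induction ?_ ?_ ?_ ?_ hx
    · rintro _ ⟨i, _, rfl⟩; exact key i
    · simp
    · intro x y _ _ hx hy; rw [map_add]; exact Submodule.add_mem _ hx hy
    · intro c x _ hx; rw [map_smul]; exact Submodule.smul_mem _ _ hx

variable (k) in
/-- `ρ(vⱼ) = ∑ vᵢ ⊗ xᵢⱼ`. -/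
def IsCovec {I : Type} [Fintype I] (v : I → A) (x : I → I → H) : Prop :=
  ∀ j, coact k H A (v j) = ∑ i, v i ⊗ₜ[k] x i j

variable (k H) in
/-- Every element of a comodule algebra lies in the span of a finite family `v` with
`ρ(vⱼ) = ∑ vᵢ ⊗ xᵢⱼ` for a comatrix `x`. -/
theorem exists_covec (h : A) : ∃ (n : ℕ) (v : Fin n → A) (x : Fin n → Fin n → H),
    IsComatrix k x ∧ IsCovec k v x ∧ h ∈ Submodule.span k (Set.range v) := by
  classical
  obtain ⟨M, hM, hh, hΔ⟩ := exists_subcomodule_coact (k := k) (H := H) h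
  let w := Module.finBasis k M
  have hexp : ∀ x : M, (x : A) = ∑ j, w.repr x j • (w j : A) := by
    intro x
    have h1 := congrArg M.subtype (w.sum_repr x)
    rw [map_sum] at h1
    exact h1.symm
  have hf : ∀ i, ∃ f : A →ₗ[k] k, f ∘ₗ M.subtype = w.coord i := fun i =>
    LinearMap.exists_extend _
  choose f hf using hf
  have hfw : ∀ i j, f i (w j) = if i = j then 1 else 0 := by
    intro i j
    have := LinearMap.congr_fun (hf i) (w j)
    simp only [LinearMap.coe_comp, Function.comp_apply, Submodule.subtype_apply,
      Module.Basis.coord_apply, Module.Basis.repr_self] at this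
    rw [this, Finsupp.single_apply]
    simp [eq_comm]
  let t : Fin (Module.finrank k M) → Fin (Module.finrank k M) → H := fun i j =>
    TensorProduct.lid k H ((f i).rTensor H (coact k H A (w j : A)))
  have hw : ∀ j, coact k H A (w j : A) = ∑ i, (w i : A) ⊗ₜ[k] t i j := by
    intro j
    obtain ⟨z, hz⟩ := hΔ (w j) (w j).2
    have hgen : ∀ z : M ⊗[k] H, TensorProduct.map M.subtype LinearMap.id z =
        ∑ i, (w i : A) ⊗ₜ[k] TensorProduct.lid k H ((f i).rTensor H
          (TensorProduct.map M.subtype LinearMap.id z)) := by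
      intro z
      induction z with
      | zero => simp
      | tmul x y =>
        have : ∀ i, f i x = w.repr x i := fun i => LinearMap.congr_fun (hf i) x
        simp only [map_tmul, Submodule.subtype_apply, LinearMap.id_coe, id_eq,
          LinearMap.rTensor_tmul, TensorProduct.lid_tmul, this]
        conv_lhs => rw [hexp x]
        simp only [TensorProduct.sum_tmul, TensorProduct.tmul_smul, TensorProduct.smul_tmul']
      | add x y hx hy =>
        rw [map_add]
        nth_rw 1 [hx, hy]
        simp [tmul_add, Finset.sum_add_distrib]
    have := hgen z
    rw [hz] at this
    exact this
  refine ⟨_, fun j => (w j : A), t, ⟨?_, ?_⟩, hw, ?_⟩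
  · intro l j
    have h1 := ComoduleAlgebra.ρ_coassoc (k := k) (H := H) (w j : A)
    rw [hw j] at h1
    simp only [map_sum, LinearMap.lTensor_tmul, LinearMap.rTensor_tmul, hw,
      TensorProduct.sum_tmul, TensorProduct.assoc_tmul] at h1
    -- The functional `f l` is dual to the basis `w`, so applying it to the first leg of
    -- coassociativity reads off the comultiplication of a single entry.
    have h2 := congrArg (TensorProduct.lid k (H ⊗[k] H)) (congrArg
      (LinearMap.rTensor (H ⊗[k] H) (f l)) h1)
    simp only [map_sum, LinearMap.rTensor_tmul, TensorProduct.lid_tmul, hfw, ite_smul, one_smul,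
      zero_smul, Finset.sum_ite_eq, Finset.mem_univ, if_true] at h2
    exact h2.symm
  · intro l j
    have h1 := ComoduleAlgebra.ρ_counit (k := k) (H := H) (w j : A)
    rw [hw j] at h1
    have h2 := congrArg (f l) (congrArg (TensorProduct.rid k A) h1)
    simpa [hfw] using h2
  · rw [show h = ∑ j, w.repr ⟨h, hh⟩ j • (w j : A) from hexp ⟨h, hh⟩]
    exact Submodule.sum_mem _ fun j _ => Submodule.smul_mem _ _ (Submodule.subset_span ⟨j, rfl⟩)

/-- Linear maps on a comodule algebra that agree on covectors are equal. -/
theorem ext_covec {V : Type*} [AddCommGroup V] [Module k V] {f g : A →ₗ[k] V}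
    (hfg : ∀ {n : ℕ} {v : Fin n → A} {x : Fin n → Fin n → H}, IsComatrix k x → IsCovec k v x →
      ∀ j, f (v j) = g (v j)) : f = g := by
  ext h
  obtain ⟨n, v, x, hx, hv, hh⟩ := exists_covec k H h
  have : Submodule.span k (Set.range v) ≤ LinearMap.eqLocus f g := by
    rw [Submodule.span_le]
    rintro _ ⟨p, rfl⟩
    exact hfg hx hv p
  exact this hh

variable {I J K : Type} [Fintype I] [Fintype J] [Fintype K] [DecidableEq I] [DecidableEq J]
  [DecidableEq K] {v : I → A} {x : I → I → H} {w : J → A} {y : J → J → H} {u : K → A}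
  {z : K → K → H}

/-- `(ab)c = a₀(b₀c₀) ω(a₁,b₁,c₁)` on covectors. -/
theorem IsCovec.mul_assoc (hv : IsCovec k v x) (hw : IsCovec k w y) (hu : IsCovec k u z) (i j l) :
    (v i * w j) * u l = ∑ a, ∑ b, ∑ c, (ω (x a i) (y b j) (z c l) : k) • (v a * (w b * u c)) :=
  ComoduleAlgebra.mul_assoc_ω (k := k) (H := H) _ _ _ _ _ _ _ _ _ (hv i) (hw j) (hu l)

/-- `a(bc) = (a₀b₀)c₀ ω⁻¹(a₁,b₁,c₁)` on covectors. -/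
theorem IsCovec.mul_assoc_inv (hx : Comat k x) (hy : Comat k y) (hz : Comat k z)
    (hv : IsCovec k v x) (hw : IsCovec k w y) (hu : IsCovec k u z) (i j l) :
    v i * (w j * u l) =
      ∑ a, ∑ b, ∑ c, (ωInv (x a i) (y b j) (z c l) : k) • ((v a * w b) * u c) := by
  simp only [hv.mul_assoc hw hu, Finset.smul_sum, smul_smul]
  have h : ∀ a' b' c', ∑ a, ∑ b, ∑ c, ((ωInv (x a i) (y b j) (z c l) : k) *
      ω (x a' a) (y b' b) (z c' c)) • (v a' * (w b' * u c')) =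
      if a' = i ∧ b' = j ∧ c' = l then v a' * (w b' * u c') else 0 := by
    intro a' b' c'
    simp only [← Finset.sum_smul, mul_comm (ωInv _ _ _ : k)]
    rw [hx.ω_ωInv hy hz]
    split_ifs <;> simp
  have h4 := Finset.sum_comm (s := (Finset.univ : Finset (I × J × K)))
    (t := (Finset.univ : Finset (I × J × K)))
    (f := fun s s' => ((ωInv (x s.1 i) (y s.2.1 j) (z s.2.2 l) : k) *
      ω (x s'.1 s.1) (y s'.2.1 s.2.1) (z s'.2.2 s.2.2)) • (v s'.1 * (w s'.2.1 * u s'.2.2)))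
  simp only [Fintype.sum_prod_type] at h4
  rw [h4]
  simp only [h, ite_and, Finset.sum_ite_irrel, Finset.sum_ite_eq', Finset.mem_univ, if_true,
    Finset.sum_const_zero]

end Covector

/-- After reassociating, the scalars depend on one set of indices and the vectors on another,
sharing only `z`. Separating them lets a unit equation act on the vectors and an identity for `ω` on
the scalars. -/
theorem sum_kernel {k V X Y Z : Type*} [Field k] [AddCommGroup V] [Module k V] [Fintype X]
    [Fintype Y] [Fintype Z] (K : Y → Z → k) (M : X → Z → V) :
    ∑ x, ∑ y, ∑ z, K y z • M x z = ∑ z, (∑ y, K y z) • ∑ x, M x z := by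
  simp only [Finset.sum_smul, Finset.smul_sum]
  rw [sum_comm₂₁]

theorem sum_comm₂₂ {I J K L : Type*} [Fintype I] [Fintype J] [Fintype K] [Fintype L]
    {V : Type*} [AddCommMonoid V] (f : I → J → K → L → V) :
    ∑ a, ∑ b, ∑ c, ∑ d, f a b c d = ∑ c, ∑ d, ∑ a, ∑ b, f a b c d := by
  have h1 := Finset.sum_comm (s := (Finset.univ : Finset (I × J)))
    (t := (Finset.univ : Finset (K × L))) (f := fun p q => f p.1 p.2 q.1 q.2)
  simpa only [Fintype.sum_prod_type] using h1

/-! ### Units of the Morita context -/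

section Units

variable {k H A : Type*} [Field k] [NonAssocRing H] [Module k H]
  [SMulCommClass k H H] [IsScalarTower k H H] [Coalgebra k H] [CoquasiHopfAlgebra k H]
  [NonAssocRing A] [Module k A] [SMulCommClass k A A] [IsScalarTower k A A]
  [ComoduleAlgebra k H A]

variable {n m : ℕ} {t : Fin n → Fin n → H} {v : Fin n → A} {x : Fin n → Fin n → H}
  {w : Fin m → A} {y : Fin m → Fin m → H}

/-- Colinearity turns each row of values on a comatrix into a covector, so `IsCovec.mul_assoc` can
reassociate products of such values. For the coaction of `H^S` it is the columns, with the antipode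
comatrix. -/
theorem covec_P (ht : IsComatrix k t) {p : H →ₗ[k] A} (hp : p ∈ HomP k H A) (i : Fin n) :
    IsCovec k (fun j => p (t i j)) t := coact_P ht hp i

theorem covec_Q (ht : IsComatrix k t) {q : H →ₗ[k] A} (hq : q ∈ HomQ k H A) (j : Fin n) :
    IsCovec k (fun i => q (t i j)) (antipodeT k t) := fun i => coact_Q ht hq i j

theorem covec_S (ht : IsComatrix k t) {s : H →ₗ[k] A} (hs : s ∈ HomS k H A) :
    IsCovec k (fun i : Fin n × Fin n => s (t i.1 i.2))
      (fun i j => antipodeT k t i.1 j.1 * t i.2 j.2) := fun i => coact_S ht hs i.1 i.2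

theorem covec_coinv {b : A} (hb : b ∈ Coinv k H A) :
    IsCovec k (fun _ : Fin 1 => b) (fun _ _ => (1 : H)) := fun _ => by
  simpa using mem_coinv.1 hb

/-- Associativity holds when the left factor is coinvariant. -/
theorem assoc_left (a c : A) {b : A} (hb : b ∈ Coinv k H A) : (b * a) * c = b * (a * c) := by
  -- Phrased as an equality of bilinear maps, so that `ext_covec` can be used in each variable. A
  -- coinvariant is a covector for the comatrix `(1)`, and `ω` is trivial when its first argument is
  -- `1`.
  have h1 : (LinearMap.mul k A) ∘ₗ (LinearMap.mulLeft k b) =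
      (LinearMap.llcomp k A A A (LinearMap.mulLeft k b)) ∘ₗ (LinearMap.mul k A) := by
    refine ext_covec (k := k) (H := H) fun hx hv i => ?_
    refine ext_covec (k := k) (H := H) fun hy hw j => ?_
    have h := (covec_coinv hb).mul_assoc hv hw 0 i j
    simp only [ω_one_left hx hy, ite_and, ite_smul, zero_smul, one_smul, Finset.sum_ite_eq',
      Finset.mem_univ, if_true, Finset.univ_unique, Finset.sum_singleton, Finset.sum_ite_irrel,
      Finset.sum_const_zero] at h
    simpa using h
  exact LinearMap.congr_fun (LinearMap.congr_fun h1 a) c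

/-- Associativity holds when the right factor is coinvariant. -/
theorem assoc_right (a c : A) {b : A} (hb : b ∈ Coinv k H A) : (a * c) * b = a * (c * b) := by
  have h1 : (LinearMap.llcomp k A A A (LinearMap.mulRight k b)) ∘ₗ (LinearMap.mul k A) =
      (LinearMap.lcomp k A (LinearMap.mulRight k b)) ∘ₗ (LinearMap.mul k A) := by
    refine ext_covec (k := k) (H := H) fun hx hv i => ?_
    refine ext_covec (k := k) (H := H) fun hy hw j => ?_
    have h := hv.mul_assoc hw (covec_coinv hb) i j 0
    simp only [ω_one_right hx hy, ite_and, ite_smul, zero_smul, one_smul, Finset.sum_ite_eq',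
      Finset.mem_univ, if_true, Finset.univ_unique, Finset.sum_singleton, Finset.sum_ite_irrel,
      Finset.sum_const_zero] at h
    simpa using h
  exact LinearMap.congr_fun (LinearMap.congr_fun h1 a) c

variable (k H A) in
/-- `α` times the unit, the unit of `Hom^H(H̄, A)`. -/
def alphaOne : HomS k H A := ⟨(α : H →ₗ[k] k).smulRight (1 : A), by
  refine ext_comatrix fun {n t} ht i j => ?_
  have h := congrArg (fun z : H => (1 : A) ⊗ₜ[k] z) (S_alpha_entry ht i j)
  simp only [TensorProduct.tmul_sum, TensorProduct.tmul_smul] at h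
  simp only [LinearMap.coe_comp, Function.comp_apply, LinearMap.smulRight_apply, map_smul,
    coactAd_entry ht, map_sum, LinearMap.rTensor_tmul, ← TensorProduct.smul_tmul', h]
  rw [show coact k H A 1 = 1 ⊗ₜ[k] 1 from ComoduleAlgebra.ρ_one]⟩

variable (k H A) in
/-- The unit of `Hom^H(H̄, A)` lies in the image of `[-,-]`. -/
def HasBracketUnit : Prop := ∃ (n : ℕ) (q : Fin n → HomQ k H A) (p : Fin n → HomP k H A),
  ∀ h, ∑ i, bracketFun (q i).1 (p i).1 h = (α h : k) • (1 : A)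

variable (k H A) in
/-- The unit of `Hom(H, B)` lies in the image of `(-,-)`. -/
def HasParenUnit : Prop := ∃ (n : ℕ) (p : Fin n → HomP k H A) (q : Fin n → HomQ k H A),
  ∀ h, ∑ i, parenFun (p i).1 (q i).1 h = counit (R := k) h • (1 : A)

theorem bracket_mk (q : HomQ k H A) (p : HomP k H A) :
    bracket k H A (Submodule.Quotient.mk (q ⊗ₜ[k] p)) =
      ⟨bracketFun q.1 p.1, bracketFun_mem q.2 p.2⟩ := rfl

theorem paren_mk (p : HomP k H A) (q : HomQ k H A) :
    paren k H A (Submodule.Quotient.mk (p ⊗ₜ[k] q)) =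
      (parenFun p.1 q.1).codRestrict (Coinv k H A) (parenFun_mem p.2 q.2) := rfl

set_option maxHeartbeats 800000 in
/-- `∑ [qᵢ, pᵢs] = s` if `∑ [qᵢ, pᵢ]` is the unit. -/
theorem sum_bracket_mulPS {N : ℕ} {q : Fin N → HomQ k H A} {p : Fin N → HomP k H A}
    (hqp : ∀ h, ∑ i, bracketFun (q i).1 (p i).1 h = (α h : k) • (1 : A)) (s : HomS k H A) :
    ∑ i, bracketFun (q i).1 (mulPS (p i).1 s.1) = s.1 := by
  refine ext_comatrix fun {n t} ht i j => ?_
  -- Bracketing `q` with `p` first makes the hypothesis applicable. The price is a factor `ω⁻¹`,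
  -- whose last slot holds the coefficients `S(t)t` of the adjoint coaction.
  have h1 : ∀ f l a b c, (q f).1 (t i l) * ((p f).1 (t l a) * s.1 (t b c)) =
      ∑ i', ∑ a', ∑ b', ∑ c', (ωInv (S (k := k) (t i i')) (t a' a)
        (S (k := k) (t b b') * t c' c) : k) •
        (((q f).1 (t i' l) * (p f).1 (t l a')) * s.1 (t b' c')) := by
    intro f l a b c
    have h := IsCovec.mul_assoc_inv ht.antipode.comat ht.comat (ht.antipode.comat.mul ht.comat)
      (covec_Q ht (q f).2 l) (covec_P ht (p f).2 l) (covec_S ht s.2) i a (b, c)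
    simpa only [Fintype.sum_prod_type] using h
  have h2 : ∀ i' a' b' c', ∑ f, ∑ l, ((q f).1 (t i' l) * (p f).1 (t l a')) * s.1 (t b' c') =
      (α (t i' a') : k) • s.1 (t b' c') := by
    intro i' a' b' c'
    have h := hqp (t i' a')
    simp only [bracketFun_entry ht] at h
    rw [← one_mul (s.1 (t b' c')), ← smul_mul_assoc, ← h]
    simp only [Finset.sum_mul, one_mul]
  simp only [LinearMap.sum_apply, bracketFun_entry ht, mulPS_entry ht, Finset.mul_sum,
    mul_smul_comm, h1, Finset.smul_sum, smul_smul]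
  have h3 := sum_kernel (X := Fin N × Fin n) (Y := Fin n × Fin n × Fin n)
    (Z := Fin n × Fin n × Fin n × Fin n)
    (fun y z => uForm k H (t y.1 y.2.1) (t y.2.2 j) * ωInv (S (k := k) (t i z.1)) (t z.2.1 y.1)
        (S (k := k) (t y.2.1 z.2.2.1) * t z.2.2.2 y.2.2))
    (fun x z => ((q x.1).1 (t z.1 x.2) * (p x.1).1 (t x.2 z.2.1)) * s.1 (t z.2.2.1 z.2.2.2))
  simp only [Fintype.sum_prod_type] at h3
  refine h3.trans ?_
  simp only [h2, smul_smul]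
  -- The remaining scalars combine `ω⁻¹`, `α` and the form `u`; by `contract_A_C` they amount to the
  -- identity matrix.
  have h4 : ∀ b' c', ∑ i', ∑ a', ((∑ a, ∑ b, ∑ c, uForm k H (t a b) (t c j) *
      (ωInv (S (k := k) (t i i')) (t a' a) (S (k := k) (t b b') * t c' c) : k)) *
      α (t i' a')) • s.1 (t b' c') = (if i = b' ∧ c' = j then 1 else 0 : k) • s.1 (t b' c') := by
    intro b' c'
    rw [← contract_A_C ht ht i b' c' j]
    simp only [Finset.sum_smul, mul_comm (α _ : k), mul_comm (uForm k H _ _)]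
  refine (sum_comm₂₂ _).trans ?_
  refine (Fintype.sum_congr _ _ fun b' => Fintype.sum_congr _ _ fun c' => h4 b' c').trans ?_
  clear h1 h2 h3 h4
  simp only [ite_and, ite_smul, one_smul, zero_smul, Finset.sum_ite_irrel, Finset.sum_ite_eq,
    Finset.sum_ite_eq', Finset.mem_univ, if_true, Finset.sum_const_zero]

/-- A preimage of `s` is `∑ qᵢ ⊗ pᵢs`. The action formula suffices, so no ring structure on
`Hom^H(H̄, A)` is needed. -/
theorem bracket_surjective_iff :
    Function.Surjective (bracket k H A) ↔ HasBracketUnit k H A := by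
  constructor
  · intro h
    obtain ⟨z, hz⟩ := h (alphaOne k H A)
    obtain ⟨z, rfl⟩ := Submodule.Quotient.mk_surjective _ z
    obtain ⟨n, q, p, rfl⟩ := exists_tmul_sum z
    refine ⟨n, q, p, fun x => ?_⟩
    have h1 := LinearMap.congr_fun (congrArg Subtype.val hz) x
    rw [← Submodule.mkQ_apply, map_sum, map_sum] at h1
    simp only [Submodule.mkQ_apply, bracket_mk] at h1
    simpa [alphaOne] using h1
  · rintro ⟨n, q, p, h⟩ s
    refine ⟨∑ i, Submodule.Quotient.mk (q i ⊗ₜ[k] actPS k H A (p i) s), Subtype.ext ?_⟩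
    simp only [map_sum, bracket_mk]
    rw [AddSubmonoidClass.coe_finsetSum]
    exact sum_bracket_mulPS h s

/-- A preimage of `r` is `∑ rpᵢ ⊗ qᵢ`, since the coinvariant values of `r` can be pulled out on the
left by `assoc_left`. -/
theorem paren_surjective_iff :
    Function.Surjective (paren k H A) ↔ HasParenUnit k H A := by
  constructor
  · intro h
    obtain ⟨z, hz⟩ := h ((counit (R := k) (A := H)).smulRight 1)
    obtain ⟨z, rfl⟩ := Submodule.Quotient.mk_surjective _ z
    obtain ⟨n, p, q, rfl⟩ := exists_tmul_sum z
    refine ⟨n, p, q, fun x => ?_⟩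
    have h1 := congrArg Subtype.val (LinearMap.congr_fun hz x)
    rw [← Submodule.mkQ_apply, map_sum, map_sum] at h1
    simp only [Submodule.mkQ_apply, paren_mk] at h1
    simpa using h1
  · rintro ⟨n, p, q, h⟩ r
    refine ⟨∑ i, Submodule.Quotient.mk (actRP k H A r (p i) ⊗ₜ[k] q i),
      ext_comatrix fun {N t} ht i j => Subtype.ext ?_⟩
    simp only [map_sum, paren_mk, LinearMap.sum_apply]
    rw [AddSubmonoidClass.coe_finsetSum]
    simp only [LinearMap.codRestrict_apply, actRP, parenFun_entry ht, mulRP_entry ht,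
      Finset.sum_mul, assoc_left _ _ (r _).2, Finset.smul_sum]
    have h1 : ∀ l, (r (t i l) : A) * (∑ f, parenFun (p f).1 (q f).1 (t l j)) =
        if l = j then (r (t i l) : A) else 0 := by
      intro l
      rw [h, ht.counit_eq]
      split_ifs <;> simp
    have h2 : (r (t i j) : A) = ∑ l, (r (t i l) : A) * (∑ f, parenFun (p f).1 (q f).1 (t l j)) := by
      simp [h1]
    rw [h2]
    simp only [parenFun_entry ht, Finset.mul_sum, mul_smul_comm]
    have h3 := Finset.sum_comm (s := (Finset.univ : Finset (Fin N)))
      (t := (Finset.univ : Finset (Fin n × Fin N × Fin N))) (f := fun l z =>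
      (β (t z.2.1 z.2.2) : k) • ((r (t i l) : A) * ((p z.1).1 (t l z.2.1) * (q z.1).1 (t z.2.2 j))))
    simp only [Fintype.sum_prod_type] at h3
    exact h3.symm

end Units

/-! ### Direct summands -/

section Summands

variable {k H A : Type*} [Field k] [NonAssocRing H] [Module k H]
  [SMulCommClass k H H] [IsScalarTower k H H] [Coalgebra k H] [CoquasiHopfAlgebra k H]
  [NonAssocRing A] [Module k A] [SMulCommClass k A A] [IsScalarTower k A A]
  [ComoduleAlgebra k H A]

/-! ### Summands of powers, component by component -/

section Pow

variable {M N : Type*} [AddCommGroup M] [Module k M] [Module (Coinv k H A) M]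
    [IsScalarTower k (Coinv k H A) M] [AddCommGroup N] [Module k N] [Module (Coinv k H A) N]
    [IsScalarTower k (Coinv k H A) N]

theorem rTensor_sum_apply {ι : Type*} (s : Finset ι) (f : ι → M →ₗ[k] N) (x : M ⊗[k] H) :
    (∑ i ∈ s, f i).rTensor H x = ∑ i ∈ s, (f i).rTensor H x := by
  rw [← LinearMap.coe_rTensorHom, map_sum, LinearMap.sum_apply]

theorem coactPow_apply (ρ : M →ₗ[k] M ⊗[k] H) (n : ℕ) (x : Fin n → M) : coactPow ρ n x =
    ∑ i, (LinearMap.single k (fun _ : Fin n => M) i).rTensor H (ρ (x i)) := by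
  simp [coactPow]

theorem proj_coactPow (ρ : M →ₗ[k] M ⊗[k] H) (n : ℕ) (x : Fin n → M) (i : Fin n) :
    (LinearMap.proj (R := k) (φ := fun _ : Fin n => M) i).rTensor H (coactPow ρ n x) = ρ (x i) := by
  rw [coactPow_apply, map_sum, Finset.sum_eq_single i]
  · rw [← LinearMap.rTensor_comp_apply, LinearMap.proj_comp_single_same,
      LinearMap.rTensor_id, LinearMap.id_apply]
  · intro j _ hj
    rw [← LinearMap.rTensor_comp_apply,
      LinearMap.proj_comp_single_ne k _ _ _ hj.symm, LinearMap.rTensor_zero, LinearMap.zero_apply]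
  · simp

theorem coactPow_single (ρ : M →ₗ[k] M ⊗[k] H) (n : ℕ) (x : M) (i : Fin n) :
    coactPow ρ n (Pi.single i x) =
      (LinearMap.single k (fun _ : Fin n => M) i).rTensor H (ρ x) := by
  rw [coactPow_apply, Finset.sum_eq_single i]
  · simp
  · intro j _ hj
    simp [hj]
  · simp

/-- A direct summand of a power in terms of the components of the two maps. -/
theorem isDirectSummand_pow_iff (ρM : M →ₗ[k] M ⊗[k] H) (ρN : N →ₗ[k] N ⊗[k] H) (n : ℕ) :
    IsDirectSummand A ρM (coactPow ρN n) ↔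
      ∃ (f : Fin n → M →ₗ[Coinv k H A] N) (g : Fin n → N →ₗ[Coinv k H A] M),
        (∀ i x, ρN (f i x) = ((f i).restrictScalars k).rTensor H (ρM x)) ∧
        (∀ i x, ρM (g i x) = ((g i).restrictScalars k).rTensor H (ρN x)) ∧
        ∀ x, ∑ i, g i (f i x) = x := by
  constructor
  · rintro ⟨f, g, hf, hg, hgf⟩
    refine ⟨fun i => LinearMap.proj i ∘ₗ f,
      fun i => g ∘ₗ LinearMap.single (Coinv k H A) (fun _ : Fin n => N) i, ?_, ?_, ?_⟩
    · intro i x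
      have h := proj_coactPow ρN n (f x) i
      rw [hf, ← LinearMap.rTensor_comp_apply] at h
      exact h.symm
    · intro i x
      have h := hg (Pi.single i x)
      rw [coactPow_single, ← LinearMap.rTensor_comp_apply] at h
      exact h
    · intro x
      have h := hgf x
      rw [← Finset.univ_sum_single (f x), map_sum] at h
      exact h
  · rintro ⟨f, g, hf, hg, hgf⟩
    refine ⟨LinearMap.pi f, ∑ i, g i ∘ₗ LinearMap.proj i, ?_, ?_, ?_⟩
    · intro x
      rw [coactPow_apply]
      simp only [LinearMap.pi_apply, hf]
      simp only [← LinearMap.rTensor_comp_apply]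
      rw [← rTensor_sum_apply]
      refine congrArg (fun l : M →ₗ[k] (Fin n → N) => l.rTensor H (ρM x)) ?_
      ext y j
      simp [Pi.single_apply]
    · intro x
      rw [coactPow_apply, map_sum]
      simp only [← LinearMap.rTensor_comp_apply]
      simp only [LinearMap.sum_apply, LinearMap.comp_apply, map_sum, LinearMap.proj_apply, hg]
      refine Finset.sum_congr rfl fun i _ => ?_
      refine congrArg (fun l : N →ₗ[k] M => l.rTensor H (ρN (x i))) ?_
      ext y
      simp [Pi.single_apply, apply_ite]
    · intro x
      simpa using hgf x

end Pow

/-! ### `B`-linear colinear maps into and out of `B ⊗ H` -/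

/-- `a ↦ φ(a₀) ⊗ a₁`. -/
def toBH (φ : A →ₗ[Coinv k H A] Coinv k H A) : A →ₗ[Coinv k H A] Coinv k H A ⊗[k] H where
  toFun a := (φ.restrictScalars k).rTensor H (coact k H A a)
  map_add' a b := by simp
  map_smul' b a := by
    rw [coinv_smul_def, coact_coinv_mul a b.2]
    induction coact k H A a with
    | zero => simp
    | add x y hx hy => simp only [map_add, hx, hy, smul_add]
    | tmul x y =>
      simp only [map_tmul, LinearMap.mulLeft_apply, LinearMap.id_apply, LinearMap.rTensor_tmul,
        LinearMap.coe_restrictScalars, RingHom.id_apply, TensorProduct.smul_tmul',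
        ← coinv_smul_def, map_smul]

/-- `b ⊗ h ↦ b p(h)`. -/
def fromBH (p : H →ₗ[k] A) : Coinv k H A ⊗[k] H →ₗ[Coinv k H A] A where
  toFun := TensorProduct.lift ((LinearMap.mul k A).compl₁₂ (Coinv k H A).subtype p)
  map_add' a b := by simp
  map_smul' b x := by
    induction x with
    | zero => simp
    | add x y hx hy => simp only [map_add, hx, hy, smul_add]
    | tmul x y => simp [TensorProduct.smul_tmul', coinv_smul_def, assoc_mid _ _ x.2]

variable (k H A) in
/-- `b ⊗ h ↦ b ε(h)`. -/
def counitBH : Coinv k H A ⊗[k] H →ₗ[Coinv k H A] Coinv k H A :=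
  (AlgebraTensorModule.rid k (Coinv k H A) (Coinv k H A)).toLinearMap ∘ₗ
    AlgebraTensorModule.lTensor (Coinv k H A) (Coinv k H A) (counit (R := k) (A := H))

@[simp] theorem counitBH_tmul (b : Coinv k H A) (h : H) :
    counitBH k H A (b ⊗ₜ[k] h) = counit (R := k) h • b := by
  simp [counitBH]

theorem toBH_apply (φ : A →ₗ[Coinv k H A] Coinv k H A) (a : A) :
    toBH φ a = (φ.restrictScalars k).rTensor H (coact k H A a) := rfl

@[simp] theorem fromBH_tmul (p : H →ₗ[k] A) (b : Coinv k H A) (h : H) :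
    fromBH p (b ⊗ₜ[k] h) = b.1 * p h := rfl

theorem coactBH_tmul (b : Coinv k H A) (h : H) : coactBH k H A (b ⊗ₜ[k] h) =
    (TensorProduct.mk k (Coinv k H A) H b).rTensor H (comul h) := by
  obtain ⟨n, x, y, hxy⟩ := exists_tmul_sum (comul (R := k) h)
  rw [coactBH, LinearMap.comp_apply, LinearMap.lTensor_tmul, hxy, tmul_sum, map_sum, map_sum]
  rfl

theorem toBH_colinear (φ : A →ₗ[Coinv k H A] Coinv k H A) (a : A) :
    coactBH k H A (toBH φ a) = ((toBH φ).restrictScalars k).rTensor H (coact k H A a) := by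
  have h := congrArg (TensorProduct.assoc k A H H).symm
    (ComoduleAlgebra.ρ_coassoc (k := k) (H := H) a)
  rw [LinearEquiv.symm_apply_apply] at h
  have h1 : (toBH φ).restrictScalars k = (φ.restrictScalars k).rTensor H ∘ₗ coact k H A := rfl
  rw [h1, LinearMap.rTensor_comp, LinearMap.comp_apply, h, toBH_apply]
  induction coact k H A a with
  | zero => simp
  | add x y hx hy => simp only [map_add, hx, hy]
  | tmul x y =>
    obtain ⟨n, y, z, hyz⟩ := exists_tmul_sum (comul (R := k) y)
    simp only [LinearMap.rTensor_tmul, LinearMap.lTensor_tmul, coactBH_tmul, hyz, tmul_sum,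
      map_sum, mk_apply, assoc_symm_tmul]

theorem counitBH_coactBH (x : Coinv k H A ⊗[k] H) :
    ((counitBH k H A).restrictScalars k).rTensor H (coactBH k H A x) = x := by
  induction x with
  | zero => simp
  | add x y hx hy => simp only [map_add, hx, hy]
  | tmul b h =>
    have h1 := congrArg (TensorProduct.map (LinearMap.toSpanSingleton k (Coinv k H A) b)
      (LinearMap.id : H →ₗ[k] H)) (Coalgebra.rTensor_counit_comul (R := k) h)
    simp only [map_tmul, LinearMap.toSpanSingleton_apply, one_smul, LinearMap.id_apply] at h1
    refine Eq.trans ?_ h1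
    rw [coactBH_tmul]
    induction comul (R := k) h with
    | zero => simp
    | add x y hx hy => simp only [map_add, hx, hy]
    | tmul y z => simp

/-- Cofreeness of `B ⊗ H`: a colinear map into it is recovered from its composite with `b ⊗ h ↦ b
ε(h)`. -/
theorem eq_toBH {f : A →ₗ[Coinv k H A] Coinv k H A ⊗[k] H}
    (hf : ∀ a, coactBH k H A (f a) = (f.restrictScalars k).rTensor H (coact k H A a)) :
    f = toBH (counitBH k H A ∘ₗ f) := by
  ext a : 1
  rw [toBH_apply, ← counitBH_coactBH (f a), hf, ← LinearMap.rTensor_comp_apply]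
  rfl

theorem fromBH_colinear {p : H →ₗ[k] A} (hp : p ∈ HomP k H A) (x : Coinv k H A ⊗[k] H) :
    coact k H A (fromBH p x) = ((fromBH p).restrictScalars k).rTensor H (coactBH k H A x) := by
  induction x with
  | zero => simp
  | add x y hx hy => simp only [map_add, hx, hy]
  | tmul b h =>
    have h1 := LinearMap.congr_fun (show _ ∘ₗ _ = _ from hp) h
    simp only [LinearMap.coe_comp, Function.comp_apply] at h1
    rw [fromBH_tmul, coact_coinv_mul _ b.2, h1]
    rw [coactBH_tmul]
    induction comul (R := k) h with
    | zero => simp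
    | add x y hx hy => simp only [map_add, hx, hy]
    | tmul y z => simp

/-- As a left `B`-module `B ⊗ H` is generated by `1 ⊗ H`, so `p(h) = g(1 ⊗ h)` determines `g`. -/
theorem exists_eq_fromBH {g : Coinv k H A ⊗[k] H →ₗ[Coinv k H A] A}
    (hg : ∀ x, coact k H A (g x) = (g.restrictScalars k).rTensor H (coactBH k H A x)) :
    ∃ p : HomP k H A, g = fromBH p.1 := by
  refine ⟨⟨g.restrictScalars k ∘ₗ TensorProduct.mk k (Coinv k H A) H 1, ?_⟩, ?_⟩
  · refine LinearMap.ext fun h => (hg _).trans ?_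
    rw [mk_apply, coactBH_tmul, ← LinearMap.rTensor_comp_apply, LinearMap.comp_apply]
  · refine LinearMap.ext fun x => ?_
    induction x with
    | zero => simp
    | add x y hx hy => simp only [map_add, hx, hy]
    | tmul b h =>
      simp only [fromBH_tmul, LinearMap.coe_comp, Function.comp_apply, mk_apply,
        LinearMap.coe_restrictScalars]
      rw [← coinv_smul_def, ← map_smul, TensorProduct.smul_tmul', smul_eq_mul, mul_one]

/-- A dual basis criterion, obtained by substituting the two descriptions of maps into and out of `B
⊗ H`. -/
theorem summand_pow_BH_iff : (∃ n : ℕ, IsDirectSummand A (coact k H A)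
      (coactPow (coactBH k H A) n)) ↔
    ∃ (n : ℕ) (φ : Fin n → A →ₗ[Coinv k H A] Coinv k H A) (p : Fin n → HomP k H A),
      ∀ a, ∑ i, fromBH (p i).1 (toBH (φ i) a) = a := by
  refine exists_congr fun n => ?_
  rw [isDirectSummand_pow_iff]
  constructor
  · rintro ⟨f, g, hf, hg, h⟩
    choose p hp using fun i => exists_eq_fromBH (hg i)
    refine ⟨fun i => counitBH k H A ∘ₗ f i, p, fun a => ?_⟩
    refine Eq.trans (Finset.sum_congr rfl fun i _ => ?_) (h a)
    rw [← hp, ← eq_toBH (hf i)]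
  · rintro ⟨φ, p, h⟩
    exact ⟨fun i => toBH (φ i), fun i => fromBH (p i).1, fun i => toBH_colinear _,
      fun i => fromBH_colinear (p i).2, h⟩

theorem toBH_fromBH_one (φ : A →ₗ[Coinv k H A] Coinv k H A) (p : HomP k H A) (h : H) :
    toBH φ (fromBH p.1 (1 ⊗ₜ[k] h)) = (φ.restrictScalars k ∘ₗ p.1).rTensor H (comul h) := by
  have h1 := LinearMap.congr_fun (show _ ∘ₗ _ = _ from p.2) h
  simp only [LinearMap.coe_comp, Function.comp_apply] at h1
  rw [fromBH_tmul, coinv_coe_one, one_mul, toBH_apply, h1, ← LinearMap.rTensor_comp_apply]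

/-- The composite `B ⊗ H → A → B ⊗ H` sends `1 ⊗ h` to `φ(p(h₁)) ⊗ h₂`. By the counit property,
these sum to the identity exactly when `∑ φᵢ ∘ pᵢ` is `ε` times the unit. -/
theorem summand_pow_A_iff : (∃ n : ℕ, IsDirectSummand A (coactBH k H A)
      (coactPow (coact k H A) n)) ↔
    ∃ (n : ℕ) (φ : Fin n → A →ₗ[Coinv k H A] Coinv k H A) (p : Fin n → HomP k H A),
      ∀ h, ∑ i, φ i ((p i).1 h) = counit (R := k) h • (1 : Coinv k H A) := by
  refine exists_congr fun n => ?_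
  rw [isDirectSummand_pow_iff]
  constructor
  · rintro ⟨f, g, hf, hg, h⟩
    choose p hp using fun i => exists_eq_fromBH (hf i)
    refine ⟨fun i => counitBH k H A ∘ₗ g i, p, fun x => ?_⟩
    rw [← counitBH_tmul, ← h (1 ⊗ₜ[k] x), map_sum]
    refine Finset.sum_congr rfl fun i _ => ?_
    rw [hp i]
    simp
  · rintro ⟨φ, p, h⟩
    refine ⟨fun i => fromBH (p i).1, fun i => toBH (φ i),
      fun i => fromBH_colinear (p i).2, fun i => toBH_colinear _, fun x => ?_⟩
    have h1 : ∀ x : H, ∑ i, toBH (φ i) (fromBH (p i).1 (1 ⊗ₜ[k] x)) = 1 ⊗ₜ[k] x := by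
      intro x
      simp only [toBH_fromBH_one]
      rw [← rTensor_sum_apply]
      have h2 : ∑ i, (φ i).restrictScalars k ∘ₗ (p i).1 =
          LinearMap.toSpanSingleton k (Coinv k H A) 1 ∘ₗ counit (R := k) (A := H) := by
        ext x : 1
        simpa using h x
      rw [h2, LinearMap.rTensor_comp, LinearMap.comp_apply, Coalgebra.rTensor_counit_comul]
      simp
    induction x with
    | zero => simp
    | add x y hx hy => simp only [map_add, Finset.sum_add_distrib, hx, hy]
    | tmul b x =>
      have h2 : b ⊗ₜ[k] x = b • ((1 : Coinv k H A) ⊗ₜ[k] x) := by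
        rw [TensorProduct.smul_tmul', smul_eq_mul, mul_one]
      rw [h2]
      simp only [map_smul]
      rw [← Finset.smul_sum, h1]

/-! ### From `Hom^H(H^S, A)` to `B`-linear maps `A → B` -/

/-- `a ↦ a₀ β(a₁) q(a₂)`. -/
def theta (q : H →ₗ[k] A) : A →ₗ[k] A :=
  TensorProduct.lift (LinearMap.mul k A) ∘ₗ (convL β q).lTensor A ∘ₗ coact k H A

theorem theta_entry {n : ℕ} {v : Fin n → A} {x : Fin n → Fin n → H} (hx : IsComatrix k x)
    (hv : IsCovec k v x) (q : H →ₗ[k] A) (j : Fin n) :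
    theta q (v j) = ∑ a, ∑ b, (β (x a b) : k) • (v a * q (x b j)) := by
  simp [theta, hv j, convL, hx.conv]

/-- The coaction produces the factor `h₁β(h₂)S(h₃)`, which the antipode axiom for `β` turns into
`β(h)1`. -/
theorem theta_mem {q : H →ₗ[k] A} (hq : q ∈ HomQ k H A) (a : A) : theta q a ∈ Coinv k H A := by
  refine LinearMap.congr_fun (f := coact k H A ∘ₗ theta q)
    (g := (TensorProduct.mk k A H).flip 1 ∘ₗ theta q)
    (ext_covec (k := k) (H := H) fun {n v x} hx hv j => ?_) a
  have h1 : ∀ a b, coact k H A (v a * q (x b j)) = ∑ c, ∑ d,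
      (v c * q (x d j)) ⊗ₜ[k] (x c a * S (k := k) (x b d)) := fun a b =>
    coact_mul_sum (hv a) (coact_Q hx hq b j)
  simp only [LinearMap.coe_comp, Function.comp_apply, theta_entry hx hv, map_sum, map_smul, h1,
    Finset.smul_sum, LinearMap.flip_apply, TensorProduct.mk_apply]
  rw [sum_comm₂₂]
  refine Fintype.sum_congr _ _ fun c => Fintype.sum_congr _ _ fun d => ?_
  have h2 := congrArg (fun z : H => (v c * q (x d j)) ⊗ₜ[k] z) (id_betaS_entry hx c d)
  simpa only [TensorProduct.tmul_sum, TensorProduct.tmul_smul] using h2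

/-- `a ↦ a₀ β(a₁) q(a₂)` as a left `B`-linear map to the coinvariants. -/
def thetaB (q : HomQ k H A) : A →ₗ[Coinv k H A] Coinv k H A where
  toFun a := ⟨theta q.1 a, theta_mem q.2 a⟩
  map_add' a b := Subtype.ext (map_add _ _ _)
  map_smul' b a := Subtype.ext (by
    simp only [coinv_smul_def, RingHom.id_apply, smul_eq_mul, coinv_coe_mul]
    simp only [theta, LinearMap.coe_comp, Function.comp_apply, coact_coinv_mul a b.2]
    induction coact k H A a with
    | zero => simp
    | add x y hx hy => simp only [map_add, hx, hy, mul_add]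
    | tmul x y => simp [assoc_left _ _ b.2])

theorem thetaB_coe (q : HomQ k H A) (a : A) : (thetaB q a : A) = theta q.1 a := rfl

/-- Links `(-,-)` to the summand criterion: a solution of its unit equation is a solution of
`summand_pow_A_iff` with each `φᵢ` equal to `thetaB (q i)`. -/
theorem parenFun_eq_theta (p : HomP k H A) (q : HomQ k H A) (h : H) :
    parenFun p.1 q.1 h = theta q.1 (p.1 h) := by
  refine LinearMap.congr_fun (f := parenFun p.1 q.1) (g := theta q.1 ∘ₗ p.1)
    (ext_comatrix fun {n t} ht i j => ?_) h
  rw [parenFun_entry ht, LinearMap.comp_apply, theta_entry ht (covec_P ht p.2 i)]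

theorem fromBH_toBH_covec {n : ℕ} {v : Fin n → A} {x : Fin n → Fin n → H}
    (hv : IsCovec k v x) (φ : A →ₗ[Coinv k H A] Coinv k H A) (p : H →ₗ[k] A) (j : Fin n) :
    fromBH p (toBH φ (v j)) = ∑ i, (φ (v i) : A) * p (x i j) := by
  simp [toBH_apply, hv j]

/-- `∑ (a₀ β(a₁) qᵢ(a₂)) pᵢ(a₃) = a` if `∑ [qᵢ, pᵢ]` is the unit. -/
theorem sum_fromBH_toBH_theta {N : ℕ} {q : Fin N → HomQ k H A} {p : Fin N → HomP k H A}
    (hqp : ∀ h, ∑ i, bracketFun (q i).1 (p i).1 h = (α h : k) • (1 : A)) (a : A) :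
    ∑ i, fromBH (p i).1 (toBH (thetaB (q i)) a) = a := by
  suffices h : ∑ i, (fromBH (p i).1 ∘ₗ toBH (thetaB (q i))).restrictScalars k = LinearMap.id by
    simpa using LinearMap.congr_fun h a
  refine ext_covec (k := k) (H := H) fun {n w y} hy hw j => ?_
  -- Moving the brackets onto `q` and `p` lets the unit equation produce `α`. What is left is
  -- `ω(h₁β(h₂), S(h₃), α(h₄)h₅)`, which is `ε(h)` by an antipode axiom.
  have h1 : ∀ f c a b, (w a * (q f).1 (y b c)) * (p f).1 (y c j) = ∑ a', ∑ b', ∑ c',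
      (ω (y a' a) (S (k := k) (y b b')) (y c' j) : k) •
        (w a' * ((q f).1 (y b' c) * (p f).1 (y c c'))) := fun f c a b =>
    hw.mul_assoc (covec_Q hy (q f).2 c) (covec_P hy (p f).2 c) a b j
  have h2 : ∀ a' b' c', ∑ f, ∑ c, w a' * ((q f).1 (y b' c) * (p f).1 (y c c')) =
      (α (y b' c') : k) • w a' := by
    intro a' b' c'
    have h := hqp (y b' c')
    simp only [bracketFun_entry hy] at h
    simp only [← Finset.mul_sum, h, mul_smul_comm, mul_one]
  simp only [LinearMap.sum_apply, LinearMap.coe_restrictScalars, LinearMap.coe_comp,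
    Function.comp_apply, fromBH_toBH_covec hw, thetaB_coe, theta_entry hy hw, Finset.sum_mul,
    smul_mul_assoc, h1, Finset.smul_sum, smul_smul]
  have h3 := sum_kernel (X := Fin N × Fin n) (Y := Fin n × Fin n) (Z := Fin n × Fin n × Fin n)
    (fun s z => (β (y s.1 s.2) : k) * ω (y z.1 s.1) (S (k := k) (y s.2 z.2.1)) (y z.2.2 j))
    (fun s z => w z.1 * ((q s.1).1 (y z.2.1 s.2) * (p s.1).1 (y s.2 z.2.2)))
  simp only [Fintype.sum_prod_type] at h3
  refine h3.trans ?_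
  simp only [h2, smul_smul]
  have h4 : ∀ a', ∑ b', ∑ c', ((∑ a, ∑ b, (β (y a b) : k) *
      ω (y a' a) (S (k := k) (y b b')) (y c' j)) * α (y b' c')) • w a' =
      (if a' = j then 1 else 0 : k) • w a' := by
    intro a'
    rw [← ω_beta_alpha_entry hy a' j]
    simp only [Finset.sum_smul, mul_comm (α _ : k), mul_comm (β _ : k)]
  refine (Fintype.sum_congr _ _ h4).trans ?_
  simp

end Summands

/-! ### The canonical map -/

section Galois

variable {k H A : Type*} [Field k] [NonAssocRing H] [Module k H]
  [SMulCommClass k H H] [IsScalarTower k H H] [Coalgebra k H] [CoquasiHopfAlgebra k H]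
  [NonAssocRing A] [Module k A] [SMulCommClass k A A] [IsScalarTower k A A]
  [ComoduleAlgebra k H A]

theorem IsCovec.mul {I J : Type} [Fintype I] [Fintype J] {v : I → A} {x : I → I → H} {w : J → A}
    {y : J → J → H} (hv : IsCovec k v x) (hw : IsCovec k w y) :
    IsCovec k (fun s : I × J => v s.1 * w s.2) (fun s s' => x s.1 s'.1 * y s.2 s'.2) := by
  intro s
  rw [coact_mul_sum (hv s.1) (hw s.2), Fintype.sum_prod_type]

variable (k H A) in
/-- `(a, b) ↦ a ⊗_B b`. -/
def tmulB : A →ₗ[k] A →ₗ[k] TensorB k H A :=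
  (TensorProduct.mk k A A).compr₂ (Submodule.mkQ _)

theorem tmulB_balanced (a c : A) {b : A} (hb : b ∈ Coinv k H A) :
    tmulB k H A (a * b) c = tmulB k H A a (b * c) :=
  (Submodule.Quotient.eq _).2 (Submodule.subset_span ⟨a, ⟨b, hb⟩, c, rfl⟩)

theorem ext_tmulB {V : Type*} [AddCommGroup V] [Module k V] {f g : TensorB k H A →ₗ[k] V}
    (h : ∀ a b, f (tmulB k H A a b) = g (tmulB k H A a b)) : f = g := by
  refine Submodule.linearMap_qext _ (TensorProduct.ext' fun a b => h a b)

/-- Reduces identities on `A ⊗_B A` to pairs of covectors, where `can` has the explicit form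
`can_covec`. -/
theorem ext_tmulB_covec {V : Type*} [AddCommGroup V] [Module k V] {f g : TensorB k H A →ₗ[k] V}
    (h : ∀ {n m : ℕ} {v : Fin n → A} {x : Fin n → Fin n → H} {w : Fin m → A}
      {y : Fin m → Fin m → H}, IsComatrix k x → IsCovec k v x → IsComatrix k y → IsCovec k w y →
      ∀ i j, f (tmulB k H A (v i) (w j)) = g (tmulB k H A (v i) (w j))) : f = g := by
  refine ext_tmulB fun a b => ?_
  have h1 : (tmulB k H A).compr₂ f = (tmulB k H A).compr₂ g :=
    ext_covec (k := k) (H := H) fun hx hv i =>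
      ext_covec (k := k) (H := H) fun hy hw j => h hx hv hy hw i j
  exact LinearMap.congr_fun (LinearMap.congr_fun h1 a) b

/-- The linear map on `A ⊗_B A` induced by a balanced bilinear map. -/
def liftB {V : Type*} [AddCommGroup V] [Module k V] (f : A →ₗ[k] A →ₗ[k] V)
    (hf : ∀ (a c : A) (b : Coinv k H A), f (a * b.1) c = f a (b.1 * c)) :
    TensorB k H A →ₗ[k] V :=
  balLift _ _ f fun a b c => hf a c b

theorem can_tmulB (a b : A) : can k H A (tmulB k H A a b) = canBil k H A a b := rfl

theorem can_covec {I : Type} [Fintype I] {v : I → A} {x : I → I → H} {m : ℕ} {w : Fin m → A}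
    {y : Fin m → Fin m → H} (hv : IsCovec k v x) (hy : IsComatrix k y) (hw : IsCovec k w y)
    (i : I) (j : Fin m) : can k H A (tmulB k H A (v i) (w j)) =
      ∑ i', ∑ j', ∑ l, wForm k H (x i' i) (y j' l) • ((v i' * w j') ⊗ₜ[k] y l j) := by
  have h1 : ∀ i' j', canForm k H (x i' i) (y j' j) = ∑ l, wForm k H (x i' i) (y j' l) • y l j := by
    intro i' j'
    simp [canForm, convL, hy.conv]
  simp only [can_tmulB, canBil, LinearMap.compl₁₂_apply, hv i, hw j, map_sum, LinearMap.sum_apply,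
    TensorProduct.map₂_apply_tmul, map_tmul, LinearMap.mul_apply', h1, tmul_sum, tmul_smul]
  exact Finset.sum_comm

/-- `ω(a₁,b₁,S(b₅)) ω⁻¹(a₂,b₂β(b₃),S(b₄)) = ε(a) β(b)` on entries. -/
theorem ω_wForm_entry {n m : ℕ} {x : Fin n → Fin n → H} {y : Fin m → Fin m → H}
    (hx : IsComatrix k x) (hy : IsComatrix k y) (p p' : Fin n) (j d : Fin m) :
    ∑ p₁, ∑ j₁, ∑ l, wForm k H (x p₁ p') (y j₁ l) * ω (x p p₁) (y j j₁) (S (k := k) (y l d)) =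
      if p = p' then (β (y j d) : k) else 0 := by
  simp only [wForm_entry hy, Finset.sum_mul]
  rw [sum_comm₃₂]
  have h1 : ∀ e f, ∑ p₁, ∑ j₁, ∑ l, (β (y e f) : k) * ωInv (x p₁ p') (y j₁ e) (S (k := k) (y f l)) *
      ω (x p p₁) (y j j₁) (S (k := k) (y l d)) =
      if p = p' ∧ j = e ∧ d = f then (β (y e f) : k) else 0 := by
    intro e f
    have h := hx.comat.ω_ωInv hy.comat hy.antipode.comat p p' j e d f
    have h' := congrArg (fun c => (β (y e f) : k) * c) h
    simp only [Finset.mul_sum, mul_ite, mul_one, mul_zero] at h'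
    rw [← h']
    refine Fintype.sum_congr _ _ fun _ => Fintype.sum_congr _ _ fun _ =>
      Fintype.sum_congr _ _ fun _ => ?_
    ring
  simp only [h1, ite_and, Finset.sum_ite_irrel, Finset.sum_ite_eq, Finset.mem_univ, if_true,
    Finset.sum_const_zero]

/-! ### The inverse of the canonical map built from a bracket unit -/

section Inverse

variable {N : ℕ} (q : Fin N → HomQ k H A) (p : Fin N → HomP k H A)

/-- `a ⊗ h ↦ ∑ a qᵢ(h₁) ⊗_B pᵢ(h₂)`. -/
def canInv : A ⊗[k] H →ₗ[k] TensorB k H A :=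
  ∑ i, TensorProduct.lift (tmulB k H A) ∘ₗ (TensorProduct.lift (LinearMap.mul k A)).rTensor A ∘ₗ
    (TensorProduct.assoc k A A A).symm.toLinearMap ∘ₗ (convTmul (q i).1 (p i).1).lTensor A

theorem canInv_entry {n : ℕ} {t : Fin n → Fin n → H} (ht : IsComatrix k t) (a : A) (i j : Fin n) :
    canInv q p (a ⊗ₜ[k] t i j) =
      ∑ f, ∑ l, tmulB k H A (a * (q f).1 (t i l)) ((p f).1 (t l j)) := by
  simp [canInv, ht.convTmul, tmul_sum]

variable {q p}

-- After reassociation, the unit equation replaces `∑ qᵢpᵢ` by `α`. The scalar that remains,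
-- involving `ω`, `α` and the form `w` of `can`, is trivial by `contract_E_B`.
set_option maxHeartbeats 400000 in
theorem can_canInv
    (hqp : ∀ h, ∑ i, bracketFun (q i).1 (p i).1 h = (α h : k) • (1 : A)) :
    can k H A ∘ₗ canInv q p = LinearMap.id := by
  refine TensorProduct.ext (ext_covec (k := k) (H := H) fun {n v x} hx hv e =>
    ext_comatrix fun {m t} ht i j => ?_)
  have h1 : ∀ f l e' a b, (v e' * (q f).1 (t a l)) * (p f).1 (t l b) = ∑ e₁, ∑ a', ∑ b',
      (ω (x e₁ e') (S (k := k) (t a a')) (t b' b) : k) •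
        (v e₁ * ((q f).1 (t a' l) * (p f).1 (t l b'))) := fun f l e' a b =>
    hv.mul_assoc (covec_Q ht (q f).2 l) (covec_P ht (p f).2 l) e' a b
  have h2 : ∀ c e₁ a' b', ∑ f, ∑ l, (v e₁ * ((q f).1 (t a' l) * (p f).1 (t l b'))) ⊗ₜ[k] t c j =
      (α (t a' b') : k) • (v e₁ ⊗ₜ[k] t c j) := by
    intro c e₁ a' b'
    have h := hqp (t a' b')
    simp only [bracketFun_entry ht] at h
    simp only [← TensorProduct.sum_tmul, ← Finset.mul_sum, h, mul_smul_comm, mul_one,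
      TensorProduct.smul_tmul']
  have h3 : ∀ f l, can k H A (tmulB k H A (v e * (q f).1 (t i l)) ((p f).1 (t l j))) =
      ∑ e', ∑ a, ∑ b, ∑ c, ∑ e₁, ∑ a', ∑ b', (wForm k H (x e' e * S (k := k) (t i a)) (t b c) *
        ω (x e₁ e') (S (k := k) (t a a')) (t b' b)) •
        ((v e₁ * ((q f).1 (t a' l) * (p f).1 (t l b'))) ⊗ₜ[k] t c j) := by
    intro f l
    have h := can_covec (hv.mul (covec_Q ht (q f).2 l)) ht (covec_P ht (p f).2 l) (e, i) j
    simp only [Fintype.sum_prod_type] at h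
    refine h.trans ?_
    simp only [h1, TensorProduct.sum_tmul, Finset.smul_sum, ← TensorProduct.smul_tmul', smul_smul]
  change can k H A (canInv q p (v e ⊗ₜ[k] t i j)) = v e ⊗ₜ[k] t i j
  simp only [canInv_entry q p ht, map_sum, h3]
  have h4 := sum_kernel (X := Fin N × Fin m) (Y := Fin n × Fin m × Fin m)
    (Z := Fin m × Fin n × Fin m × Fin m)
    (fun y z => wForm k H (x y.1 e * S (k := k) (t i y.2.1)) (t y.2.2 z.1) *
        ω (x z.2.1 y.1) (S (k := k) (t y.2.1 z.2.2.1)) (t z.2.2.2 y.2.2))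
    (fun s z => (v z.2.1 * ((q s.1).1 (t z.2.2.1 s.2) * (p s.1).1 (t s.2 z.2.2.2))) ⊗ₜ[k] t z.1 j)
  simp only [Fintype.sum_prod_type] at h4
  refine h4.trans ?_
  simp only [h2, smul_smul]
  have h5 : ∀ c e₁, ∑ a', ∑ b', ((∑ e', ∑ a, ∑ b, wForm k H (x e' e * S (k := k) (t i a)) (t b c) *
        (ω (x e₁ e') (S (k := k) (t a a')) (t b' b) : k)) * α (t a' b')) • (v e₁ ⊗ₜ[k] t c j) =
      (if e₁ = e ∧ i = c then 1 else 0 : k) • (v e₁ ⊗ₜ[k] t c j) := by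
    intro c e₁
    rw [← contract_E_B hx ht e₁ e i c]
    simp only [Finset.sum_smul, mul_comm (α _ : k), mul_comm (wForm k H _ _)]
  refine (Fintype.sum_congr _ _ fun c => Fintype.sum_congr _ _ fun e₁ => h5 c e₁).trans ?_
  clear h1 h2 h3 h4 h5
  simp only [ite_and, ite_smul, one_smul, zero_smul, Finset.sum_ite_eq,
    Finset.sum_ite_eq', Finset.mem_univ, if_true]

/-- Reassociating `(a₀b₀)qᵢ(b₁)` cancels the `ω⁻¹` in `can` and leaves `∑ a θ_{qᵢ}(b₀) ⊗ pᵢ(b₁)`.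
The coinvariant factor then crosses the tensor sign, and `sum_fromBH_toBH_theta` rebuilds `b`. -/
theorem canInv_can
    (hqp : ∀ h, ∑ i, bracketFun (q i).1 (p i).1 h = (α h : k) • (1 : A)) :
    canInv q p ∘ₗ can k H A = LinearMap.id := by
  refine ext_tmulB_covec fun {n m v x w y} hx hv hy hw e j => ?_
  have h1 : ∀ f c e' j' l, (v e' * w j') * (q f).1 (y l c) = ∑ e₁, ∑ j₁, ∑ d,
      (ω (x e₁ e') (y j₁ j') (S (k := k) (y l d)) : k) •
        (v e₁ * (w j₁ * (q f).1 (y d c))) := fun f c e' j' l =>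
    hv.mul_assoc hw (covec_Q hy (q f).2 c) e' j' l
  have h2 : ∑ f, ∑ c, tmulB k H A (v e * theta (q f).1 (w c)) ((p f).1 (y c j)) =
      tmulB k H A (v e) (w j) := by
    have h := sum_fromBH_toBH_theta hqp (w j)
    simp only [fromBH_toBH_covec hw, thetaB_coe] at h
    conv_rhs => rw [← h]
    simp only [tmulB_balanced _ _ (theta_mem (q _).2 _), map_sum]
  simp only [LinearMap.coe_comp, Function.comp_apply, can_covec hv hy hw, map_sum, map_smul,
    canInv_entry q p hy, h1, LinearMap.sum_apply, LinearMap.smul_apply, Finset.smul_sum, smul_smul,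
    LinearMap.id_apply]
  rw [sum_comm₃₂]
  have h4 := sum_kernel (X := Fin N × Fin m) (Y := Fin n × Fin m × Fin m)
    (Z := Fin n × Fin m × Fin m)
    (fun s z => wForm k H (x s.1 e) (y s.2.1 s.2.2) *
        ω (x z.1 s.1) (y z.2.1 s.2.1) (S (k := k) (y s.2.2 z.2.2)))
    (fun s z => tmulB k H A (v z.1 * (w z.2.1 * (q s.1).1 (y z.2.2 s.2))) ((p s.1).1 (y s.2 j)))
  simp only [Fintype.sum_prod_type] at h4
  refine h4.trans ?_
  -- The scalars collapse to a single `β`, which is the one occurring in `theta`.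
  simp only [ω_wForm_entry hx hy, ite_smul, zero_smul, Finset.sum_ite_irrel, Finset.sum_ite_eq',
    Finset.mem_univ, if_true, Finset.sum_const_zero]
  rw [← h2]
  simp only [theta_entry hy hw, Finset.mul_sum, mul_smul_comm, map_sum, map_smul,
    LinearMap.sum_apply, LinearMap.smul_apply, Finset.smul_sum]
  rw [sum_comm₂₂]

theorem isGalois_of_unit
    (hqp : ∀ h, ∑ i, bracketFun (q i).1 (p i).1 h = (α h : k) • (1 : A)) :
    IsGalois k H A :=
  Function.bijective_iff_has_inverse.2 ⟨canInv q p,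
    fun z => LinearMap.congr_fun (canInv_can hqp) z,
    fun z => LinearMap.congr_fun (can_canInv hqp) z⟩

end Inverse

end Galois

/-! ### From Galois extensions to the Morita context -/

section Converse

variable {k H A : Type*} [Field k] [NonAssocRing H] [Module k H]
  [SMulCommClass k H H] [IsScalarTower k H H] [Coalgebra k H] [CoquasiHopfAlgebra k H]
  [NonAssocRing A] [Module k A] [SMulCommClass k A A] [IsScalarTower k A A]
  [ComoduleAlgebra k H A]

/-! ### Coactions and induced maps on `A ⊗_B A` -/

variable (k H A) in
/-- `a ⊗_B b ↦ (a ⊗_B b₀) ⊗ b₁`. -/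
def coactRight : TensorB k H A →ₗ[k] TensorB k H A ⊗[k] H :=
  liftB (LinearMap.lcomp k _ (coact k H A) ∘ₗ LinearMap.rTensorHom H ∘ₗ tmulB k H A) <| by
    intro a c b
    change (tmulB k H A (a * b.1)).rTensor H (coact k H A c) =
      (tmulB k H A a).rTensor H (coact k H A (b.1 * c))
    rw [coact_coinv_mul c b.2]
    induction coact k H A c with
    | zero => simp
    | add x y hx hy => simp only [map_add, hx, hy]
    | tmul x y => simp [tmulB_balanced _ _ b.2]

variable (k H A) in
/-- `a ⊗_B b ↦ (a₀ ⊗_B b) ⊗ a₁`. -/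
def coactLeft : TensorB k H A →ₗ[k] TensorB k H A ⊗[k] H :=
  liftB (LinearMap.lcomp k _ (coact k H A) ∘ₗ LinearMap.rTensorHom H ∘ₗ
      (tmulB k H A).flip).flip <| by
    intro a c b
    change ((tmulB k H A).flip c).rTensor H (coact k H A (a * b.1)) =
      ((tmulB k H A).flip (b.1 * c)).rTensor H (coact k H A a)
    rw [coact_mul_coinv a b.2]
    induction coact k H A a with
    | zero => simp
    | add x y hx hy => simp only [map_add, hx, hy]
    | tmul x y => simp [tmulB_balanced _ _ b.2]

theorem coactRight_tmulB (a b : A) : coactRight k H A (tmulB k H A a b) =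
    (tmulB k H A a).rTensor H (coact k H A b) := rfl

theorem coactLeft_tmulB (a b : A) : coactLeft k H A (tmulB k H A a b) =
    ((tmulB k H A).flip b).rTensor H (coact k H A a) := rfl

variable (k H A) in
/-- `a ⊗_B b ↦ ab`. -/
def multB : TensorB k H A →ₗ[k] A :=
  liftB (LinearMap.mul k A) fun a c b => assoc_mid a c b.2

/-- `a ⊗_B b ↦ a φ(b)`. -/
def applyB (φ : A →ₗ[Coinv k H A] Coinv k H A) : TensorB k H A →ₗ[k] A :=
  liftB ((LinearMap.mul k A).compl₂ ((Coinv k H A).subtype ∘ₗ φ.restrictScalars k)) <| by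
    intro a c b
    simp only [LinearMap.compl₂_apply, LinearMap.coe_comp, Function.comp_apply,
      LinearMap.coe_restrictScalars, Submodule.subtype_apply, LinearMap.mul_apply',
      ← coinv_smul_def, map_smul]
    rw [smul_eq_mul, coinv_coe_mul, assoc_mid _ _ b.2]

@[simp] theorem applyB_tmulB (φ : A →ₗ[Coinv k H A] Coinv k H A) (a b : A) :
    applyB φ (tmulB k H A a b) = a * (φ b : A) := rfl

variable (k H A) in
/-- The diagonal coaction `a ⊗ h ↦ (a₀ ⊗ h₂) ⊗ a₁S(h₁)`. -/
def coactDiag : A ⊗[k] H →ₗ[k] (A ⊗[k] H) ⊗[k] H :=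
  (TensorProduct.lift (LinearMap.mul k H)).lTensor (A ⊗[k] H) ∘ₗ
    (TensorProduct.tensorTensorTensorComm k A H H H).toLinearMap ∘ₗ
      TensorProduct.map (coact k H A) (coactS k H)

theorem coactDiag_entry {I : Type} [Fintype I] {v : I → A} {x : I → I → H} {m : ℕ}
    {t : Fin m → Fin m → H} (hv : IsCovec k v x) (ht : IsComatrix k t) (e : I) (i j : Fin m) :
    coactDiag k H A (v e ⊗ₜ[k] t i j) =
      ∑ e', ∑ a, (v e' ⊗ₜ[k] t a j) ⊗ₜ[k] (x e' e * S (k := k) (t i a)) := by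
  simp only [coactDiag, LinearMap.coe_comp, Function.comp_apply, map_tmul, hv e, coactS_entry ht,
    TensorProduct.sum_tmul, TensorProduct.tmul_sum, map_sum, LinearEquiv.coe_coe,
    tensorTensorTensorComm_tmul, LinearMap.lTensor_tmul, lift.tmul, LinearMap.mul_apply']
  exact Finset.sum_comm

/-- Coacting on the left tensor factor corresponds to the diagonal coaction with `H^S` on the second
factor; the required identity is `wForm_colinear`. -/
theorem can_coactLeft : (can k H A).rTensor H ∘ₗ coactLeft k H A =
    coactDiag k H A ∘ₗ can k H A := by
  refine ext_tmulB_covec fun {n m v x w y} hx hv hy hw e j => ?_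
  have h1 : ∀ e₁ j₁ l, coactDiag k H A ((v e₁ * w j₁) ⊗ₜ[k] y l j) = ∑ e', ∑ j', ∑ a,
      ((v e' * w j') ⊗ₜ[k] y a j) ⊗ₜ[k] ((x e' e₁ * y j' j₁) * S (k := k) (y l a)) := by
    intro e₁ j₁ l
    have h := coactDiag_entry (hv.mul hw) hy (e₁, j₁) l j
    simpa only [Fintype.sum_prod_type] using h
  have h2 : ∀ e' j' a, ∑ e₁, ∑ j₁, ∑ l, wForm k H (x e₁ e) (y j₁ l) •
      (((v e' * w j') ⊗ₜ[k] y a j) ⊗ₜ[k] ((x e' e₁ * y j' j₁) * S (k := k) (y l a))) =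
      ∑ s, wForm k H (x e' s) (y j' a) • (((v e' * w j') ⊗ₜ[k] y a j) ⊗ₜ[k] x s e) := by
    intro e' j' a
    have h := congrArg (fun c : H => ((v e' * w j') ⊗ₜ[k] y a j) ⊗ₜ[k] c)
      (wForm_colinear hx hy e' e j' a)
    simpa only [TensorProduct.tmul_sum, TensorProduct.tmul_smul] using h
  simp only [LinearMap.coe_comp, Function.comp_apply, coactLeft_tmulB, hv e, map_sum,
    LinearMap.rTensor_tmul, LinearMap.flip_apply, can_covec hv hy hw, map_smul, h1,
    Finset.smul_sum, TensorProduct.sum_tmul, ← TensorProduct.smul_tmul']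
  rw [sum_comm₃₃]
  simp only [h2]
  exact (sum_comm₃₁ _).symm

/-- The last leg of `b` passes through `can` untouched, so coassociativity suffices. -/
theorem can_coactRight : (can k H A).rTensor H ∘ₗ coactRight k H A =
    ((TensorProduct.assoc k A H H).symm.toLinearMap ∘ₗ (comul (R := k) (A := H)).lTensor A) ∘ₗ
      can k H A := by
  refine ext_tmulB_covec fun {n m v x w y} hx hv hy hw e j => ?_
  simp only [LinearMap.coe_comp, Function.comp_apply, coactRight_tmulB, hw j, map_sum,
    LinearMap.rTensor_tmul, can_covec hv hy hw, map_smul, LinearMap.lTensor_tmul, hy.comul_eq,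
    Finset.smul_sum, TensorProduct.sum_tmul, TensorProduct.tmul_sum, ← TensorProduct.smul_tmul',
    LinearEquiv.coe_coe, assoc_symm_tmul]
  rw [← sum_comm₃₁]

/-! ### The multiplication of `A` through the canonical map -/

variable (k H) in
/-- `(x, h) ↦ α(h₂) ω(x, S(h₁), h₃)`. -/
def alphaForm : H →ₗ[k] H →ₗ[k] k :=
  (conv (LinearMap.lflip.toLinearMap ∘ₗ (ω (k := k) (H := H)).flip) S (convL α LinearMap.id)).flip

theorem alphaForm_entry {n : ℕ} {t : Fin n → Fin n → H} (ht : IsComatrix k t) (x : H)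
    (i j : Fin n) : alphaForm k H x (t i j) =
      ∑ a, ∑ b, (α (t a b) : k) * ω x (S (k := k) (t i a)) (t b j) := by
  simp [alphaForm, convL, ht.conv]

variable (k H A) in
/-- `a ⊗ h ↦ a₀ α(h₂) ω(a₁, S(h₁), h₃)`. -/
def alphaMap : A ⊗[k] H →ₗ[k] A :=
  (TensorProduct.rid k A).toLinearMap ∘ₗ (TensorProduct.lift (alphaForm k H)).lTensor A ∘ₗ
    (TensorProduct.assoc k A H H).toLinearMap ∘ₗ (coact k H A).rTensor H

theorem alphaMap_entry {I : Type} [Fintype I] {v : I → A} {x : I → I → H}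
    (hv : IsCovec k v x) (e : I) (h : H) :
    alphaMap k H A (v e ⊗ₜ[k] h) = ∑ e', alphaForm k H (x e' e) h • v e' := by
  simp [alphaMap, hv e, TensorProduct.sum_tmul]

theorem alphaMap_one (h : H) : alphaMap k H A (1 ⊗ₜ[k] h) = (α h : k) • (1 : A) := by
  refine LinearMap.congr_fun (f := alphaMap k H A ∘ₗ TensorProduct.mk k A H 1)
    (g := (α : H →ₗ[k] k).smulRight (1 : A)) (ext_comatrix fun {n t} ht i j => ?_) h
  have h1 := alphaMap_entry (covec_coinv (k := k) (H := H) (A := A) one_mem_coinv) 0 (t i j)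
  refine h1.trans ?_
  simp only [Finset.univ_unique, Finset.sum_singleton, LinearMap.smulRight_apply,
    alphaForm_entry ht]
  congr 1
  have h2 : ∀ a b, (ω (1 : H) (S (k := k) (t i a)) (t b j) : k) = if a = i ∧ b = j then 1 else 0 :=
    fun a b => ω_one_left ht.antipode ht a i b j
  simp [h2, ite_and]

/-- The multiplication of `A` in terms of the canonical map. -/
theorem alphaMap_can : alphaMap k H A ∘ₗ can k H A = multB k H A := by
  refine ext_tmulB_covec fun {n m v x w y} hx hv hy hw e j => ?_
  have h1 : ∀ e₁ j₁ l, alphaMap k H A ((v e₁ * w j₁) ⊗ₜ[k] y l j) = ∑ e', ∑ j',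
      (∑ a, ∑ b, (α (y a b) : k) * ω (x e' e₁ * y j' j₁) (S (k := k) (y l a)) (y b j)) •
        (v e' * w j') := by
    intro e₁ j₁ l
    have h := alphaMap_entry (hv.mul hw) (e₁, j₁) (y l j)
    simpa only [Fintype.sum_prod_type, alphaForm_entry hy] using h
  -- The scalars from `can` and from `alphaMap` cancel each other; this is what `contract_B_E`
  -- provides.
  have h2 : ∀ e' j', ∑ e₁, ∑ j₁, ∑ l, (wForm k H (x e₁ e) (y j₁ l) *
      (∑ a, ∑ b, (α (y a b) : k) * ω (x e' e₁ * y j' j₁) (S (k := k) (y l a)) (y b j))) =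
      if e' = e ∧ j' = j then 1 else 0 := by
    intro e' j'
    rw [← contract_B_E hx hy e' e j' j]
    simp only [Finset.mul_sum]
    rw [sum_comm₃₂]
    refine Fintype.sum_congr _ _ fun _ => Fintype.sum_congr _ _ fun _ =>
      Fintype.sum_congr _ _ fun _ => Fintype.sum_congr _ _ fun _ =>
      Fintype.sum_congr _ _ fun _ => ?_
    ring
  simp only [LinearMap.coe_comp, Function.comp_apply, can_covec hv hy hw, map_sum, map_smul, h1,
    Finset.smul_sum, smul_smul]
  rw [sum_comm₃₂]
  simp only [← Finset.sum_smul, h2]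
  change _ = v e * w j
  simp only [ite_and, ite_smul, one_smul, zero_smul, Finset.sum_ite_irrel, Finset.sum_ite_eq',
    Finset.mem_univ, if_true, Finset.sum_const_zero]

/-- The values of `φ` are coinvariant, so in `aφ(b)` only `a` contributes to the coaction. -/
theorem coact_applyB (φ : A →ₗ[Coinv k H A] Coinv k H A) :
    coact k H A ∘ₗ applyB φ = (applyB φ).rTensor H ∘ₗ coactLeft k H A := by
  refine ext_tmulB fun a b => ?_
  rw [LinearMap.comp_apply, LinearMap.comp_apply, coactLeft_tmulB, applyB_tmulB,
    coact_mul_coinv _ (φ b).2, ← LinearMap.rTensor_comp_apply]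
  rfl

theorem coactDiag_one (h : H) : coactDiag k H A (1 ⊗ₜ[k] h) =
    (TensorProduct.mk k A H 1).rTensor H (coactS k H h) := by
  refine LinearMap.congr_fun (f := coactDiag k H A ∘ₗ TensorProduct.mk k A H 1)
    (g := (TensorProduct.mk k A H 1).rTensor H ∘ₗ coactS k H)
    (ext_comatrix fun {n t} ht i j => ?_) h
  have h1 := coactDiag_entry (covec_coinv (k := k) (H := H) (A := A) one_mem_coinv) ht 0 i j
  refine h1.trans ?_
  simp [coactS_entry ht]

/-! ### A bracket unit from the inverse of the canonical map -/

section FromGalois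

/-- The inverse of the canonical map of a Galois extension. -/
def canSymm (hG : IsGalois k H A) : A ⊗[k] H →ₗ[k] TensorB k H A :=
  (LinearEquiv.ofBijective (can k H A) hG).symm.toLinearMap

theorem can_canSymm (hG : IsGalois k H A) (x : A ⊗[k] H) : can k H A (canSymm hG x) = x :=
  (LinearEquiv.ofBijective (can k H A) hG).apply_symm_apply x

theorem rTensor_can_injective (hG : IsGalois k H A) :
    Function.Injective ((can k H A).rTensor H) :=
  ((LinearEquiv.ofBijective (can k H A) hG).rTensor H).injective

/-- Transports `can_coactLeft` to the inverse. At `x = 1 ⊗ h` the diagonal coaction is that of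
`H^S`, which makes `translationQ` colinear. -/
theorem coactLeft_canSymm (hG : IsGalois k H A) (x : A ⊗[k] H) :
    coactLeft k H A (canSymm hG x) =
    (canSymm hG).rTensor H (coactDiag k H A x) := by
  refine rTensor_can_injective hG ?_
  have h1 : can k H A ∘ₗ canSymm hG = LinearMap.id := LinearMap.ext (can_canSymm hG)
  rw [← LinearMap.rTensor_comp_apply, h1, LinearMap.rTensor_id, LinearMap.id_apply]
  refine (LinearMap.congr_fun can_coactLeft (canSymm hG x)).trans ?_
  rw [LinearMap.comp_apply, can_canSymm]

theorem coactRight_canSymm_one (hG : IsGalois k H A) (h : H) :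
    coactRight k H A (canSymm hG (1 ⊗ₜ[k] h)) =
    (canSymm hG ∘ₗ TensorProduct.mk k A H 1).rTensor H (comul h) := by
  refine rTensor_can_injective hG ?_
  have h1 : can k H A ∘ₗ canSymm hG = LinearMap.id := LinearMap.ext (can_canSymm hG)
  rw [← LinearMap.rTensor_comp_apply, ← LinearMap.comp_assoc, h1, LinearMap.id_comp]
  refine (LinearMap.congr_fun can_coactRight (canSymm hG (1 ⊗ₜ[k] h))).trans ?_
  rw [LinearMap.comp_apply, can_canSymm, LinearMap.comp_apply, LinearMap.lTensor_tmul]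
  obtain ⟨n, y, z, hyz⟩ := exists_tmul_sum (comul (R := k) h)
  simp [hyz, tmul_sum]

/-- `h ↦ l φ(r)`, where `l ⊗_B r = can⁻¹(1 ⊗ h)`. -/
def translationQ (hG : IsGalois k H A) (φ : A →ₗ[Coinv k H A] Coinv k H A) : HomQ k H A :=
  ⟨applyB φ ∘ₗ canSymm hG ∘ₗ TensorProduct.mk k A H 1, by
    refine LinearMap.ext fun h => ?_
    refine (LinearMap.congr_fun (coact_applyB φ) (canSymm hG (1 ⊗ₜ[k] h))).trans ?_
    rw [LinearMap.comp_apply, coactLeft_canSymm, coactDiag_one, ← LinearMap.rTensor_comp_apply,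
      ← LinearMap.rTensor_comp_apply, LinearMap.comp_apply, LinearMap.comp_assoc]⟩

/-- On `a ⊗ b` the left side is `∑ (aφᵢ(b₀))pᵢ(b₁)`. Associativity around the coinvariant `φᵢ(b₀)`
and the dual basis equation give `ab`. -/
theorem sum_applyB_mul {N : ℕ} {φ : Fin N → A →ₗ[Coinv k H A] Coinv k H A}
    {p : Fin N → HomP k H A} (h : ∀ a, ∑ i, fromBH (p i).1 (toBH (φ i) a) = a)
    (z : TensorB k H A) :
    ∑ i, TensorProduct.lift ((LinearMap.mul k A).compl₂ (p i).1)
      ((applyB (φ i)).rTensor H (coactRight k H A z)) = multB k H A z := by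
  suffices hh : ∑ i, TensorProduct.lift ((LinearMap.mul k A).compl₂ (p i).1) ∘ₗ
      (applyB (φ i)).rTensor H ∘ₗ coactRight k H A = multB k H A by
    simpa using LinearMap.congr_fun hh z
  refine ext_tmulB fun a b => ?_
  simp only [LinearMap.sum_apply, LinearMap.comp_apply, coactRight_tmulB]
  change _ = a * b
  conv_rhs => rw [← h b, Finset.mul_sum]
  refine Finset.sum_congr rfl fun i _ => ?_
  rw [toBH_apply]
  induction coact k H A b with
  | zero => simp
  | add x y hx hy => simp only [map_add, hx, hy, mul_add]
  | tmul x y => simp [assoc_mid _ _ (φ i x).2]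

theorem hasBracketUnit_of_isGalois (hG : IsGalois k H A) {N : ℕ}
    {φ : Fin N → A →ₗ[Coinv k H A] Coinv k H A}
    {p : Fin N → HomP k H A} (h : ∀ a, ∑ i, fromBH (p i).1 (toBH (φ i) a) = a) :
    HasBracketUnit k H A := by
  refine ⟨N, fun i => translationQ hG (φ i), p, fun x => ?_⟩
  have h1 := sum_applyB_mul h (canSymm hG (1 ⊗ₜ[k] x))
  -- Multiplying together the two factors of the preimage of `1 ⊗ x` gives `α(x)1`.
  rw [← alphaMap_can, LinearMap.comp_apply, can_canSymm, alphaMap_one] at h1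
  rw [← h1]
  refine Finset.sum_congr rfl fun i _ => ?_
  -- By right colinearity, coacting on the second factor of that preimage amounts to splitting `x`
  -- into `x₁` and `x₂`, so both sides become sums over the comultiplication of `x`.
  rw [coactRight_canSymm_one, ← LinearMap.rTensor_comp_apply, bracketFun, conv, convTmul,
    LinearMap.comp_apply, LinearMap.comp_apply]
  change TensorProduct.lift _ (TensorProduct.map (applyB (φ i) ∘ₗ _) _ _) = _
  induction comul (R := k) x with
  | zero => simp
  | add x y hx hy => simp only [map_add, hx, hy]
  | tmul x y => simp

end FromGalois

theorem hasBracketUnit_iff : HasBracketUnit k H A ↔ IsGalois k H A ∧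
    ∃ n : ℕ, IsDirectSummand A (coact k H A) (coactPow (coactBH k H A) n) := by
  rw [summand_pow_BH_iff]
  constructor
  · rintro ⟨n, q, p, h⟩
    exact ⟨isGalois_of_unit h, n, fun i => thetaB (q i), p, sum_fromBH_toBH_theta h⟩
  · rintro ⟨hG, n, φ, p, h⟩
    exact hasBracketUnit_of_isGalois hG h

/-- The bracket unit makes every `B`-linear map `A → B` a `theta` of some colinear `q`, so solutions
of `summand_pow_A_iff` come from the pairing. -/
theorem hasParenUnit_iff (hB : HasBracketUnit k H A) : HasParenUnit k H A ↔
    ∃ n : ℕ, IsDirectSummand A (coactBH k H A) (coactPow (coact k H A) n) := by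
  rw [summand_pow_A_iff]
  constructor
  · rintro ⟨n, p, q, h⟩
    refine ⟨n, fun i => thetaB (q i), p, fun x => Subtype.ext ?_⟩
    rw [AddSubmonoidClass.coe_finsetSum]
    simp only [thetaB_coe, ← parenFun_eq_theta]
    exact h x
  · rintro ⟨n, φ, p, h⟩
    obtain ⟨N, q', p', h'⟩ := hB
    -- Apply `φ j` to `a = ∑ θ_{q'ᵢ}(a₀)p'ᵢ(a₁)`. By `B`-linearity this is `∑
    -- θ_{q'ᵢ}(a₀)φⱼ(p'ᵢ(a₁))`, and `assoc_right` absorbs the last, coinvariant factor into `q'ᵢ`.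
    have key : ∀ j a, theta (∑ i, actQR k H A (q' i) ((φ j).restrictScalars k ∘ₗ (p' i).1)).1 a =
        (φ j a : A) := by
      intro j a
      refine LinearMap.congr_fun (g := (Coinv k H A).subtype ∘ₗ (φ j).restrictScalars k)
        (ext_covec (k := k) (H := H) fun {m w y} hy hw e => ?_) a
      have h1 := congrArg (fun b => (φ j b : A)) (sum_fromBH_toBH_theta h' (w e))
      simp only [fromBH_toBH_covec hw, map_sum, ← coinv_smul_def, map_smul] at h1
      refine Eq.trans ?_ h1
      rw [theta_entry hy hw]
      simp only [AddSubmonoidClass.coe_finsetSum, actQR, LinearMap.sum_apply, mulQR_entry hy,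
        smul_eq_mul, coinv_coe_mul, thetaB_coe, theta_entry hy hw, Finset.mul_sum,
        Finset.sum_mul, Finset.smul_sum, smul_mul_assoc, ← assoc_right _ _ (φ j _).2,
        LinearMap.comp_apply, LinearMap.coe_restrictScalars]
      rw [sum_comm₂₂]
    refine ⟨n, p, fun j => ∑ i, actQR k H A (q' i) ((φ j).restrictScalars k ∘ₗ (p' i).1),
      fun x => ?_⟩
    have h2 := congrArg (Coinv k H A).subtype (h x)
    rw [map_sum] at h2
    simp only [parenFun_eq_theta, key]
    exact h2

theorem isStrict_iff : IsStrict k H A ↔ HasBracketUnit k H A ∧ HasParenUnit k H A := by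
  rw [IsStrict, bracket_surjective_iff, paren_surjective_iff, and_comm]

/-- The two convolution identities of a cleaving pair are the two unit equations with families of
length one. -/
theorem isStrict_of_isCleft (h : IsCleft k H A) : IsStrict k H A := by
  obtain ⟨γ, δ, hγ, hδ, h1, h2⟩ := h
  have hγ' : γ ∈ HomP k H A := LinearMap.ext hγ
  have hδ' : δ ∈ HomQ k H A := by
    refine LinearMap.ext fun x => (hδ x).trans ?_
    simp only [coactS, convTmul, LinearMap.comp_apply, LinearEquiv.coe_coe]
    induction comul (R := k) x with
    | zero => simp
    | add x y hx hy => simp only [map_add, hx, hy]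
    | tmul x y => simp
  exact isStrict_iff.2 ⟨⟨1, fun _ => ⟨δ, hδ'⟩, fun _ => ⟨γ, hγ'⟩,
    fun x => by simpa [bracketFun] using h1 x⟩,
    ⟨1, fun _ => ⟨γ, hγ'⟩, fun _ => ⟨δ, hδ'⟩, fun x => by simpa [parenFun] using h2 x⟩⟩

end Converse

end CoquasiHopf

end

theorem theorem31 {k H A : Type*} [Field k] [NonAssocRing H] [Module k H]
    [SMulCommClass k H H] [IsScalarTower k H H] [Coalgebra k H]
    [CoquasiHopf.CoquasiHopfAlgebra k H]
    [NonAssocRing A] [Module k A] [SMulCommClass k A A] [IsScalarTower k A A]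
    [CoquasiHopf.ComoduleAlgebra k H A] :
    (Function.Surjective (CoquasiHopf.bracket k H A) ↔
      CoquasiHopf.IsGalois k H A ∧
        ∃ n : ℕ, CoquasiHopf.IsDirectSummand A (CoquasiHopf.coact k H A)
          (CoquasiHopf.coactPow (CoquasiHopf.coactBH k H A) n)) ∧
    (CoquasiHopf.IsStrict k H A ↔
      CoquasiHopf.IsGalois k H A ∧
        ∃ n m : ℕ,
          CoquasiHopf.IsDirectSummand A (CoquasiHopf.coact k H A)
            (CoquasiHopf.coactPow (CoquasiHopf.coactBH k H A) n) ∧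
          CoquasiHopf.IsDirectSummand A (CoquasiHopf.coactBH k H A)
            (CoquasiHopf.coactPow (CoquasiHopf.coact k H A) m)) ∧
    (CoquasiHopf.IsCleft k H A → CoquasiHopf.IsStrict k H A) := by
  refine ⟨CoquasiHopf.bracket_surjective_iff.trans CoquasiHopf.hasBracketUnit_iff, ?_,
    CoquasiHopf.isStrict_of_isCleft⟩
  -- The pairing criterion is available only in the presence of a bracket unit, hence the congruence
  -- under the first conjunct.
  rw [CoquasiHopf.isStrict_iff, and_congr_right CoquasiHopf.hasParenUnit_iff,
    CoquasiHopf.hasBracketUnit_iff, and_assoc]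
  simp only [exists_and_left, exists_and_right]
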